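/- **Setting.** Let $\mathcal P$ be an infinite set of processes. A block is $B=(h,\overline{\mathsf{tx}},\pi,\sigma)$ (parent hash, list of transactions, resource commitment, signature); a chain is a list of blocks starting with the genesis block $B_0$, linked by a collision-free hash function; signatures are ideal. $C[0{:}h]$ consists of the blocks of heights $0,\dots,h$, and $C[{:}{-}k]$ of all blocks but the last $k$. A validation predicate $\mathbb P(C,\overline{\mathsf{tx}})$ is given which accepts the empty list and never accepts a list that repeats a transaction or contains one already in $C$. The resource is virtual: $\mathrm{StateAlloc}(p,C)\in\mathbb N$ is a function of the sequence of transactions in $C$, and $\sum_p \mathrm{StateAlloc}(p,C)=R$ always. In time slot $t=0,1,2,\dots$ a process $p$ may commit to a valid chain $C$; the resource allocator then assigns it a commitment $\pi=(p,t)$ with probability $1-(1-\varrho)^{\mathrm{StateAlloc}(p,C_t)}$, where $0<\varrho<1$ and $C_t$ is the part of $C$ made of the blocks of slots $\le \mathrm{cutoff}(t)$, for a given function with $\mathrm{cutoff}(t)\to\infty$ (e.g. $\mathrm{cutoff}(t)=t$, or $(\lfloor t/q\rfloor-2)q$ for the stake distribution two epochs before); distinct triples $(p,C_t,t)$ use independent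 randomness, repeated ones the same. A chain is valid if it starts with $B_0$ and every further block has the hash of its predecessor, transactions accepted by $\mathbb P$, a signature by the process named in its commitment, a commitment that the allocator assigned for its predecessor chain, and a later slot than its predecessor. Each correct process runs the longest-chain protocol (Algorithm 1): starting from $[B_0]$, it collects gossiped transactions, accepts gossiped valid blocks whose parent chain it knows (and gossips a request for the parents otherwise; those who know the requested chain gossip its blocks), replaces its local chain whenever a strictly longer valid chain becomes known, then a-delivers in order all not yet delivered transactions of $C_{\mathsf{local}}[{:}{-}k]$, and commits, in the name of its resource, to a new block of valid pending transactions on top of $C_{\mathsf{local}}$; when assigned a commitment it signs and gossips the block, otherwise it retries in the next time step. The adversary chooses who joins, what correct processes a-broadcast, and the order and time of deliveries, subject to: what a correct process gossips at time $s$ is delivered to every correct process that has joined by time $s$, by time $s+\Delta$ ($\Delta\ge1$). It may send own messages to any processes, and it may corrupt processes that have joined, as long as at each moment of corruption all corrupted processes together hold at most $R_{\mathcal A}$ according to the local chain of each process correct until then. It signs for corrupted processes and lets each of them commit to at most one chain per time step. It is called admissible if it obeys these rules in all executions and in the $n$-th step causes only a polynomially (in $n$) bounded number of joins, inputs and own messages.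 Total-order broadcast means: *validity* (a valid transaction a-broadcast by a correct process is eventually a-delivered by it), *no duplication*, *agreement* (a transaction a-delivered by some correct process is eventually a-delivered by every correct process), and *total order* (if correct $p$, $q$ both a-deliver $\mathsf{tx}_1$ and $\mathsf{tx}_2$, and $p$ a-delivers $\mathsf{tx}_1$ before $\mathsf{tx}_2$, then so does $q$). **Theorem.** Let $2R_{\mathcal A}\le R$. Consider any configuration that can occur in an execution of the protocol and in which all correct processes have the same local chain $C$. Suppose that a *virtual-resource-shifting event* has occurred on $C$: there are heights $h_0<h_1<|C|$ and a finite set $\mathcal P_{\mathsf{maj}}$ of processes with $$\sum_{p\in\mathcal P_{\mathsf{maj}}}\mathrm{StateAlloc}(p,C[0{:}h_0])>R-R_{\mathcal A},\qquad \sum_{p\in\mathcal P_{\mathsf{maj}}}\mathrm{StateAlloc}(p,C[0{:}h_1])\le R_{\mathcal A}.$$ Let $A\supseteq \mathcal P_{\mathsf{maj}}$ be a finite set of processes that have joined, containing all those already corrupted, but not all that have joined, which uses exactly the adversary's budget: $\sum_{p\in A}\mathrm{StateAlloc}(p,C')=R_{\mathcal A}$ for $C'=C$ and for every $C'$ arising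 from $C$ by appending blocks of valid transactions that are pending at, or in transit from and to, processes outside $A$ (so that the processes outside $A$ hold $R-R_{\mathcal A}$ on the honest chain). Then: 1. (Long-range attack.) Let $S$ be any set of processes outside $A$ that have joined, and let $\ell$ be any list of transactions (e.g. the empty one) with $\mathbb P(C[0{:}h_0],\ell)$ such that $\mathcal P_{\mathsf{maj}}$ still holds more than $R-R_{\mathcal A}$ after executing $\ell$ on top of $C[0{:}h_0]$. There is an admissible adversary such that in the continued execution, with probability one, at some time there is a valid chain $C^*$ that extends $C[0{:}h_0]$ but not $C[0{:}h_0+1]$, with $|C^*|>h_0+1+k$, all of whose blocks above height $h_0$ are made by corrupted processes, the block at height $h_0+1$ containing $\ell$, and such that $C^*$ is the local chain of all processes in $S$ and of a newly joined process, all of them correct, although these have received all blocks of the local chains of all correct processes, while all other correct processes have strictly shorter local chains; the adopting processes have a-delivered all transactions of $C^*[{:}{-}k]$. Moreover, with probability one, total order is violated whenever some process outside $A$ that had joined had a-delivered two transactions $\mathsf{tx}_1$ before $\mathsf{tx}_2$ in the given configuration, and $\ell$ contains $\mathsf{tx}_2$ before $\mathsf{tx}_1$. 2. (Total-order broadcast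 is not guaranteed.) For every $\varepsilon>0$ there is an admissible adversary such that in the continued execution the properties of total-order broadcast hold with probability at most $\varepsilon$, and in fact agreement holds with probability at most $\varepsilon$. -/

import Mathlib

open MeasureTheory Filter

noncomputable section

section Model

variable {P Tx Hash Rnd : Type*}

/-- A block `(h, txs, π, σ)`. Here `none` is `⊥`, the resource commitment `π = (p, sl)` names the
process to which the allocator assigned it and the slot of the assignment, and the (ideal)
signature is represented by the name of its signer. -/
structure Block (P Tx Hash : Type*) where
  parent : Option Hash
  txs : List Tx
  proof : Option (P × ℕ)
  sig : Option P

/-- A blockchain, genesis block first. -/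
abbrev Chain (P Tx Hash : Type*) := List (Block P Tx Hash)

/-- The transactions included in a chain, in order. -/
def txsOf (C : Chain P Tx Hash) : List Tx := C.flatMap Block.txs

/-- The blocks of `C` up to height `h`, the genesis block having height `0`. -/
def upTo (C : Chain P Tx Hash) (h : ℕ) : Chain P Tx Hash := C.take (h + 1)

/-- The chain without its last `k` blocks. -/
def dropLastK (C : Chain P Tx Hash) (k : ℕ) : Chain P Tx Hash := C.take (C.length - k)

/-- A query for randomness: process, part of the chain from which leaders are drawn, slot. -/
abbrev Key (P Tx Hash : Type*) := P × Chain P Tx Hash × ℕ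

/-- The data with which the longest-chain broadcast protocol is instantiated, for a virtual
resource. -/
structure Params (P Tx Hash Rnd : Type*) [MeasurableSpace Rnd] where
  /-- transactions of the genesis block -/
  genesisTxs : List Tx
  /-- the hash function, idealized as collision free -/
  H : Block P Tx Hash → Hash
  H_injective : Function.Injective H
  /-- the validation predicate `ℙ(C, txs)` -/
  validTx : Chain P Tx Hash → List Tx → Prop
  validTx_nil : ∀ C, validTx C []
  /-- a transaction cannot be executed twice -/
  validTx_fresh : ∀ C l, validTx C l → l.Nodup ∧ ∀ tx ∈ l, tx ∉ txsOf C
  /-- the distribution of the virtual resource after executing a list of transactions -/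
  ledger : List Tx → P →₀ ℕ
  /-- the fixed total amount of the resource -/
  R : ℕ
  ledger_total : ∀ l, ((ledger l).sum fun _ r => r) = R
  /-- the maximal adversarial resource budget -/
  RA : ℕ
  /-- the choice of transactions to be put into a new block -/
  select : Chain P Tx Hash → Set Tx → List Tx
  select_valid : ∀ C U, validTx C (select C U)
  select_mem : ∀ C U, ∀ tx ∈ select C U, tx ∈ U
  /-- the common prefix parameter -/
  k : ℕ
  /-- the network delay -/
  delay : ℕ
  one_le_delay : 1 ≤ delay
  /-- In slot `t` the allocator reads the resource distribution off the blocks of slots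
  `≤ cutoff t`: `cutoff t = t` uses the whole chain, `cutoff t = (t / q - 2) * q` the stake
  distribution of two epochs (of `q` slots) before. -/
  cutoff : ℕ → ℕ
  cutoff_tendsto : Tendsto cutoff atTop atTop
  /-- the leader selection process `(D, F)`; `F S sl ρ` is the set of the processes that are
  elected in slot `sl` by the randomness `ρ`, given the resource distribution `S` -/
  D : Measure Rnd
  D_prob : IsProbabilityMeasure D
  F : (P →₀ ℕ) → ℕ → Rnd → Set P
  /-- the probability of being elected with one unit of the resource -/
  rate : ℝ
  rate_pos : 0 < rate
  rate_lt_one : rate < 1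
  F_measurable : ∀ S sl p, MeasurableSet {x | p ∈ F S sl x}
  F_prob : ∀ S sl p, D {x | p ∈ F S sl x} = ENNReal.ofReal (1 - (1 - rate) ^ (S p))

/-- Messages that are gossiped: transactions, blocks, and requests for the parents of a block. -/
inductive Msg (P Tx Hash : Type*) where
  | op (tx : Tx)
  | blk (B : Block P Tx Hash)
  | request (B : Block P Tx Hash)

/-- The local variables of a process. -/
structure LocalState (P Tx Hash : Type*) where
  unordered : Set Tx
  /-- the transactions that have been a-delivered, in the order of their delivery -/
  delivered : List Tx
  /-- the received (and accepted) blocks -/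
  blocks : Set (Block P Tx Hash)
  /-- the local chain -/
  chain : Chain P Tx Hash
  /-- the state `(C, B)` of the pending commit to the resource allocator, if any -/
  com : Option (Chain P Tx Hash × Block P Tx Hash)
  /-- whether the last answer of the allocator was `⊥` and is still to be handled -/
  retry : Bool
  /-- the transactions that were a-broadcast, each with the local chain at that moment -/
  bcast : Set (Tx × Chain P Tx Hash)

/-- A global configuration, at the beginning of time step `time`. -/
structure Config (P Tx Hash : Type*) where
  time : ℕ
  /-- the processes that have joined so far -/
  active : Finset P
  /-- the corrupted processes -/
  byz : Finset P
  loc : P → LocalState P Tx Hash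
  /-- the queries of the allocator that were answered by a resource commitment -/
  assigned : Set (Key P Tx Hash)
  /-- the blocks that were signed by correct processes -/
  signed : Set (Block P Tx Hash)
  /-- `net q` holds the entries `(p, s, m)` such that `p`, while it was correct, gossiped `m` in
  time step `s` and `m` was not delivered to `q` yet -/
  net : P → List (P × ℕ × Msg P Tx Hash)

/-- The choices of the adversary in one time step. It also controls the schedule: who joins, what
correct processes a-broadcast, and which messages are delivered in which order. It may deliver
messages of its own to any processes. Each corrupted process may commit to one state per step. -/
structure AdvAction (P Tx Hash : Type*) where
  join : Finset P
  corrupt : Finset P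
  input : P → List Tx
  deliver : P → List (Msg P Tx Hash)
  commit : P → Option (Chain P Tx Hash × Block P Tx Hash)

/-- An adversary chooses its action from the history, the newest configuration being first. -/
abbrev Strategy (P Tx Hash : Type*) := List (Config P Tx Hash) → AdvAction P Tx Hash

variable [DecidableEq P] [MeasurableSpace Rnd] (Pr : Params P Tx Hash Rnd)

namespace Params

/-- The genesis block. -/
def genesis : Block P Tx Hash := ⟨none, Pr.genesisTxs, none, none⟩

/-- The resource budget of a process, determined by the chain. -/
def stateAlloc (p : P) (C : Chain P Tx Hash) : ℕ := Pr.ledger (txsOf C) p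

open Classical in
/-- The part of the chain from which the allocator reads the distribution in slot `t`. -/
def view (C : Chain P Tx Hash) (t : ℕ) : Chain P Tx Hash :=
  C.takeWhile fun B => decide (∀ x ∈ B.proof, x.2 ≤ Pr.cutoff t)

/-- `B` carries the hash of the last block of `C`. -/
def Linked (C : Chain P Tx Hash) (B : Block P Tx Hash) : Prop :=
  ∃ A, C.getLast? = some A ∧ B.parent = some (Pr.H A)

/-- The block is signed by the process named in its commitment. Only a correct process itself can
produce its signatures, while the adversary signs for corrupted processes as it wishes. -/
def Verify (c : Config P Tx Hash) (B : Block P Tx Hash) : Prop :=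
  ∃ p sl, B.proof = some (p, sl) ∧ B.sig = some p ∧ (p ∈ c.byz ∨ B ∈ c.signed)

/-- The commitment in `B` was assigned by the allocator, for the part of `C` that is relevant in
its slot, and its slot is later than that of the last block of `C`. -/
def Committed (c : Config P Tx Hash) (C : Chain P Tx Hash) (B : Block P Tx Hash) : Prop :=
  ∃ p sl, B.proof = some (p, sl) ∧ (p, Pr.view C sl, sl) ∈ c.assigned ∧
    ∀ A, C.getLast? = some A → ∀ x ∈ A.proof, x.2 < sl

/-- Valid blockchains consist of valid blocks and start from the genesis block. -/
inductive ValidChain (c : Config P Tx Hash) : Chain P Tx Hash → Prop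
  | genesis : ValidChain c [Pr.genesis]
  | snoc (C : Chain P Tx Hash) (B : Block P Tx Hash) : ValidChain c C → Pr.Linked C B →
      Pr.validTx C B.txs → Verify c B → Pr.Committed c C B → ValidChain c (C ++ [B])

/-- The valid blockchains derived from the received blocks. -/
def Known (c : Config P Tx Hash) (s : LocalState P Tx Hash) (C : Chain P Tx Hash) : Prop :=
  Pr.ValidChain c C ∧ ∀ B ∈ C, B ∈ s.blocks

open Classical in
/-- `Extend`: deliver the transactions that are `k` blocks deep, and commit to a new block. -/
def extend (s : LocalState P Tx Hash) : LocalState P Tx Hash :=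
  let deep := txsOf (dropLastK s.chain Pr.k)
  let unordered := s.unordered \ {tx | tx ∈ deep ∧ tx ∉ s.delivered}
  { s with
    delivered := deep.foldl (fun d tx => if tx ∈ d then d else d ++ [tx]) s.delivered
    unordered := unordered
    com := some (s.chain,
      ⟨s.chain.getLast?.map Pr.H, Pr.select s.chain unordered, none, none⟩)
    retry := false }

/-- The state of a process that has just joined. -/
def initLocal : LocalState P Tx Hash :=
  Pr.extend ⟨∅, [], {Pr.genesis}, [Pr.genesis], none, false, ∅⟩

/-- Reaction to the validation of `B` on top of `C`. -/
def accept (s : LocalState P Tx Hash) (C : Chain P Tx Hash) (B : Block P Tx Hash) :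
    LocalState P Tx Hash :=
  let s' := { s with blocks := insert B s.blocks }
  if s.chain.length < (C ++ [B]).length then Pr.extend { s' with chain := C ++ [B] } else s'

open Classical in
/-- Reaction to a gossip-delivered message: the new state and the messages to be gossiped. -/
def handle (c : Config P Tx Hash) (s : LocalState P Tx Hash) :
    Msg P Tx Hash → LocalState P Tx Hash × List (Msg P Tx Hash)
  | .op tx => ({ s with unordered := insert tx s.unordered }, [])
  | .request B =>
      if h : ∃ C, Pr.Known c s C ∧ C.getLast? = some B then (s, h.choose.map Msg.blk) else (s, [])
  | .blk B =>
      if h : Verify c B ∧ ∃ C, Pr.Known c s C ∧ Pr.Linked C B ∧ Pr.validTx C B.txs then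
        if Pr.Committed c h.2.choose B then (Pr.accept s h.2.choose B, []) else (s, [])
      else (s, [.request B])

/-- The activation of a correct process: handle a pending answer `⊥` of the allocator, a-broadcast
the transactions `ins`, and then handle the messages `ms`. -/
def activate (c : Config P Tx Hash) (ins : List Tx) (ms : List (Msg P Tx Hash))
    (s : LocalState P Tx Hash) : LocalState P Tx Hash × List (Msg P Tx Hash) :=
  let s₁ := if s.retry then Pr.extend s else s
  let s₂ := { s₁ with bcast := s₁.bcast ∪ {x | x.1 ∈ ins ∧ x.2 = s₁.chain} }
  ms.foldl (fun x m => ((Pr.handle c x.1 m).1, x.2 ++ (Pr.handle c x.1 m).2))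
    (s₂, ins.map Msg.op)

/-- The allocator answers the commit of the state `(C, B)` by `p` in this time step by a resource
commitment (and not by `⊥`). Repeated queries get the same randomness. -/
def Elected (ω : Key P Tx Hash → Rnd) (c : Config P Tx Hash) (p : P)
    (st : Chain P Tx Hash × Block P Tx Hash) : Prop :=
  Pr.ValidChain c st.1 ∧ Pr.Linked st.1 st.2 ∧
    p ∈ Pr.F (Pr.ledger (txsOf (Pr.view st.1 c.time))) c.time (ω (p, Pr.view st.1 c.time, c.time))

open Classical in
/-- One time step: joins and corruptions, then the activations of the correct processes, then the
answers of the allocator, after which correct processes sign and gossip their new blocks. -/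
def step (ω : Key P Tx Hash → Rnd) (a : AdvAction P Tx Hash) (c : Config P Tx Hash) :
    Config P Tx Hash :=
  let c₁ : Config P Tx Hash :=
    { c with
      active := c.active ∪ a.join
      byz := c.byz ∪ a.corrupt
      loc := fun p => if p ∈ a.join \ c.active then Pr.initLocal else c.loc p }
  let correct := c₁.active \ c₁.byz
  let res := fun p => Pr.activate c₁ (a.input p) (a.deliver p) (c₁.loc p)
  let com := fun p => if p ∈ correct then (res p).1.com
    else if p ∈ c₁.byz then a.commit p else none
  let wins := fun p st => com p = some st ∧ Pr.Elected ω c₁ p st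
  let mined := fun p (st : Chain P Tx Hash × Block P Tx Hash) =>
    { st.2 with proof := some (p, c.time), sig := some p }
  let out := fun p => (res p).2 ++
    ((com p).toList.filter fun st => decide (wins p st)).map fun st => Msg.blk (mined p st)
  { time := c.time + 1
    active := c₁.active
    byz := c₁.byz
    loc := fun p => if p ∈ correct then
        { (res p).1 with
          com := none
          retry := match com p with
            | none => (res p).1.retry
            | some st => !decide (wins p st) }
      else c₁.loc p
    assigned := c.assigned ∪ {x | ∃ st, wins x.1 st ∧ x.2 = (Pr.view st.1 c.time, c.time)}
    signed := c.signed ∪ {B | ∃ p st, p ∈ correct ∧ wins p st ∧ B = mined p st}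
    net := fun q => (c.net q).filter (fun x => decide (x.2.2 ∉ a.deliver q)) ++
      if q ∈ c₁.active then correct.toList.flatMap fun p => (out p).map fun m => (p, c.time, m)
      else [] }

/-- The rules for the adversary: only processes that have participated can be corrupted; when it
corrupts processes, all corrupted processes together hold at most the budget `R_A`, as computed from
the local chains of the processes that are correct until then; what correct processes gossip is
delivered in time; and the adversary commits only in the name of corrupted processes. -/
structure Legal (c : Config P Tx Hash) (a : AdvAction P Tx Hash) : Prop where
  corrupt_active : a.corrupt ⊆ c.active
  budget : a.corrupt ⊆ c.byz ∨ ∀ j ∈ c.active \ c.byz,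
    ∑ p ∈ c.byz ∪ a.corrupt, Pr.stateAlloc p (c.loc j).chain ≤ Pr.RA
  delivery : ∀ q ∈ c.active, q ∉ c.byz ∪ a.corrupt → ∀ x ∈ c.net q, x.1 ∉ c.byz ∪ a.corrupt →
    x.2.1 + Pr.delay ≤ c.time → x.2.2 ∈ a.deliver q
  commit_byz : ∀ p, a.commit p ≠ none → p ∈ c.byz ∪ a.corrupt

/-- The configuration before any process has joined. -/
def initConfig : Config P Tx Hash := ⟨0, ∅, ∅, fun _ => Pr.initLocal, ∅, ∅, fun _ => []⟩

/-- The configurations that can occur in executions of the protocol. -/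
inductive Reachable : Config P Tx Hash → Prop
  | init : Reachable Pr.initConfig
  | step (ω : Key P Tx Hash → Rnd) (a : AdvAction P Tx Hash) (c : Config P Tx Hash) :
      Reachable c → Pr.Legal c a → Reachable (Pr.step ω a c)

/-- The continuation of an execution from `c`: the first `n + 1` configurations, newest first. -/
def history (σ : Strategy P Tx Hash) (c : Config P Tx Hash) (ω : Key P Tx Hash → Rnd) :
    ℕ → List (Config P Tx Hash)
  | 0 => [c]
  | n + 1 => Pr.step ω (σ (history σ c ω n)) ((history σ c ω n).headD c) :: history σ c ω n

/-- The configuration after `n` further time steps. -/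
def exec (σ : Strategy P Tx Hash) (c : Config P Tx Hash) (ω : Key P Tx Hash → Rnd) (n : ℕ) :
    Config P Tx Hash :=
  (Pr.history σ c ω n).headD c

/-- The randomness of the allocator: independent samples of `D` for all queries. -/
def randomness : Measure (Key P Tx Hash → Rnd) :=
  haveI := Pr.D_prob
  Measure.infinitePi fun _ => Pr.D

/-- The adversary obeys the rules in all continuations from `c`, and in the `n`-th step the numbers
of joining processes, of inputs and of messages of its own are polynomially bounded in `n`. -/
structure Admissible (σ : Strategy P Tx Hash) (c : Config P Tx Hash) : Prop where
  legal : ∀ ω n, Pr.Legal (Pr.exec σ c ω n) (σ (Pr.history σ c ω n))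
  bounded : ∃ K d : ℕ, ∀ ω n, (σ (Pr.history σ c ω n)).join.card ≤ K * (n + 1) ^ d ∧ ∀ q,
    ((σ (Pr.history σ c ω n)).input q).length ≤ K * (n + 1) ^ d ∧
    ((σ (Pr.history σ c ω n)).deliver q).length ≤
      ((Pr.exec σ c ω n).net q).length + K * (n + 1) ^ d

end Params

/-- The process joins at some time and is never corrupted. -/
def Correct (e : ℕ → Config P Tx Hash) (p : P) : Prop :=
  (∃ n, p ∈ (e n).active) ∧ ∀ n, p ∉ (e n).byz

/-- `p` a-delivers `tx`. -/
def Delivers (e : ℕ → Config P Tx Hash) (p : P) (tx : Tx) : Prop :=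
  ∃ n, tx ∈ ((e n).loc p).delivered

/-- `p` a-delivers `tx₁` and later `tx₂`. -/
def DeliversBefore (e : ℕ → Config P Tx Hash) (p : P) (tx₁ tx₂ : Tx) : Prop :=
  ∃ n, [tx₁, tx₂].Sublist ((e n).loc p).delivered

/-- Agreement, for a single execution. -/
def Agreement (e : ℕ → Config P Tx Hash) : Prop :=
  ∀ p q tx, Correct e p → Correct e q → Delivers e p tx → Delivers e q tx

/-- Total order, for a single execution. -/
def TotalOrder (e : ℕ → Config P Tx Hash) : Prop :=
  ∀ p q tx₁ tx₂, Correct e p → Correct e q → Delivers e q tx₁ → Delivers e q tx₂ →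
    DeliversBefore e p tx₁ tx₂ → DeliversBefore e q tx₁ tx₂

/-- All the properties of total-order broadcast, for a single execution. -/
structure TotalOrderBroadcast (e : ℕ → Config P Tx Hash) : Prop where
  validity : ∀ p tx C, Correct e p → (∃ n, (tx, C) ∈ ((e n).loc p).bcast) → Pr.validTx C [tx] →
    Delivers e p tx
  no_duplication : ∀ p n, Correct e p → ((e n).loc p).delivered.Nodup
  agreement : Agreement e
  total_order : TotalOrder e

/-- A virtual-resource-shifting event on the chain `C`: the processes in `M` hold more than
`R - R_A` of the resource at height `h₀`, and at most `R_A` at the later height `h₁`. -/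
structure ShiftingEvent (C : Chain P Tx Hash) (h₀ h₁ : ℕ) (M : Finset P) : Prop where
  lt : h₀ < h₁
  lt_length : h₁ < C.length
  active_before : Pr.R < (∑ p ∈ M, Pr.stateAlloc p (upTo C h₀)) + Pr.RA
  inactive_after : ∑ p ∈ M, Pr.stateAlloc p (upTo C h₁) ≤ Pr.RA

/-- The transactions that wait for being ordered, at processes outside `A` or in transit
from processes outside `A`. -/
def pending (c : Config P Tx Hash) (A : Finset P) : Set Tx :=
  {tx | ∃ j ∈ c.active, j ∉ A ∧ (tx ∈ (c.loc j).unordered ∨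
    ∃ i s, i ∉ A ∧ (i, s, Msg.op tx) ∈ c.net j)}

/-- The chains that arise from `C` by appending blocks with valid transactions from `U`. -/
inductive ExtensionBy (U : Set Tx) (C : Chain P Tx Hash) : Chain P Tx Hash → Prop
  | refl : ExtensionBy U C C
  | snoc (C' : Chain P Tx Hash) (B : Block P Tx Hash) : ExtensionBy U C C' →
      Pr.validTx C' B.txs → (∀ tx ∈ B.txs, tx ∈ U) → ExtensionBy U C (C' ++ [B])

/-- The long-range attack succeeds in configuration `e`, having started in configuration `c`:
there is a valid chain `C'` that forks from `C` after height `h₀`, whose blocks after the fork are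
all made by corrupted processes, the first of them with the transactions `l`, and which is longer
than the local chain of any other correct process. It was adopted by the processes in `S` and by a
process `q` that joined after `c`, all of them correct, although they have received the local chains
of all correct processes, and they have a-delivered what is `k` blocks deep in `C'`. -/
def AttackSucceeds (c : Config P Tx Hash) (C : Chain P Tx Hash) (h₀ : ℕ) (S : Finset P)
    (l : List Tx) (e : Config P Tx Hash) : Prop :=
  ∃ (C' : Chain P Tx Hash) (q : P),
    Pr.ValidChain e C' ∧ upTo C h₀ <+: C' ∧ ¬ upTo C (h₀ + 1) <+: C' ∧
    (∀ B ∈ C'.drop (h₀ + 1), ∃ p ∈ e.byz, B.sig = some p) ∧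
    (∃ B, C'[h₀ + 1]? = some B ∧ B.txs = l) ∧ h₀ + 1 + Pr.k < C'.length ∧
    q ∈ e.active ∧ q ∉ c.active ∧
    (∀ x ∈ insert q S, x ∉ e.byz ∧ (e.loc x).chain = C' ∧
      (∀ tx ∈ txsOf (dropLastK C' Pr.k), tx ∈ (e.loc x).delivered) ∧
      ∀ j ∈ e.active \ e.byz, ∀ B ∈ (e.loc j).chain, B ∈ (e.loc x).blocks) ∧
    ∀ j ∈ e.active \ e.byz, j ∉ insert q S → (e.loc j).chain.length < C'.length

end Model

end

/-! The adversary corrupts `A` at once, while `A` holds exactly the budget, and extends the old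
prefix `upTo C h₀` in secret: the first private block carries `ℓ`, all later ones are empty. The
resource is read off the chain itself, so on the private chain the distribution stays the one after
`h₀` and `ℓ`, under which `M ⊆ A` holds at least `R - R_A + 1`. On the public chain `A` holds
exactly `R_A`, so everybody else holds at most `R - R_A`. In one slot the private chain stays
without a new block with probability at most `(1 - ϱ) ^ (R - R_A + 1)`, the public chain with
probability at least `(1 - ϱ) ^ (R - R_A)`. Hence the private chain grows faster on average, makes
up any deficit, and wins by the longest-chain rule wherever it is shown.

Two points need care. Some of the resource outside `A` may belong to processes that have not joined,
so the public chain might not grow by itself. The adversary therefore first extends it with empty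
blocks up to length `N`, which buries the block of height `h₁` under `k` others, and only then works
on the private chain. Moreover the allocator may read an old distribution; the drift is used only
from slot `T` on, when it sees all of `C`.

The deterministic half is an invariant in two forms: `Inv` for a new configuration, and `Ready`
after the adversary has updated its variables. They alternate by `Inv.ready` and `Ready.step`. All
messages from processes outside `A` are delivered in the next step, after the blocks of the public
chain, so uninformed processes always agree on that chain. Nothing is a-broadcast anew, so only
transactions that were pending at the start enter it, and the budget hypothesis applies to it. That
private blocks do not leak rests on `ValidChain.unique` (the last block determines a valid chain)
and on `Clean`: chains in circulation are old or extend `C`, whereas private blocks have new slots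
and fork from `C`.

The probabilistic half uses that a history has finitely many values and depends only on queries of
earlier slots, so one-step bounds that are conditional on the history can be integrated
(`lintegral_history_succ_le`). For a suitable `x < 1`, the potential `x ^ (private length - public
length)` shrinks by a factor `ρ < 1` on average (`exists_rate`, `lintegral_potential_le`). Before
the release it is bounded below, so the release happens almost surely (`ae_release`), and with it
the attack succeeds (`Ready.attackSucceeds`). After a release with lead `L` it is a supermartingale
that starts at no more than `x ^ L` and is at least `1` once the lead is lost, so the lead is lost
with probability at most `x ^ L` (`randomness_not_good_le`).

Total order fails because the newcomer `q` delivers `ℓ` in its own order. Agreement fails because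
some transaction lies between `h₀` and `h₁` (otherwise the distribution could not have shifted): the
public side delivers it, while `q` never does as long as the private chain of empty blocks keeps its
lead. -/

/-! ### Hash-linked chains and the consistency of local states. -/

noncomputable section Chains

variable {P Tx Hash Rnd : Type*} [MeasurableSpace Rnd]
  {Pr : Params P Tx Hash Rnd}

/-- `c'` knows at least the corruptions, signatures and assignments of `c`. -/
structure Config.Le (c c' : Config P Tx Hash) : Prop where
  byz : c.byz ⊆ c'.byz
  signed : c.signed ⊆ c'.signed
  assigned : c.assigned ⊆ c'.assigned

theorem Config.Le.refl (c : Config P Tx Hash) : c.Le c := ⟨subset_rfl, subset_rfl, subset_rfl⟩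

theorem Config.Le.trans {c c' c'' : Config P Tx Hash} (h : c.Le c') (h' : c'.Le c'') :
    c.Le c'' :=
  ⟨h.byz.trans h'.byz, h.signed.trans h'.signed, h.assigned.trans h'.assigned⟩

theorem List.exists_prefix_getLast?_of_mem {α : Type*} {l : List α} {a : α} (h : a ∈ l) :
    ∃ d, d <+: l ∧ d.getLast? = some a := by
  obtain ⟨s, t, rfl⟩ := List.append_of_mem h
  exact ⟨s ++ [a], ⟨t, by simp⟩, by simp⟩

theorem txsOf_append (C D : Chain P Tx Hash) : txsOf (C ++ D) = txsOf C ++ txsOf D := by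
  simp [txsOf]

theorem txsOf_subset_of_prefix {C D : Chain P Tx Hash} (h : C <+: D) {tx : Tx}
    (htx : tx ∈ txsOf C) : tx ∈ txsOf D := by
  obtain ⟨E, rfl⟩ := h
  rw [txsOf_append]
  exact List.mem_append_left _ htx

namespace Params

theorem ValidChain.ne_nil {c : Config P Tx Hash} {C : Chain P Tx Hash} (h : Pr.ValidChain c C) :
    C ≠ [] := by
  cases h <;> simp

theorem Linked.unique {C : Chain P Tx Hash} {B A A' : Block P Tx Hash} (h : Pr.Linked C B)
    (hA : B.parent = some (Pr.H A)) (hA' : C.getLast? = some A') : A = A' := by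
  obtain ⟨A₁, h₁, h₂⟩ := h
  rw [h₁] at hA'
  rw [h₂] at hA
  simp only [Option.some.injEq] at hA hA'
  rw [← hA', Pr.H_injective hA]

/-- The hash links determine a valid chain by its last block. -/
theorem ValidChain.unique {c c' : Config P Tx Hash} {C C' : Chain P Tx Hash}
    (h : Pr.ValidChain c C) (h' : Pr.ValidChain c' C') (hl : C.getLast? = C'.getLast?) :
    C = C' := by
  induction h generalizing C' with
  | genesis =>
    cases h' with
    | genesis => rfl
    | snoc D B _ hB =>
      obtain ⟨A, _, hA⟩ := hB
      simp only [List.getLast?_singleton, List.getLast?_concat, Option.some.injEq] at hl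
      rw [← hl] at hA
      simp [Params.genesis] at hA
  | snoc D B hD hB _ _ _ ih =>
    cases h' with
    | genesis =>
      obtain ⟨A, _, hA⟩ := hB
      simp only [List.getLast?_singleton, List.getLast?_concat, Option.some.injEq] at hl
      rw [hl] at hA
      simp [Params.genesis] at hA
    | snoc D' B' hD' hB' =>
      simp only [List.getLast?_concat, Option.some.injEq] at hl
      subst hl
      obtain ⟨A, hA, hp⟩ := hB
      obtain ⟨A', hA', hp'⟩ := hB'
      rw [hp] at hp'
      simp only [Option.some.injEq] at hp'
      rw [ih hD' (by rw [hA, hA', Pr.H_injective hp'])]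

/-- Validity uses the configuration only through corruptions, signatures and assignments, each of
them positively. -/
theorem ValidChain.mono {c c' : Config P Tx Hash} (hle : c.Le c') {C : Chain P Tx Hash}
    (h : Pr.ValidChain c C) : Pr.ValidChain c' C := by
  induction h with
  | genesis => exact .genesis
  | snoc D B _ hl ht hv hc ih =>
    refine .snoc D B ih hl ht ?_ ?_
    · obtain ⟨p, sl, h₁, h₂, h₃⟩ := hv
      exact ⟨p, sl, h₁, h₂, h₃.imp (fun h => hle.byz h) fun h => hle.signed h⟩
    · obtain ⟨p, sl, h₁, h₂, h₃⟩ := hc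
      exact ⟨p, sl, h₁, hle.assigned h₂, h₃⟩

theorem ValidChain.snoc_inv {c : Config P Tx Hash} {C : Chain P Tx Hash} {B : Block P Tx Hash}
    (h : Pr.ValidChain c (C ++ [B])) (hC : C ≠ []) :
    Pr.ValidChain c C ∧ Pr.Linked C B ∧ Pr.validTx C B.txs ∧ Verify c B ∧
      Pr.Committed c C B := by
  generalize hE : C ++ [B] = E at h
  cases h with
  | genesis =>
    cases C with
    | nil => exact absurd rfl hC
    | cons a l => simp at hE
  | snoc D B' h₁ h₂ h₃ h₄ h₅ =>
    obtain ⟨rfl, hB⟩ := List.append_inj' hE rfl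
    simp only [List.cons.injEq, and_true] at hB
    subst hB
    exact ⟨h₁, h₂, h₃, h₄, h₅⟩

theorem ValidChain.of_prefix {c : Config P Tx Hash} {C D : Chain P Tx Hash}
    (h : Pr.ValidChain c C) (hD : D <+: C) (hne : D ≠ []) : Pr.ValidChain c D := by
  induction h with
  | genesis =>
    rcases List.prefix_concat_iff.1 (show D <+: [] ++ [Pr.genesis] from hD) with h | h
    · rw [h]; exact .genesis
    · exact absurd (List.prefix_nil.1 h) hne
  | snoc E B h₁ h₂ h₃ h₄ h₅ ih =>
    rcases List.prefix_concat_iff.1 hD with rfl | h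
    · exact .snoc E B h₁ h₂ h₃ h₄ h₅
    · exact ih h

theorem ValidChain.genesis_prefix {c : Config P Tx Hash} {C : Chain P Tx Hash}
    (h : Pr.ValidChain c C) : [Pr.genesis] <+: C := by
  induction h with
  | genesis => exact List.prefix_rfl
  | snoc E B _ _ _ _ _ ih => exact ih.trans (List.prefix_append _ _)

/-- A commitment can be used only after it was assigned, so the slots on a chain lie in the past.
This is what later tells the blocks made before the attack from the private ones. -/
theorem ValidChain.slot_lt {c : Config P Tx Hash} (hs : ∀ x ∈ c.assigned, x.2.2 < c.time)
    {C : Chain P Tx Hash} (h : Pr.ValidChain c C) :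
    ∀ B ∈ C, ∀ x ∈ B.proof, x.2 < c.time := by
  induction h with
  | genesis => simp [Params.genesis]
  | snoc E B _ _ _ _ h₅ ih =>
    intro B' hB' x hx
    rcases List.mem_append.1 hB' with h | h
    · exact ih B' h x hx
    · rw [List.mem_singleton] at h
      subst h
      obtain ⟨p, sl, h₁, h₂, -⟩ := h₅
      rw [h₁] at hx
      simp only [Option.mem_def, Option.some.injEq] at hx
      subst hx
      exact hs _ h₂

/-- Since `validTx` rejects repetitions, a transaction between two heights is really absent from the
lower prefix; the violation of agreement needs such a transaction. -/
theorem ValidChain.fresh {c : Config P Tx Hash} {D E : Chain P Tx Hash}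
    (h : Pr.ValidChain c (D ++ E)) (hD : D ≠ []) : ∀ tx ∈ txsOf E, tx ∉ txsOf D := by
  induction E using List.reverseRecOn with
  | nil => simp [txsOf]
  | append_singleton E B ih =>
    rw [← List.append_assoc] at h
    obtain ⟨h₁, -, h₃, -⟩ := h.snoc_inv (by simp [hD])
    intro tx htx hmem
    rw [txsOf_append] at htx
    rcases List.mem_append.1 htx with h' | h'
    · exact ih h₁ tx h' hmem
    · simp only [txsOf, List.flatMap_singleton] at h'
      refine (Pr.validTx_fresh _ _ h₃).2 tx h' ?_
      rw [txsOf_append]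
      exact List.mem_append_left _ hmem

/-! ### Local states -/

theorem Known.unique {c c' : Config P Tx Hash} {s s' : LocalState P Tx Hash}
    {C C' : Chain P Tx Hash} (h : Pr.Known c s C) (h' : Pr.Known c' s' C')
    (hl : C.getLast? = C'.getLast?) : C = C' :=
  h.1.unique h'.1 hl

/-- Consistency of the local state of a correct process. -/
structure LocOK (Pr : Params P Tx Hash Rnd) (c : Config P Tx Hash)
    (s : LocalState P Tx Hash) : Prop where
  known : Pr.Known c s s.chain
  blocks : ∀ B ∈ s.blocks, ∃ D, Pr.Known c s D ∧ D.getLast? = some B ∧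
    D.length ≤ s.chain.length
  deep : ∀ tx ∈ txsOf (dropLastK s.chain Pr.k), tx ∈ s.delivered
  nodup : s.delivered.Nodup
  com : ∀ C B, s.com = some (C, B) → C = s.chain ∧
    B = ⟨C.getLast?.map Pr.H, B.txs, none, none⟩ ∧ Pr.validTx C B.txs ∧
    ∀ tx ∈ B.txs, tx ∈ s.unordered

/-- How a local state may evolve. -/
structure Evol (s s' : LocalState P Tx Hash) : Prop where
  blocks : s.blocks ⊆ s'.blocks
  delivered : s.delivered <+: s'.delivered
  chain : s.chain.length < s'.chain.length ∨
    s'.chain = s.chain ∧ ∀ tx ∈ s.unordered, tx ∉ txsOf s.chain → tx ∈ s'.unordered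

theorem Evol.refl (s : LocalState P Tx Hash) : Evol s s :=
  ⟨subset_rfl, List.prefix_rfl, Or.inr ⟨rfl, fun _ h _ => h⟩⟩

theorem Evol.length_le {s s' : LocalState P Tx Hash} (h : Evol s s') :
    s.chain.length ≤ s'.chain.length := by
  rcases h.chain with h | h
  · exact h.le
  · rw [h.1]

theorem Evol.trans {s s' s'' : LocalState P Tx Hash} (h : Evol s s') (h' : Evol s' s'') :
    Evol s s'' := by
  refine ⟨h.blocks.trans h'.blocks, h.delivered.trans h'.delivered, ?_⟩
  rcases h.chain with h₁ | ⟨h₁, h₂⟩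
  · exact Or.inl (h₁.trans_le h'.length_le)
  · rcases h'.chain with h₃ | ⟨h₃, h₄⟩
    · exact Or.inl (h₁ ▸ h₃)
    · exact Or.inr ⟨h₃.trans h₁, fun tx ht hn => h₄ tx (h₂ tx ht hn) (h₁ ▸ hn)⟩

open Classical in
theorem foldl_deliver_prefix (l d : List Tx) :
    d <+: l.foldl (fun d tx => if tx ∈ d then d else d ++ [tx]) d := by
  induction l generalizing d with
  | nil => exact List.prefix_rfl
  | cons a l ih =>
    simp only [List.foldl_cons]
    refine List.IsPrefix.trans ?_ (ih _)
    split_ifs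
    · exact List.prefix_rfl
    · exact List.prefix_append _ _

open Classical in
theorem mem_foldl_deliver (l d : List Tx) (tx : Tx) :
    tx ∈ l.foldl (fun d tx => if tx ∈ d then d else d ++ [tx]) d ↔ tx ∈ d ∨ tx ∈ l := by
  induction l generalizing d with
  | nil => simp
  | cons a l ih =>
    simp only [List.foldl_cons, ih, List.mem_cons]
    split_ifs with h
    · constructor
      · tauto
      · rintro (h' | rfl | h')
        · exact Or.inl h'
        · exact Or.inl h
        · exact Or.inr h'
    · simp only [List.mem_append, List.mem_singleton]
      tauto

open Classical in
theorem nodup_foldl_deliver (l d : List Tx) (h : d.Nodup) :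
    (l.foldl (fun d tx => if tx ∈ d then d else d ++ [tx]) d).Nodup := by
  induction l generalizing d with
  | nil => exact h
  | cons a l ih =>
    simp only [List.foldl_cons]
    refine ih _ ?_
    split_ifs with h'
    · exact h
    · exact List.nodup_append.2 ⟨h, List.nodup_singleton _, by
        intro x hx y hy
        rw [List.mem_singleton] at hy
        rintro rfl
        exact h' (hy ▸ hx)⟩

theorem dropLastK_prefix (C : Chain P Tx Hash) (k : ℕ) : dropLastK C k <+: C :=
  List.take_prefix _ _

open Classical in
theorem extend_delivered (s : LocalState P Tx Hash) : (Pr.extend s).delivered =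
    (txsOf (dropLastK s.chain Pr.k)).foldl (fun d tx => if tx ∈ d then d else d ++ [tx])
      s.delivered := rfl

theorem mem_extend_delivered (s : LocalState P Tx Hash) (tx : Tx) :
    tx ∈ (Pr.extend s).delivered ↔
      tx ∈ s.delivered ∨ tx ∈ txsOf (dropLastK s.chain Pr.k) := by
  classical
  rw [extend_delivered, mem_foldl_deliver]

theorem extend_unordered_subset (s : LocalState P Tx Hash) :
    (Pr.extend s).unordered ⊆ s.unordered := Set.sdiff_subset

theorem evol_extend (s : LocalState P Tx Hash) : Evol s (Pr.extend s) := by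
  classical
  refine ⟨subset_rfl, ?_, Or.inr ⟨rfl, fun tx h hn => ⟨h, fun h' => hn ?_⟩⟩⟩
  · rw [extend_delivered]
    exact foldl_deliver_prefix _ _
  · exact txsOf_subset_of_prefix (dropLastK_prefix _ _) h'.1

/-- `extend` produces the fields `deep` and `com` anew, so they need not hold before. This covers
the moment at which the chain has been replaced but nothing was delivered yet. -/
theorem LocOK.extend_of {c : Config P Tx Hash} {s : LocalState P Tx Hash}
    (hk : Pr.Known c s s.chain)
    (hb : ∀ B ∈ s.blocks, ∃ D, Pr.Known c s D ∧ D.getLast? = some B ∧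
      D.length ≤ s.chain.length) (hn : s.delivered.Nodup) : Pr.LocOK c (Pr.extend s) := by
  classical
  refine ⟨hk, hb, ?_, ?_, ?_⟩
  · intro tx htx
    exact (mem_extend_delivered s tx).2 (Or.inr htx)
  · rw [extend_delivered]
    exact nodup_foldl_deliver _ _ hn
  · intro C B h
    simp only [Params.extend, Option.some.injEq, Prod.mk.injEq] at h
    obtain ⟨rfl, rfl⟩ := h
    exact ⟨rfl, rfl, Pr.select_valid _ _, Pr.select_mem _ _⟩

theorem LocOK.extend {c : Config P Tx Hash} {s : LocalState P Tx Hash} (h : Pr.LocOK c s) :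
    Pr.LocOK c (Pr.extend s) := LocOK.extend_of h.known h.blocks h.nodup

theorem locOK_initLocal (c : Config P Tx Hash) : Pr.LocOK c Pr.initLocal := by
  have hk : Pr.Known c ⟨∅, [], {Pr.genesis}, [Pr.genesis], none, false, ∅⟩ [Pr.genesis] :=
    ⟨.genesis, by simp⟩
  refine LocOK.extend_of hk ?_ List.nodup_nil
  intro B hB
  rw [Set.mem_singleton_iff] at hB
  subst hB
  exact ⟨_, hk, rfl, le_rfl⟩

theorem Known.mono {c c' : Config P Tx Hash} {s s' : LocalState P Tx Hash} (hle : c.Le c')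
    (hs : s.blocks ⊆ s'.blocks) {D : Chain P Tx Hash} (h : Pr.Known c s D) : Pr.Known c' s' D :=
  ⟨h.1.mono hle, fun B hB => hs (h.2 B hB)⟩

theorem LocOK.mono {c c' : Config P Tx Hash} (hle : c.Le c') {s : LocalState P Tx Hash}
    (h : Pr.LocOK c s) : Pr.LocOK c' s :=
  ⟨h.known.mono hle subset_rfl, fun B hB => by
    obtain ⟨D, h₁, h₂⟩ := h.blocks B hB
    exact ⟨D, h₁.mono hle subset_rfl, h₂⟩, h.deep, h.nodup, h.com⟩

theorem evol_accept (s : LocalState P Tx Hash) (C : Chain P Tx Hash) (B : Block P Tx Hash) :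
    Evol s (Pr.accept s C B) := by
  unfold accept
  dsimp only
  split_ifs with h
  · refine Evol.trans (s' := { s with blocks := insert B s.blocks, chain := C ++ [B] }) ?_
      (evol_extend _)
    exact ⟨Set.subset_insert _ _, List.prefix_rfl, Or.inl h⟩
  · exact ⟨Set.subset_insert _ _, List.prefix_rfl, Or.inr ⟨rfl, fun _ h _ => h⟩⟩

theorem accept_blocks (s : LocalState P Tx Hash) (C : Chain P Tx Hash) (B : Block P Tx Hash) :
    (Pr.accept s C B).blocks = insert B s.blocks := by
  unfold accept
  dsimp only
  split_ifs <;> rfl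

theorem accept_chain (s : LocalState P Tx Hash) (C : Chain P Tx Hash) (B : Block P Tx Hash) :
    (Pr.accept s C B).chain =
      if s.chain.length < (C ++ [B]).length then C ++ [B] else s.chain := by
  unfold accept
  dsimp only
  split_ifs <;> rfl

theorem accept_of_le {s : LocalState P Tx Hash} {C : Chain P Tx Hash} {B : Block P Tx Hash}
    (h : (C ++ [B]).length ≤ s.chain.length) :
    Pr.accept s C B = { s with blocks := insert B s.blocks } := by
  unfold accept
  dsimp only
  rw [if_neg (not_lt.2 h)]

theorem LocOK.accept {c : Config P Tx Hash} {s : LocalState P Tx Hash} (h : Pr.LocOK c s)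
    {C : Chain P Tx Hash} {B : Block P Tx Hash} (hC : Pr.Known c s C)
    (hB : Pr.ValidChain c (C ++ [B])) : Pr.LocOK c (Pr.accept s C B) := by
  have hk : ∀ s' : LocalState P Tx Hash, s'.blocks = insert B s.blocks →
      Pr.Known c s' (C ++ [B]) := by
    intro s' hs'
    refine ⟨hB, fun B' hB' => ?_⟩
    rw [hs']
    rcases List.mem_append.1 hB' with h | h
    · exact Set.mem_insert_of_mem _ (hC.2 B' h)
    · exact Set.mem_insert_iff.2 (Or.inl (List.mem_singleton.1 h))
  have hm : ∀ s' : LocalState P Tx Hash, s'.blocks = insert B s.blocks → ∀ n,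
      s.chain.length ≤ n → (C ++ [B]).length ≤ n →
      ∀ B' ∈ s'.blocks, ∃ D, Pr.Known c s' D ∧ D.getLast? = some B' ∧ D.length ≤ n := by
    intro s' hs' n h₁ h₂ B' hB'
    rw [hs'] at hB'
    rcases Set.mem_insert_iff.1 hB' with rfl | h'
    · exact ⟨_, hk s' hs', by simp, h₂⟩
    · obtain ⟨D, hD, hl, hle⟩ := h.blocks B' h'
      exact ⟨D, hD.mono (.refl _) (hs' ▸ Set.subset_insert _ _), hl, hle.trans h₁⟩
  unfold Params.accept
  dsimp only
  split_ifs with hlt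
  · refine LocOK.extend_of (hk _ rfl) ?_ h.nodup
    exact hm _ rfl _ hlt.le le_rfl
  · refine ⟨h.known.mono (.refl _) (Set.subset_insert _ _), ?_, h.deep, h.nodup, h.com⟩
    exact hm _ rfl _ le_rfl (not_lt.1 hlt)

theorem handle_op (c : Config P Tx Hash) (s : LocalState P Tx Hash) (tx : Tx) :
    Pr.handle c s (.op tx) = ({ s with unordered := insert tx s.unordered }, []) := rfl

theorem handle_request (c : Config P Tx Hash) (s : LocalState P Tx Hash) (B : Block P Tx Hash) :
    Pr.handle c s (.request B) = (s, []) ∨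
      ∃ D, Pr.Known c s D ∧ D.getLast? = some B ∧
        Pr.handle c s (.request B) = (s, D.map Msg.blk) := by
  by_cases h : ∃ C, Pr.Known c s C ∧ C.getLast? = some B
  · exact Or.inr ⟨h.choose, h.choose_spec.1, h.choose_spec.2, by simp only [handle, dif_pos h]⟩
  · exact Or.inl (by simp only [handle, dif_neg h])

theorem handle_blk (c : Config P Tx Hash) (s : LocalState P Tx Hash) (B : Block P Tx Hash) :
    Pr.handle c s (.blk B) = (s, [.request B]) ∨ Pr.handle c s (.blk B) = (s, []) ∨
      ∃ D, Pr.Known c s D ∧ Pr.ValidChain c (D ++ [B]) ∧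
        Pr.handle c s (.blk B) = (Pr.accept s D B, []) := by
  by_cases h : Verify c B ∧ ∃ C, Pr.Known c s C ∧ Pr.Linked C B ∧ Pr.validTx C B.txs
  · by_cases h' : Pr.Committed c h.2.choose B
    · refine Or.inr (Or.inr ⟨h.2.choose, h.2.choose_spec.1, ?_, ?_⟩)
      · exact .snoc _ _ h.2.choose_spec.1.1 h.2.choose_spec.2.1 h.2.choose_spec.2.2 h.1 h'
      · simp only [handle, dif_pos h, if_pos h']
    · exact Or.inr (Or.inl (by simp only [handle, dif_pos h, if_neg h']))
  · exact Or.inl (by simp only [handle, dif_neg h])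

/-- The choice of a parent chain in `handle` is harmless: the parent hash fixes the last block, and
this fixes the chain. -/
theorem handle_blk_of_known {c : Config P Tx Hash} {s : LocalState P Tx Hash}
    {D : Chain P Tx Hash} {B : Block P Tx Hash} (hD : Pr.Known c s D)
    (hB : Pr.ValidChain c (D ++ [B])) : Pr.handle c s (.blk B) = (Pr.accept s D B, []) := by
  obtain ⟨h₁, h₂, h₃, h₄, h₅⟩ := hB.snoc_inv hD.1.ne_nil
  have h : Verify c B ∧ ∃ C, Pr.Known c s C ∧ Pr.Linked C B ∧ Pr.validTx C B.txs :=
    ⟨h₄, D, hD, h₂, h₃⟩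
  have hu : h.2.choose = D := by
    refine h.2.choose_spec.1.unique hD ?_
    obtain ⟨A, hA, hp⟩ := h₂
    obtain ⟨A', hA', -⟩ := h.2.choose_spec.2.1
    rw [hA, hA', Linked.unique h.2.choose_spec.2.1 hp hA']
  simp only [handle, dif_pos h]
  rw [if_pos (hu ▸ h₅), hu]

/-- What is known about the blocks that a process with local state `s` gossips. -/
def OutOK (Pr : Params P Tx Hash Rnd) (c : Config P Tx Hash) (n : ℕ) (m : Msg P Tx Hash) :
    Prop :=
  ∀ B, m = .blk B → ∃ D, Pr.ValidChain c D ∧ D.getLast? = some B ∧ D.length ≤ n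

theorem handle_spec {c : Config P Tx Hash} {s : LocalState P Tx Hash} (h : Pr.LocOK c s)
    (m : Msg P Tx Hash) : Pr.LocOK c (Pr.handle c s m).1 ∧ Evol s (Pr.handle c s m).1 ∧
      ∀ m' ∈ (Pr.handle c s m).2, Pr.OutOK c s.chain.length m' := by
  cases m with
  | op tx =>
    rw [handle_op]
    refine ⟨⟨h.known, h.blocks, h.deep, h.nodup, ?_⟩, ⟨subset_rfl, List.prefix_rfl, ?_⟩, by simp⟩
    · intro C B hc
      obtain ⟨h₁, h₂, h₃, h₄⟩ := h.com C B hc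
      exact ⟨h₁, h₂, h₃, fun tx ht => Set.mem_insert_of_mem _ (h₄ tx ht)⟩
    · exact Or.inr ⟨rfl, fun tx ht _ => Set.mem_insert_of_mem _ ht⟩
  | request B =>
    rcases handle_request (Pr := Pr) c s B with h' | ⟨D, hD, hl, h'⟩
    · rw [h']
      exact ⟨h, .refl _, by simp⟩
    · rw [h']
      refine ⟨h, .refl _, fun m' hm' B' hB' => ?_⟩
      subst hB'
      simp only [List.mem_map, Msg.blk.injEq, exists_eq_right] at hm'
      obtain ⟨E, hE, hl⟩ := List.exists_prefix_getLast?_of_mem hm'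
      obtain ⟨E', hE', hl', hle⟩ := h.blocks B' (hD.2 B' hm')
      exact ⟨E', hE'.1, hl', hle⟩
  | blk B =>
    rcases handle_blk (Pr := Pr) c s B with h' | h' | ⟨D, hD, hv, h'⟩
    · rw [h']
      refine ⟨h, .refl _, fun m' hm' B' hB' => ?_⟩
      rw [List.mem_singleton] at hm'
      rw [hm'] at hB'
      cases hB'
    · rw [h']
      exact ⟨h, .refl _, by simp⟩
    · rw [h']
      exact ⟨h.accept hD hv, evol_accept _ _ _, by simp⟩

/-- Handling a list of messages. -/
def handleAll (Pr : Params P Tx Hash Rnd) (c : Config P Tx Hash) (ms : List (Msg P Tx Hash))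
    (x : LocalState P Tx Hash × List (Msg P Tx Hash)) :
    LocalState P Tx Hash × List (Msg P Tx Hash) :=
  ms.foldl (fun x m => ((Pr.handle c x.1 m).1, x.2 ++ (Pr.handle c x.1 m).2)) x

@[simp] theorem handleAll_nil (c : Config P Tx Hash)
    (x : LocalState P Tx Hash × List (Msg P Tx Hash)) : Pr.handleAll c [] x = x := rfl

@[simp] theorem handleAll_cons (c : Config P Tx Hash) (m : Msg P Tx Hash)
    (ms : List (Msg P Tx Hash)) (x : LocalState P Tx Hash × List (Msg P Tx Hash)) :
    Pr.handleAll c (m :: ms) x =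
      Pr.handleAll c ms ((Pr.handle c x.1 m).1, x.2 ++ (Pr.handle c x.1 m).2) := rfl

theorem handleAll_append (c : Config P Tx Hash) (ms ms' : List (Msg P Tx Hash))
    (x : LocalState P Tx Hash × List (Msg P Tx Hash)) :
    Pr.handleAll c (ms ++ ms') x = Pr.handleAll c ms' (Pr.handleAll c ms x) := by
  simp [handleAll, List.foldl_append]

/-- The local state in which an activation starts to handle messages. -/
def wake (Pr : Params P Tx Hash Rnd) (ins : List Tx) (s : LocalState P Tx Hash) :
    LocalState P Tx Hash :=
  let s₁ := if s.retry then Pr.extend s else s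
  { s₁ with bcast := s₁.bcast ∪ {x | x.1 ∈ ins ∧ x.2 = s₁.chain} }

theorem activate_eq (c : Config P Tx Hash) (ins : List Tx) (ms : List (Msg P Tx Hash))
    (s : LocalState P Tx Hash) :
    Pr.activate c ins ms s = Pr.handleAll c ms (Pr.wake ins s, ins.map Msg.op) := rfl

theorem wake_chain (ins : List Tx) (s : LocalState P Tx Hash) :
    (Pr.wake ins s).chain = s.chain := by
  unfold wake
  dsimp only
  split_ifs <;> rfl

theorem wake_blocks (ins : List Tx) (s : LocalState P Tx Hash) :
    (Pr.wake ins s).blocks = s.blocks := by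
  unfold wake
  dsimp only
  split_ifs <;> rfl

theorem wake_unordered_subset (ins : List Tx) (s : LocalState P Tx Hash) :
    (Pr.wake ins s).unordered ⊆ s.unordered := by
  unfold wake
  dsimp only
  split_ifs
  · exact extend_unordered_subset s
  · exact subset_rfl

theorem mem_wake_delivered {ins : List Tx} {s : LocalState P Tx Hash} {tx : Tx}
    (h : tx ∈ (Pr.wake ins s).delivered) : tx ∈ s.delivered ∨ tx ∈ txsOf s.chain := by
  unfold wake at h
  dsimp only at h
  split_ifs at h
  · exact ((mem_extend_delivered s tx).1 h).imp_right
      fun h => txsOf_subset_of_prefix (dropLastK_prefix _ _) h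
  · exact Or.inl h

theorem wake_spec {c : Config P Tx Hash} {s : LocalState P Tx Hash} (h : Pr.LocOK c s)
    (ins : List Tx) : Pr.LocOK c (Pr.wake ins s) ∧ Evol s (Pr.wake ins s) := by
  unfold wake
  dsimp only
  have he := evol_extend (Pr := Pr) s
  split_ifs
  · exact ⟨⟨h.extend.known, h.extend.blocks, h.extend.deep, h.extend.nodup, h.extend.com⟩,
      he.blocks, he.delivered, he.chain⟩
  · exact ⟨⟨h.known, h.blocks, h.deep, h.nodup, h.com⟩, (Evol.refl s).blocks,
      (Evol.refl s).delivered, (Evol.refl s).chain⟩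

theorem OutOK.mono {c : Config P Tx Hash} {n n' : ℕ} (hn : n ≤ n') {m : Msg P Tx Hash}
    (h : Pr.OutOK c n m) : Pr.OutOK c n' m := by
  intro B hB
  obtain ⟨D, h₁, h₂, h₃⟩ := h B hB
  exact ⟨D, h₁, h₂, h₃.trans hn⟩

theorem handleAll_spec {c : Config P Tx Hash} (ms : List (Msg P Tx Hash))
    (x : LocalState P Tx Hash × List (Msg P Tx Hash)) (h : Pr.LocOK c x.1)
    (hx : ∀ m ∈ x.2, Pr.OutOK c x.1.chain.length m) :
    Pr.LocOK c (Pr.handleAll c ms x).1 ∧ Evol x.1 (Pr.handleAll c ms x).1 ∧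
      ∀ m ∈ (Pr.handleAll c ms x).2,
        Pr.OutOK c (Pr.handleAll c ms x).1.chain.length m := by
  induction ms generalizing x with
  | nil => exact ⟨h, .refl _, hx⟩
  | cons m ms ih =>
    obtain ⟨h₁, h₂, h₃⟩ := handle_spec h m
    rw [handleAll_cons]
    obtain ⟨h₄, h₅, h₆⟩ := ih ((Pr.handle c x.1 m).1, x.2 ++ (Pr.handle c x.1 m).2) h₁ (by
      intro m' hm'
      rcases List.mem_append.1 hm' with h | h
      · exact (hx m' h).mono h₂.length_le
      · exact (h₃ m' h).mono h₂.length_le)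
    exact ⟨h₄, h₂.trans h₅, h₆⟩

theorem activate_spec {c : Config P Tx Hash} {s : LocalState P Tx Hash} (h : Pr.LocOK c s)
    (ins : List Tx) (ms : List (Msg P Tx Hash)) :
    Pr.LocOK c (Pr.activate c ins ms s).1 ∧ Evol s (Pr.activate c ins ms s).1 ∧
      ∀ m ∈ (Pr.activate c ins ms s).2,
        Pr.OutOK c (Pr.activate c ins ms s).1.chain.length m := by
  obtain ⟨h₁, h₂⟩ := wake_spec h ins
  rw [activate_eq]
  obtain ⟨h₃, h₄, h₅⟩ := handleAll_spec ms (Pr.wake ins s, ins.map Msg.op) h₁ (by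
    intro m hm B hB
    subst hB
    simp at hm)
  exact ⟨h₃, h₂.trans h₄, h₅⟩

theorem LocOK.reset {c : Config P Tx Hash} {s : LocalState P Tx Hash} (h : Pr.LocOK c s)
    (r : Bool) : Pr.LocOK c { s with com := none, retry := r } :=
  ⟨h.known, h.blocks, h.deep, h.nodup, fun _ _ h => by simp at h⟩

theorem Evol.reset {s s' : LocalState P Tx Hash} (h : Evol s s') (r : Bool) :
    Evol s { s' with com := none, retry := r } :=
  ⟨h.blocks, h.delivered, h.chain⟩

theorem OutOK.lift {c c' : Config P Tx Hash} (hle : c.Le c') {n : ℕ} {m : Msg P Tx Hash}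
    (h : Pr.OutOK c n m) : Pr.OutOK c' n m := by
  intro B hB
  obtain ⟨D, h₁, h₂⟩ := h B hB
  exact ⟨D, h₁.mono hle, h₂⟩

end Params

end Chains

/-! ### A single time step and the invariant of reachable configurations. -/

noncomputable section Steps

variable {P Tx Hash Rnd : Type*} [DecidableEq P] [MeasurableSpace Rnd]
  {Pr : Params P Tx Hash Rnd}

namespace Params

/-- The configuration after the joins and corruptions of a time step. -/
def mid (Pr : Params P Tx Hash Rnd) (a : AdvAction P Tx Hash) (c : Config P Tx Hash) :
    Config P Tx Hash :=
  { c with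
    active := c.active ∪ a.join
    byz := c.byz ∪ a.corrupt
    loc := fun p => if p ∈ a.join \ c.active then Pr.initLocal else c.loc p }

/-- The result of the activation of `p` in a time step. -/
def result (Pr : Params P Tx Hash Rnd) (a : AdvAction P Tx Hash) (c : Config P Tx Hash) (p : P) :
    LocalState P Tx Hash × List (Msg P Tx Hash) :=
  Pr.activate (Pr.mid a c) (a.input p) (a.deliver p) ((Pr.mid a c).loc p)

/-- What `p` commits to in a time step. -/
def commitOf (Pr : Params P Tx Hash Rnd) (a : AdvAction P Tx Hash) (c : Config P Tx Hash)
    (p : P) : Option (Chain P Tx Hash × Block P Tx Hash) :=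
  if p ∈ (Pr.mid a c).active \ (Pr.mid a c).byz then (Pr.result a c p).1.com
  else if p ∈ (Pr.mid a c).byz then a.commit p else none

/-- The commit of `p` is answered by a resource commitment. -/
def Wins (Pr : Params P Tx Hash Rnd) (ω : Key P Tx Hash → Rnd) (a : AdvAction P Tx Hash)
    (c : Config P Tx Hash) (p : P) (st : Chain P Tx Hash × Block P Tx Hash) : Prop :=
  Pr.commitOf a c p = some st ∧ Pr.Elected ω (Pr.mid a c) p st

/-- The block that `p` makes from a resource commitment of slot `t`. -/
def mined (t : ℕ) (p : P) (B : Block P Tx Hash) : Block P Tx Hash :=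
  { B with proof := some (p, t), sig := some p }

variable {ω : Key P Tx Hash → Rnd} {a : AdvAction P Tx Hash} {c : Config P Tx Hash}

theorem step_time : (Pr.step ω a c).time = c.time + 1 := rfl

theorem step_active : (Pr.step ω a c).active = c.active ∪ a.join := rfl

theorem step_byz : (Pr.step ω a c).byz = c.byz ∪ a.corrupt := rfl

theorem mem_step_assigned (x : Key P Tx Hash) : x ∈ (Pr.step ω a c).assigned ↔
    x ∈ c.assigned ∨ ∃ st, Pr.Wins ω a c x.1 st ∧ x.2 = (Pr.view st.1 c.time, c.time) := Iff.rfl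

theorem mem_step_signed (B : Block P Tx Hash) : B ∈ (Pr.step ω a c).signed ↔
    B ∈ c.signed ∨ ∃ p st, p ∈ (Pr.mid a c).active \ (Pr.mid a c).byz ∧ Pr.Wins ω a c p st ∧
      B = mined c.time p st.2 := Iff.rfl

theorem step_loc_of_correct {p : P} (hp : p ∈ (Pr.mid a c).active \ (Pr.mid a c).byz) :
    ∃ r, (Pr.step ω a c).loc p = { (Pr.result a c p).1 with com := none, retry := r } := by
  refine ⟨?_, ?_⟩
  rotate_left
  · exact if_pos hp

theorem step_loc_of_not_correct {p : P} (hp : p ∉ (Pr.mid a c).active \ (Pr.mid a c).byz) :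
    (Pr.step ω a c).loc p = (Pr.mid a c).loc p :=
  if_neg hp

theorem step_net_of_not_mem {q : P} (hq : q ∉ (Pr.mid a c).active) (hn : c.net q = []) :
    (Pr.step ω a c).net q = [] := by
  unfold step
  dsimp only
  rw [hn, List.filter_nil, List.nil_append]
  exact if_neg hq

theorem mem_step_net {q : P} {x : P × ℕ × Msg P Tx Hash} (hx : x ∈ (Pr.step ω a c).net q) :
    (x ∈ c.net q ∧ x.2.2 ∉ a.deliver q) ∨
    (x.1 ∈ (Pr.mid a c).active \ (Pr.mid a c).byz ∧ x.2.1 = c.time ∧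
      (x.2.2 ∈ (Pr.result a c x.1).2 ∨
        ∃ st, Pr.Wins ω a c x.1 st ∧ x.2.2 = .blk (mined c.time x.1 st.2))) := by
  unfold step at hx
  dsimp only at hx
  rcases List.mem_append.1 hx with h' | h'
  · simp only [List.mem_filter, decide_eq_true_eq] at h'
    exact Or.inl h'
  · right
    split_ifs at h'
    · simp only [List.mem_flatMap, Finset.mem_toList, List.mem_map, List.mem_append,
        List.mem_filter, Option.mem_toList, decide_eq_true_eq] at h'
      obtain ⟨p, hp, m, hm, rfl⟩ := h'
      refine ⟨hp, rfl, ?_⟩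
      rcases hm with hm | ⟨st, ⟨_, hst⟩, rfl⟩
      · exact Or.inl hm
      · exact Or.inr ⟨st, hst, rfl⟩
    · simp at h'

theorem mid_le (a : AdvAction P Tx Hash) (c : Config P Tx Hash) : c.Le (Pr.mid a c) :=
  ⟨Finset.subset_union_left, subset_rfl, subset_rfl⟩

theorem mid_le_step (ω : Key P Tx Hash → Rnd) (a : AdvAction P Tx Hash) (c : Config P Tx Hash) :
    (Pr.mid a c).Le (Pr.step ω a c) :=
  ⟨subset_rfl, Set.subset_union_left, Set.subset_union_left⟩

theorem le_step (ω : Key P Tx Hash → Rnd) (a : AdvAction P Tx Hash) (c : Config P Tx Hash) :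
    c.Le (Pr.step ω a c) :=
  (mid_le a c).trans (mid_le_step ω a c)

/-- Invariants of the configurations that can occur. -/
structure GlobOK (Pr : Params P Tx Hash Rnd) (c : Config P Tx Hash) : Prop where
  slot : ∀ x ∈ c.assigned, x.2.2 < c.time
  byz : c.byz ⊆ c.active
  inactive_loc : ∀ p ∉ c.active, c.loc p = Pr.initLocal
  inactive_net : ∀ p ∉ c.active, c.net p = []
  loc : ∀ p ∈ c.active \ c.byz, Pr.LocOK c (c.loc p)
  signed : ∀ B ∈ c.signed, ∀ i, B.sig = some i → i ∈ c.active ∧ (i ∉ c.byz →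
    ∃ D, Pr.ValidChain c (D ++ [B]) ∧ D ≠ [] ∧ D.length ≤ (c.loc i).chain.length ∧
      (D.length = (c.loc i).chain.length →
        D = (c.loc i).chain ∧ ∀ tx ∈ B.txs, tx ∈ (c.loc i).unordered))
  net : ∀ q, ∀ x ∈ c.net q, x.1 ∈ c.active ∧ (x.1 ∉ c.byz → ∀ B, x.2.2 = .blk B →
    Pr.OutOK c (c.loc x.1).chain.length x.2.2 ∨ (B ∈ c.signed ∧ B.sig = some x.1))

/-- Joining does not change any local state, because processes that have not joined are already
stored in the initial state. -/
theorem GlobOK.mid_loc (h : Pr.GlobOK c) (p : P) : (Pr.mid a c).loc p = c.loc p := by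
  by_cases hp : p ∈ a.join \ c.active
  · rw [h.inactive_loc p (Finset.mem_sdiff.1 hp).2]
    exact if_pos hp
  · exact if_neg hp

theorem GlobOK.mid_locOK (h : Pr.GlobOK c) {p : P}
    (hp : p ∈ (Pr.mid a c).active \ (Pr.mid a c).byz) :
    Pr.LocOK (Pr.mid a c) ((Pr.mid a c).loc p) := by
  rw [h.mid_loc]
  by_cases hpa : p ∈ c.active
  · refine (h.loc p (Finset.mem_sdiff.2 ⟨hpa, fun hb => ?_⟩)).mono (mid_le a c)
    exact (Finset.mem_sdiff.1 hp).2 (Finset.mem_union_left _ hb)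
  · rw [h.inactive_loc p hpa]
    exact locOK_initLocal _

theorem GlobOK.result_spec (h : Pr.GlobOK c) {p : P}
    (hp : p ∈ (Pr.mid a c).active \ (Pr.mid a c).byz) :
    Pr.LocOK (Pr.mid a c) (Pr.result a c p).1 ∧ Evol (c.loc p) (Pr.result a c p).1 ∧
      ∀ m ∈ (Pr.result a c p).2,
        Pr.OutOK (Pr.mid a c) (Pr.result a c p).1.chain.length m := by
  have := activate_spec (h.mid_locOK hp) (a.input p) (a.deliver p)
  rw [← h.mid_loc (a := a) p]
  exact this

theorem GlobOK.evol (h : Pr.GlobOK c) (ω : Key P Tx Hash → Rnd) (a : AdvAction P Tx Hash)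
    (p : P) : Evol (c.loc p) ((Pr.step ω a c).loc p) := by
  by_cases hp : p ∈ (Pr.mid a c).active \ (Pr.mid a c).byz
  · obtain ⟨r, hr⟩ := step_loc_of_correct (ω := ω) hp
    rw [hr]
    exact (h.result_spec hp).2.1.reset r
  · rw [step_loc_of_not_correct hp, h.mid_loc]
    exact .refl _

/-- A correct process that wins extends its local chain by a valid block. -/
theorem GlobOK.wins_spec (h : Pr.GlobOK c) {p : P}
    (hp : p ∈ (Pr.mid a c).active \ (Pr.mid a c).byz) {st : Chain P Tx Hash × Block P Tx Hash}
    (hw : Pr.Wins ω a c p st) : st.1 = (Pr.result a c p).1.chain ∧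
      Pr.ValidChain (Pr.step ω a c) (st.1 ++ [mined c.time p st.2]) ∧
      ∀ tx ∈ st.2.txs, tx ∈ (Pr.result a c p).1.unordered := by
  have hc := hw.1
  rw [commitOf, if_pos hp] at hc
  obtain ⟨h₁, h₂, h₃, h₄⟩ := (h.result_spec hp).1.com st.1 st.2 hc
  refine ⟨h₁, ?_, h₄⟩
  refine .snoc _ _ (hw.2.1.mono (mid_le_step ω a c)) ?_ h₃ ?_ ?_
  · exact hw.2.2.1
  · exact ⟨p, c.time, rfl, rfl, Or.inr ((mem_step_signed _).2 (Or.inr ⟨p, st, hp, hw, rfl⟩))⟩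
  · refine ⟨p, c.time, rfl, (mem_step_assigned _).2 (Or.inr ⟨st, hw, rfl⟩), ?_⟩
    intro A hA x hx
    exact hw.2.1.slot_lt (c := Pr.mid a c) h.slot A (List.mem_of_getLast? hA) x hx

theorem GlobOK.step (h : Pr.GlobOK c) (ω : Key P Tx Hash → Rnd) (ha : Pr.Legal c a) :
    Pr.GlobOK (Pr.step ω a c) := by
  have hcor : ∀ {p}, p ∈ (Pr.step ω a c).active \ (Pr.step ω a c).byz ↔
    p ∈ (Pr.mid a c).active \ (Pr.mid a c).byz := Iff.rfl
  refine ⟨?_, ?_, ?_, ?_, ?_, ?_, ?_⟩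
  · intro x hx
    rw [step_time]
    rcases (mem_step_assigned x).1 hx with hx | ⟨st, -, hx⟩
    · exact (h.slot x hx).trans (Nat.lt_succ_self _)
    · rw [hx]
      exact Nat.lt_succ_self _
  · rw [step_byz, step_active]
    exact Finset.union_subset (h.byz.trans Finset.subset_union_left)
      (ha.corrupt_active.trans Finset.subset_union_left)
  · intro p hp
    rw [step_loc_of_not_correct (fun hp' => hp (Finset.mem_sdiff.1 hp').1), h.mid_loc]
    exact h.inactive_loc p fun hp' => hp (Finset.mem_union_left _ hp')
  · intro p hp
    exact step_net_of_not_mem hp (h.inactive_net p fun hp' => hp (Finset.mem_union_left _ hp'))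
  · intro p hp
    obtain ⟨r, hr⟩ := step_loc_of_correct (ω := ω) (hcor.1 hp)
    rw [hr]
    exact ((h.result_spec (hcor.1 hp)).1.mono (mid_le_step ω a c)).reset r
  · intro B hB i hi
    rcases (mem_step_signed B).1 hB with hB | ⟨p, st, hp, hw, rfl⟩
    · obtain ⟨h₁, h₂⟩ := h.signed B hB i hi
      refine ⟨Finset.mem_union_left _ h₁, fun hi' => ?_⟩
      obtain ⟨D, hD, hne, hle, heq⟩ := h₂ fun hb => hi' (Finset.mem_union_left _ hb)
      have hev := h.evol ω a i
      refine ⟨D, hD.mono (le_step ω a c), hne, hle.trans hev.length_le, fun hl => ?_⟩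
      -- A longer local chain makes the last clause vacuous. With an unchanged chain, the
      -- transactions of a signed block stay unordered, since a valid block repeats nothing of its
      -- parent chain.
      rcases hev.chain with hlt | ⟨hch, hun⟩
      · omega
      · rw [hch] at hl
        obtain ⟨h₃, h₄⟩ := heq hl
        refine ⟨hch ▸ h₃, fun tx htx => hun tx (h₄ tx htx) ?_⟩
        rw [← h₃]
        exact (Pr.validTx_fresh _ _ (hD.snoc_inv hne).2.2.1).2 tx htx
    · obtain rfl : p = i := by simpa [mined] using hi
      refine ⟨(Finset.mem_sdiff.1 hp).1, fun _ => ?_⟩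
      obtain ⟨h₁, h₂, h₃⟩ := h.wins_spec hp hw
      obtain ⟨r, hr⟩ := step_loc_of_correct (ω := ω) hp
      rw [hr]
      exact ⟨st.1, h₂, hw.2.1.ne_nil, by rw [h₁], fun _ => ⟨h₁, h₃⟩⟩
  · intro q x hx
    rcases mem_step_net hx with ⟨hx, -⟩ | ⟨hp, -, hx⟩
    · obtain ⟨h₁, h₂⟩ := h.net q x hx
      refine ⟨Finset.mem_union_left _ h₁, fun hi B hB => ?_⟩
      rcases h₂ (fun hb => hi (Finset.mem_union_left _ hb)) B hB with h' | ⟨h', h''⟩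
      · exact Or.inl ((h'.lift (le_step ω a c)).mono (h.evol ω a x.1).length_le)
      · exact Or.inr ⟨(le_step ω a c).signed h', h''⟩
    · refine ⟨(Finset.mem_sdiff.1 hp).1, fun _ B hB => ?_⟩
      rcases hx with hx | ⟨st, hw, hx⟩
      · left
        obtain ⟨r, hr⟩ := step_loc_of_correct (ω := ω) hp
        rw [hr]
        exact ((h.result_spec hp).2.2 _ hx).lift (mid_le_step ω a c)
      · right
        rw [hx] at hB
        cases hB
        exact ⟨(mem_step_signed _).2 (Or.inr ⟨_, st, hp, hw, rfl⟩), rfl⟩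

theorem Reachable.globOK (h : Pr.Reachable c) : Pr.GlobOK c := by
  induction h with
  | init =>
    refine ⟨?_, ?_, ?_, ?_, ?_, ?_, ?_⟩ <;> simp [initConfig]
  | step ω a c _ ha ih => exact ih.step ω ha

end Params

end Steps

/-! ### The effect of delivering many messages in one activation. -/

noncomputable section Delivery

variable {P Tx Hash Rnd : Type*} [MeasurableSpace Rnd] {Pr : Params P Tx Hash Rnd}

namespace Params

/-- The effect of receiving all blocks of a valid chain in order. -/
structure ChainReceived (c : Config P Tx Hash) (D : Chain P Tx Hash)
    (x y : LocalState P Tx Hash × List (Msg P Tx Hash)) : Prop where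
  out : y.2 = x.2
  blocks : ∀ B ∈ D, B ∈ y.1.blocks
  blocks_subset : ∀ B ∈ y.1.blocks, B ∈ x.1.blocks ∨ B ∈ D
  chain : y.1.chain = if x.1.chain.length < D.length then D else x.1.chain
  unordered : y.1.unordered ⊆ x.1.unordered
  delivered : ∀ tx ∈ y.1.delivered, tx ∈ x.1.delivered ∨ tx ∈ txsOf D

theorem tail_concat_of_ne_nil {α : Type*} {l : List α} (h : l ≠ []) (a : α) :
    (l ++ [a]).tail = l.tail ++ [a] :=
  List.tail_append_of_ne_nil h

theorem accept_unordered_subset (s : LocalState P Tx Hash) (C : Chain P Tx Hash)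
    (B : Block P Tx Hash) : (Pr.accept s C B).unordered ⊆ s.unordered := by
  unfold accept
  dsimp only
  split_ifs
  · exact extend_unordered_subset _
  · exact subset_rfl

theorem mem_accept_delivered {s : LocalState P Tx Hash} {C : Chain P Tx Hash}
    {B : Block P Tx Hash} {tx : Tx} (h : tx ∈ (Pr.accept s C B).delivered) :
    tx ∈ s.delivered ∨ tx ∈ txsOf (C ++ [B]) := by
  unfold accept at h
  dsimp only at h
  split_ifs at h
  · exact ((mem_extend_delivered _ tx).1 h).imp_right
      fun h => txsOf_subset_of_prefix (dropLastK_prefix _ _) h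
  · exact Or.inl h

/-- In this order each block finds its parent chain already known, so it is accepted without a
request. The genesis block is known to every process and need not be sent. -/
theorem handleAll_chain {c : Config P Tx Hash} {D : Chain P Tx Hash}
    {x : LocalState P Tx Hash × List (Msg P Tx Hash)} (hx : Pr.LocOK c x.1)
    (hD : Pr.ValidChain c D) :
    ChainReceived c D x (Pr.handleAll c (D.tail.map Msg.blk) x) := by
  induction hD with
  | genesis =>
    have hne := List.length_pos_iff.2 hx.known.1.ne_nil
    refine ⟨rfl, ?_, fun B hB => Or.inl hB, ?_, subset_rfl, fun tx h => Or.inl h⟩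
    · intro B hB
      exact hx.known.2 B (hx.known.1.genesis_prefix.subset hB)
    · rw [if_neg (not_lt.2 hne)]
      rfl
  | snoc E B hE hl ht hv hc ih =>
    have hEB : Pr.ValidChain c (E ++ [B]) := .snoc E B hE hl ht hv hc
    rw [tail_concat_of_ne_nil hE.ne_nil, List.map_append, handleAll_append]
    set y := Pr.handleAll c (E.tail.map Msg.blk) x with hy
    have hk : Pr.Known c y.1 E := ⟨hE, ih.blocks⟩
    simp only [List.map_cons, List.map_nil, handleAll_cons, handleAll_nil,
      handle_blk_of_known hk hEB, List.append_nil]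
    refine ⟨ih.out, ?_, ?_, ?_, (accept_unordered_subset _ _ _).trans ih.unordered, ?_⟩
    · intro B' hB'
      rw [accept_blocks]
      rcases List.mem_append.1 hB' with h | h
      · exact Set.mem_insert_of_mem _ (ih.blocks B' h)
      · exact Set.mem_insert_iff.2 (Or.inl (List.mem_singleton.1 h))
    · intro B' hB'
      rw [accept_blocks] at hB'
      rcases Set.mem_insert_iff.1 hB' with rfl | h
      · exact Or.inr (by simp)
      · exact (ih.blocks_subset B' h).imp_right (List.mem_append_left _)
    · rw [accept_chain, ih.chain]
      simp only [List.length_append, List.length_singleton]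
      split_ifs <;> first | rfl | omega
    · intro tx htx
      rcases mem_accept_delivered htx with h | h
      · exact (ih.delivered tx h).imp_right
          fun h => txsOf_subset_of_prefix (List.prefix_append _ _) h
      · exact Or.inr h

theorem ChainReceived.chain_eq {c : Config P Tx Hash} {D : Chain P Tx Hash}
    {x y : LocalState P Tx Hash × List (Msg P Tx Hash)} (h : ChainReceived c D x y)
    (hx : x.1.chain <+: D) : y.1.chain = D := by
  rw [h.chain]
  split_ifs with hlt
  · rfl
  · exact hx.eq_of_length (le_antisymm hx.length_le (not_lt.1 hlt))

theorem ChainReceived.chain_eq_of_le {c : Config P Tx Hash} {D : Chain P Tx Hash}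
    {x y : LocalState P Tx Hash × List (Msg P Tx Hash)} (h : ChainReceived c D x y)
    (hx : D.length ≤ x.1.chain.length) : y.1.chain = x.1.chain := by
  rw [h.chain, if_neg (not_lt.2 hx)]

open Classical in
-- The process calls `extend` after every block. Delivering a prefix first and the longer list
-- afterwards has the same effect as delivering the longer list once, so only the final chain
-- counts.
theorem handleAll_chain_delivered {c : Config P Tx Hash} {D : Chain P Tx Hash}
    (out : List (Msg P Tx Hash)) (hD : Pr.ValidChain c D) :
    (Pr.handleAll c (D.tail.map Msg.blk) (Pr.initLocal, out)).1.delivered =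
      (txsOf (dropLastK D Pr.k)).foldl (fun d tx => if tx ∈ d then d else d ++ [tx]) [] := by
  have key : ∀ l l' d : List Tx, l <+: l' →
      l'.foldl (fun d tx => if tx ∈ d then d else d ++ [tx])
        (l.foldl (fun d tx => if tx ∈ d then d else d ++ [tx]) d) =
      l'.foldl (fun d tx => if tx ∈ d then d else d ++ [tx]) d := by
    have hfix : ∀ l d : List Tx, (∀ tx ∈ l, tx ∈ d) →
        l.foldl (fun d tx => if tx ∈ d then d else d ++ [tx]) d = d := by
      intro l
      induction l with
      | nil => intro d _; rfl
      | cons a l ih =>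
        intro d h
        rw [List.foldl_cons, if_pos (h a (by simp)), ih d fun tx ht => h tx (by simp [ht])]
    rintro l _ d ⟨m, rfl⟩
    rw [List.foldl_append, List.foldl_append, hfix l]
    exact fun tx ht => (mem_foldl_deliver _ _ _).2 (Or.inr ht)
  have hinit := locOK_initLocal (Pr := Pr) c
  induction hD with
  | genesis => rfl
  | snoc E B hE hl ht hv hc ih =>
    have hEB : Pr.ValidChain c (E ++ [B]) := .snoc E B hE hl ht hv hc
    rw [tail_concat_of_ne_nil hE.ne_nil, List.map_append, handleAll_append]
    have hr := handleAll_chain (x := (Pr.initLocal, out)) hinit hE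
    have hch : _ = E := hr.chain_eq hE.genesis_prefix
    set y := Pr.handleAll c (E.tail.map Msg.blk) (Pr.initLocal, out) with hy
    simp only [List.map_cons, List.map_nil, handleAll_cons, handleAll_nil,
      handle_blk_of_known ⟨hE, hr.blocks⟩ hEB]
    unfold accept
    dsimp only
    rw [if_pos (by rw [hch]; simp), extend_delivered]
    dsimp only
    rw [ih]
    refine key _ _ _ ?_
    have : dropLastK E Pr.k <+: dropLastK (E ++ [B]) Pr.k := by
      unfold dropLastK
      refine List.prefix_of_prefix_length_le ((List.take_prefix _ _).trans
        (List.prefix_append E [B])) (List.take_prefix _ _) ?_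
      simp only [List.length_take, List.length_append, List.length_singleton]
      omega
    obtain ⟨F, hF⟩ := this
    exact ⟨txsOf F, by rw [← txsOf_append, hF]⟩

/-- The effect of messages that do not change the local chain. -/
structure Unaffected (c : Config P Tx Hash) (Q X : Chain P Tx Hash → Prop)
    (ops : Set Tx) (x y : LocalState P Tx Hash × List (Msg P Tx Hash)) : Prop where
  chain : y.1.chain = x.1.chain
  delivered : y.1.delivered = x.1.delivered
  unordered : y.1.unordered ⊆ x.1.unordered ∪ ops
  blocks_mono : x.1.blocks ⊆ y.1.blocks
  blocks : ∀ B ∈ y.1.blocks, ∃ D, Pr.ValidChain c D ∧ D.getLast? = some B ∧ (Q D ∨ X D)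
  out_blk : ∀ B, Msg.blk B ∈ y.2 → ∃ D, Pr.ValidChain c D ∧ D.getLast? = some B ∧ Q D
  out_request : ∀ B, Msg.request B ∈ y.2 → ∃ D, Pr.ValidChain c D ∧ D.getLast? = some B ∧ Q D
  out_op : ∀ tx, Msg.op tx ∉ y.2

/-- `Q` describes the chains that may circulate, `X` those that are known but must not spread.
Chains in `Q` are too short to displace the local one. A leak could come only from the answer to a
request, and `hreq` requires that any requested chain in `X` is in `Q` as well. -/
theorem handleAll_unaffected {c : Config P Tx Hash} {Q X : Chain P Tx Hash → Prop} {n : ℕ}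
    {ops : Set Tx} (hQ : ∀ D E, Q D → E <+: D → E ≠ [] → Q E) (hn : ∀ D, Q D → D.length ≤ n)
    (ms : List (Msg P Tx Hash)) (x : LocalState P Tx Hash × List (Msg P Tx Hash))
    (hx : Unaffected (Pr := Pr) c Q X ops x x) (hlen : n ≤ x.1.chain.length)
    (hop : ∀ tx, Msg.op tx ∈ ms → tx ∈ ops)
    (hblk : ∀ B, Msg.blk B ∈ ms → ∃ D, Pr.ValidChain c D ∧ D.getLast? = some B ∧ Q D)
    (hreq : ∀ B, Msg.request B ∈ ms → ∀ D, Pr.ValidChain c D → D.getLast? = some B → X D → Q D) :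
    Unaffected (Pr := Pr) c Q X ops x (Pr.handleAll c ms x) := by
  suffices h : ∀ z, Unaffected (Pr := Pr) c Q X ops x z →
      Unaffected (Pr := Pr) c Q X ops x (Pr.handleAll c ms z) from h x hx
  induction ms with
  | nil => exact fun z hz => hz
  | cons m ms ih =>
    intro z hz
    rw [handleAll_cons]
    refine ih (fun tx h => hop tx (List.mem_cons_of_mem _ h))
      (fun B h => hblk B (List.mem_cons_of_mem _ h))
      (fun B h => hreq B (List.mem_cons_of_mem _ h)) _ ?_
    cases m with
    | op tx =>
      rw [handle_op]
      refine ⟨hz.chain, hz.delivered, ?_, hz.blocks_mono, hz.blocks, ?_, ?_, ?_⟩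
      · exact Set.insert_subset (Or.inr (hop tx (by simp))) hz.unordered
      · simpa using hz.out_blk
      · simpa using hz.out_request
      · simpa using hz.out_op
    | request B =>
      rcases handle_request (Pr := Pr) c z.1 B with h | ⟨D, hD, hl, h⟩
      · rw [h]
        simpa using hz
      · rw [h]
        -- The chain sent in reply ends with the requested block, hence it is the one that
        -- `hz.blocks` provides for this block.
        have hQD : Q D := by
          obtain ⟨E, hE, hE', hor⟩ := hz.blocks B (hD.2 B (List.mem_of_getLast? hl))
          have := hE.unique hD.1 (hE'.trans hl.symm)
          subst this
          rcases hor with hor | hor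
          · exact hor
          · exact hreq B (by simp) E hE hE' hor
        refine ⟨hz.chain, hz.delivered, hz.unordered, hz.blocks_mono, hz.blocks, ?_, ?_, ?_⟩
        · intro B' hB'
          simp only [List.mem_append, List.mem_map, Msg.blk.injEq, exists_eq_right] at hB'
          rcases hB' with hB' | hB'
          · exact hz.out_blk B' hB'
          · obtain ⟨E, hE, hl'⟩ := List.exists_prefix_getLast?_of_mem hB'
            have hne : E ≠ [] := by rintro rfl; simp at hl'
            exact ⟨E, hD.1.of_prefix hE hne, hl', hQ D E hQD hE hne⟩
        · simpa using hz.out_request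
        · simpa using hz.out_op
    | blk B =>
      obtain ⟨D, hD, hl, hQD⟩ := hblk B (by simp)
      rcases handle_blk (Pr := Pr) c z.1 B with h | h | ⟨E, hE, hEB, h⟩
      · rw [h]
        refine ⟨hz.chain, hz.delivered, hz.unordered, hz.blocks_mono, hz.blocks, ?_, ?_, ?_⟩
        · simpa using hz.out_blk
        · intro B' hB'
          simp only [List.mem_append, List.mem_singleton, Msg.request.injEq] at hB'
          rcases hB' with hB' | rfl
          · exact hz.out_request B' hB'
          · exact ⟨D, hD, hl, hQD⟩
        · simpa using hz.out_op
      · rw [h]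
        simpa using hz
      · rw [h]
        have := hD.unique hEB (by rw [hl, List.getLast?_concat])
        subst this
        rw [accept_of_le (by rw [hz.chain]; exact (hn _ hQD).trans hlen)]
        refine ⟨hz.chain, hz.delivered, hz.unordered,
          hz.blocks_mono.trans (Set.subset_insert _ _), ?_, ?_, ?_, ?_⟩
        · intro B' hB'
          rcases Set.mem_insert_iff.1 hB' with rfl | hB'
          · exact ⟨_, hD, hl, Or.inl hQD⟩
          · exact hz.blocks B' hB'
        · simpa using hz.out_blk
        · simpa using hz.out_request
        · simpa using hz.out_op

end Params

end Delivery

/-! ### The strategy of the adversary and its invariants. -/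

noncomputable section Strategy

set_option linter.unusedSectionVars false

variable {P Tx Hash Rnd : Type*} [DecidableEq P] [MeasurableSpace Rnd]
  {Pr : Params P Tx Hash Rnd}

/-- The data of a long-range attack that forks from the chain `base` after height `fork`. -/
structure Plan (P Tx Hash : Type*) where
  start : Config P Tx Hash
  base : Chain P Tx Hash
  fork : ℕ
  /-- the corrupted processes -/
  A : Finset P
  /-- the processes outside `A` to which the private chain is revealed -/
  S : Finset P
  /-- the process that joins when the private chain is revealed -/
  q : P
  /-- the transactions of the first private block -/
  l : List Tx
  /-- the length up to which the adversary supports the public chain -/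
  N : ℕ
  /-- the lead at which the private chain is revealed -/
  L : ℕ
  /-- the time before which the private chain is not revealed -/
  T : ℕ

/-- The variables of the adversary: the public chain, the private chain, and whether the private
chain has been revealed. -/
structure PlanState (P Tx Hash : Type*) where
  pub : Chain P Tx Hash
  priv : Chain P Tx Hash
  rel : Prop

namespace Plan

variable (d : Plan P Tx Hash)

/-- The assumptions under which the attack works. -/
structure OK (Pr : Params P Tx Hash Rnd) : Prop where
  reach : Pr.Reachable d.start
  chain : ∀ j ∈ d.start.active \ d.start.byz, (d.start.loc j).chain = d.base
  fork_lt : d.fork + 1 < d.base.length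
  byz : d.start.byz ⊆ d.A
  active : d.A ⊆ d.start.active
  nonempty : (d.start.active \ d.A).Nonempty
  budget : ∀ C', ExtensionBy Pr (pending d.start d.A) d.base C' →
    ∑ p ∈ d.A, Pr.stateAlloc p C' = Pr.RA
  S_subset : d.S ⊆ d.start.active \ d.A
  q_notMem : d.q ∉ d.start.active
  valid : Pr.validTx (upTo d.base d.fork) d.l
  L_pos : 0 < d.L
  fork_lt_N : d.fork + 1 + Pr.k < d.N
  cutoff : ∀ t, d.T ≤ t → d.start.time ≤ Pr.cutoff t

/-- The transactions of the next private block. -/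
def privTxs (C : Chain P Tx Hash) : List Tx := if C.length = d.fork + 1 then d.l else []

/-- `B` is accepted as the next block of the public chain `G`. -/
def PubNext (Pr : Params P Tx Hash Rnd) (c : Config P Tx Hash) (G : Chain P Tx Hash)
    (B : Block P Tx Hash) : Prop :=
  Pr.ValidChain c (G ++ [B]) ∧
    ((B ∈ c.signed ∧ ∃ i ∉ d.A, B.sig = some i) ∨ (G.length < d.N ∧ B.txs = []))

/-- In the previous time step, `p` was elected to extend the private chain. -/
def PrivNext (Pr : Params P Tx Hash Rnd) (c : Config P Tx Hash) (s : PlanState P Tx Hash)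
    (p : P) : Prop :=
  d.N ≤ s.pub.length ∧ d.start.time < c.time ∧ p ∈ d.A ∧
    (p, Pr.view s.priv (c.time - 1), c.time - 1) ∈ c.assigned

/-- The block of the private chain `C` made by `p` in slot `t`. -/
def privBlock (Pr : Params P Tx Hash Rnd) (C : Chain P Tx Hash) (t : ℕ) (p : P) :
    Block P Tx Hash :=
  Params.mined t p ⟨C.getLast?.map Pr.H, d.privTxs C, none, none⟩

open Classical in
/-- The new public chain. -/
def nextPub (Pr : Params P Tx Hash Rnd) (s : PlanState P Tx Hash) (c : Config P Tx Hash) :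
    Chain P Tx Hash :=
  if h : ∃ B, d.PubNext Pr c s.pub B then s.pub ++ [h.choose] else s.pub

open Classical in
/-- The new private chain. -/
def nextPriv (Pr : Params P Tx Hash Rnd) (s : PlanState P Tx Hash) (c : Config P Tx Hash) :
    Chain P Tx Hash :=
  if h : ∃ p, d.PrivNext Pr c s p then s.priv ++ [d.privBlock Pr s.priv (c.time - 1) h.choose]
  else s.priv

/-- The reaction of the adversary to a new configuration. -/
def update (Pr : Params P Tx Hash Rnd) (s : PlanState P Tx Hash) (c : Config P Tx Hash) :
    PlanState P Tx Hash where
  pub := d.nextPub Pr s c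
  priv := d.nextPriv Pr s c
  rel := s.rel ∨ (d.T ≤ c.time ∧ d.N ≤ (d.nextPub Pr s c).length ∧
    (d.nextPub Pr s c).length + d.L ≤ (d.nextPriv Pr s c).length)

/-- What the adversary commits to. -/
def target (Pr : Params P Tx Hash Rnd) (s : PlanState P Tx Hash) :
    Chain P Tx Hash × Block P Tx Hash :=
  if s.pub.length < d.N then (s.pub, ⟨s.pub.getLast?.map Pr.H, [], none, none⟩)
  else (s.priv, ⟨s.priv.getLast?.map Pr.H, d.privTxs s.priv, none, none⟩)

open Classical in
/-- The blocks of the private chain, where they are revealed. -/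
def privMsgs (s : PlanState P Tx Hash) (x : P) : List (Msg P Tx Hash) :=
  if s.rel ∧ x ∈ insert d.q d.S then s.priv.tail.map Msg.blk else []

/-- The messages from processes outside `A`. -/
def netMsgs (c : Config P Tx Hash) (x : P) : List (Msg P Tx Hash) :=
  ((c.net x).filter fun y => decide (y.1 ∉ d.A)).map fun y => y.2.2

open Classical in
/-- The action of the adversary. -/
def action (Pr : Params P Tx Hash Rnd) (s : PlanState P Tx Hash) (c : Config P Tx Hash) :
    AdvAction P Tx Hash where
  join := if s.rel then {d.q} else ∅
  corrupt := d.A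
  input := fun _ => []
  deliver := fun x => d.privMsgs s x ++ (s.pub.tail.map Msg.blk ++ d.netMsgs c x)
  commit := fun p => if p ∈ d.A then some (d.target Pr s) else none

/-- The initial variables of the adversary. -/
def initState : PlanState P Tx Hash := ⟨d.base, upTo d.base d.fork, False⟩

/-- The variables of the adversary after a history. -/
def stateOf (Pr : Params P Tx Hash Rnd) : List (Config P Tx Hash) → PlanState P Tx Hash
  | [] => d.initState
  | c :: h => d.update Pr (stateOf Pr h) c

/-- The strategy of the adversary. -/
def strategy (Pr : Params P Tx Hash Rnd) : Strategy P Tx Hash :=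
  fun h => d.action Pr (d.stateOf Pr h) (h.headD d.start)

/-- Chains which do not contain private blocks. -/
def Clean (D : Chain P Tx Hash) : Prop :=
  (∀ B ∈ D, ∀ x ∈ B.proof, x.2 < d.start.time) ∨ d.base <+: D

/-- The valid chain that ends with `B` satisfies `Q`. -/
def Ends (Pr : Params P Tx Hash Rnd) (c : Config P Tx Hash) (Q : Chain P Tx Hash → Prop)
    (B : Block P Tx Hash) : Prop :=
  ∃ D, Pr.ValidChain c D ∧ D.getLast? = some B ∧ Q D

/-- The properties of the private chain. -/
structure PrivOK (Pr : Params P Tx Hash Rnd) (c : Config P Tx Hash) (C : Chain P Tx Hash) :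
    Prop where
  valid : Pr.ValidChain c C
  shape : C = upTo d.base d.fork ∨ ∃ B E, C = upTo d.base d.fork ++ B :: E ∧ B.txs = d.l ∧
    ∀ B' ∈ E, B'.txs = []
  tail : ∀ B ∈ C.drop (d.fork + 1), ∃ p ∈ d.A, ∃ sl, B.sig = some p ∧ B.proof = some (p, sl) ∧
    d.start.time ≤ sl

/-- Facts about a configuration that do not involve the variables of the adversary. -/
structure BaseInv (Pr : Params P Tx Hash Rnd) (c : Config P Tx Hash) : Prop where
  reach : Pr.Reachable c
  time : d.start.time ≤ c.time
  mono : d.start.active ⊆ c.active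
  byz : c.byz ⊆ d.A
  byz_eq : d.start.time < c.time → c.byz = d.A
  active : ∀ j ∈ c.active, j = d.q ∨ j ∈ d.start.active
  unord : ∀ j ∈ c.active \ d.A, j ≠ d.q → (c.loc j).unordered ⊆ pending d.start d.A
  net_op : ∀ j ∈ c.active \ d.A, ∀ tx, Msg.op tx ∈ d.netMsgs c j → tx ∈ pending d.start d.A
  net_request : d.start.time < c.time → ∀ j ∈ c.active \ d.A, ∀ B,
    Msg.request B ∈ d.netMsgs c j → Ends Pr c d.Clean B
  signed : ∀ B ∈ c.signed, B.sig ≠ some d.q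

/-- The state in which the adversary sees the configuration `c`, before it updates its variables
`s`. -/
structure Inv (Pr : Params P Tx Hash Rnd) (s : PlanState P Tx Hash) (c : Config P Tx Hash) :
    Prop extends d.BaseInv Pr c where
  q_active : d.q ∈ c.active ↔ s.rel
  pub : ∀ j ∈ c.active \ d.A, j ≠ d.q → (c.loc j).chain = s.pub
  ext : ExtensionBy Pr (pending d.start d.A) d.base s.pub
  priv : d.PrivOK Pr c s.priv
  priv_slot : d.start.time < c.time → ∀ B ∈ s.priv, ∀ x ∈ B.proof, x.2 < c.time - 1
  early : c.time ≤ d.start.time → s.priv = upTo d.base d.fork ∧ ¬ s.rel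
  phase : s.pub.length < d.N → s.priv = upTo d.base d.fork
  net_blk : ∀ j ∈ c.active \ d.A, ∀ B, Msg.blk B ∈ d.netMsgs c j → Ends Pr c (fun D =>
    d.Clean D ∧ (D.length ≤ s.pub.length ∨
      (B ∈ c.signed ∧ ∃ i ∉ d.A, i ≠ d.q ∧ B.sig = some i))) B
  blocks : ∀ j ∈ c.active \ d.A, j ≠ d.q → ∀ B ∈ (c.loc j).blocks, Ends Pr c d.Clean B
  q_chain : d.q ∈ c.active → (c.loc d.q).chain = s.priv
  q_blocks : d.q ∈ c.active → ∀ B ∈ (c.loc d.q).blocks, Ends Pr c (fun D =>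
    (d.Clean D ∧ D.length ≤ s.pub.length) ∨ D <+: s.priv) B
  q_delivered : d.q ∈ c.active → ∀ tx ∈ (c.loc d.q).delivered, tx ∈ txsOf (upTo d.base d.fork)

/-- The state in which the adversary acts, after it has updated its variables. -/
structure Ready (Pr : Params P Tx Hash Rnd) (s : PlanState P Tx Hash) (c : Config P Tx Hash) :
    Prop extends d.BaseInv Pr c where
  q_active : d.q ∈ c.active → s.rel
  rel : s.rel → d.start.time < c.time
  pub : ∀ j ∈ c.active \ d.A, j ≠ d.q → (c.loc j).chain <+: s.pub
  pubValid : Pr.ValidChain c s.pub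
  no_next : ∀ B ∈ c.signed, ∀ i ∉ d.A, B.sig = some i → ¬ Pr.ValidChain c (s.pub ++ [B])
  ext : ExtensionBy Pr (pending d.start d.A) d.base s.pub
  priv : d.PrivOK Pr c s.priv
  phase : s.pub.length < d.N → s.priv = upTo d.base d.fork
  net_blk : ∀ j ∈ c.active \ d.A, ∀ B, Msg.blk B ∈ d.netMsgs c j → Ends Pr c (fun D =>
    d.Clean D ∧ D.length ≤ s.pub.length) B
  blocks : ∀ j ∈ c.active \ d.A, j ≠ d.q → ∀ B ∈ (c.loc j).blocks, Ends Pr c (fun D =>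
    d.Clean D ∧ D.length ≤ s.pub.length) B
  q_chain : d.q ∈ c.active → (c.loc d.q).chain <+: s.priv
  q_blocks : d.q ∈ c.active → ∀ B ∈ (c.loc d.q).blocks, Ends Pr c (fun D =>
    (d.Clean D ∧ D.length ≤ s.pub.length) ∨ D <+: s.priv) B
  q_delivered : d.q ∈ c.active → ∀ tx ∈ (c.loc d.q).delivered, tx ∈ txsOf (upTo d.base d.fork)

variable {d}

theorem Ends.mono {c c' : Config P Tx Hash} (hle : c.Le c') {Q Q' : Chain P Tx Hash → Prop}
    (hQ : ∀ D, Q D → Q' D) {B : Block P Tx Hash} (h : Ends Pr c Q B) : Ends Pr c' Q' B := by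
  obtain ⟨D, h₁, h₂, h₃⟩ := h
  exact ⟨D, h₁.mono hle, h₂, hQ D h₃⟩

theorem mem_netMsgs {c : Config P Tx Hash} {x : P} {m : Msg P Tx Hash} :
    m ∈ d.netMsgs c x ↔ ∃ i t, i ∉ d.A ∧ (i, t, m) ∈ c.net x := by
  simp only [netMsgs, List.mem_map, List.mem_filter, decide_eq_true_eq]
  constructor
  · rintro ⟨⟨i, t, m'⟩, ⟨h₁, h₂⟩, rfl⟩
    exact ⟨i, t, h₂, h₁⟩
  · rintro ⟨i, t, h₁, h₂⟩
    exact ⟨_, ⟨h₂, h₁⟩, rfl⟩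

theorem nextPub_cases (s : PlanState P Tx Hash) (c : Config P Tx Hash) :
    (d.nextPub Pr s c = s.pub ∧ ∀ B, ¬ d.PubNext Pr c s.pub B) ∨
      ∃ B, d.PubNext Pr c s.pub B ∧ d.nextPub Pr s c = s.pub ++ [B] := by
  unfold nextPub
  split_ifs with h
  · exact Or.inr ⟨_, h.choose_spec, rfl⟩
  · exact Or.inl ⟨rfl, not_exists.1 h⟩

theorem nextPriv_cases (s : PlanState P Tx Hash) (c : Config P Tx Hash) :
    (d.nextPriv Pr s c = s.priv ∧ ∀ p, ¬ d.PrivNext Pr c s p) ∨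
      ∃ p, d.PrivNext Pr c s p ∧
        d.nextPriv Pr s c = s.priv ++ [d.privBlock Pr s.priv (c.time - 1) p] := by
  unfold nextPriv
  split_ifs with h
  · exact Or.inr ⟨_, h.choose_spec, rfl⟩
  · exact Or.inl ⟨rfl, not_exists.1 h⟩

theorem prefix_nextPub (s : PlanState P Tx Hash) (c : Config P Tx Hash) :
    s.pub <+: d.nextPub Pr s c := by
  rcases nextPub_cases (Pr := Pr) (d := d) s c with ⟨h, -⟩ | ⟨B, -, h⟩ <;> rw [h]
  exact List.prefix_append _ _

theorem prefix_nextPriv (s : PlanState P Tx Hash) (c : Config P Tx Hash) :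
    s.priv <+: d.nextPriv Pr s c := by
  rcases nextPriv_cases (Pr := Pr) (d := d) s c with ⟨h, -⟩ | ⟨B, -, h⟩ <;> rw [h]
  exact List.prefix_append _ _

/-- Some process outside `A` has joined; it is not corrupted and has `base` as its local chain,
which therefore has been validated. -/
theorem OK.base_facts (hd : d.OK Pr) : Pr.ValidChain d.start d.base ∧
    ∀ B ∈ d.base, ∀ x ∈ B.proof, x.2 < d.start.time := by
  obtain ⟨j, hj⟩ := hd.nonempty
  rw [Finset.mem_sdiff] at hj
  have hj' : j ∈ d.start.active \ d.start.byz :=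
    Finset.mem_sdiff.2 ⟨hj.1, fun h => hj.2 (hd.byz h)⟩
  have h := (hd.reach.globOK.loc j hj').known.1
  rw [hd.chain j hj'] at h
  exact ⟨h, h.slot_lt hd.reach.globOK.slot⟩

/-- A prefix of a chain through `base` either still contains `base` or is a part of `base`, whose
slots are all old. -/
theorem OK.clean_prefix (hd : d.OK Pr) {D E : Chain P Tx Hash} (h : d.Clean D) (hE : E <+: D) :
    d.Clean E := by
  rcases h with h | h
  · exact Or.inl fun B hB => h B (hE.subset hB)
  · rcases List.prefix_or_prefix_of_prefix h hE with h' | h'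
    · exact Or.inr h'
    · exact Or.inl fun B hB => hd.base_facts.2 B (h'.subset hB)

theorem ExtensionBy.base_prefix {U : Set Tx} {C C' : Chain P Tx Hash}
    (h : ExtensionBy Pr U C C') : C <+: C' := by
  induction h with
  | refl => exact List.prefix_rfl
  | snoc C' B _ _ _ ih => exact ih.trans (List.prefix_append _ _)

theorem ExtensionBy.of_prefix {U : Set Tx} {C C' D : Chain P Tx Hash}
    (h : ExtensionBy Pr U C C') (hD : D <+: C') (hC : C <+: D) : ExtensionBy Pr U C D := by
  induction h with
  | refl =>
    rw [hC.eq_of_length (le_antisymm hC.length_le hD.length_le)] at *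
    exact .refl
  | snoc C' B h₁ h₂ h₃ ih =>
    rcases List.prefix_concat_iff.1 hD with rfl | h
    · exact .snoc C' B h₁ h₂ h₃
    · exact ih h

theorem length_upTo_fork (hd : d.OK Pr) : (upTo d.base d.fork).length = d.fork + 1 := by
  have := hd.fork_lt
  simp only [upTo, List.length_take]
  omega

theorem upTo_prefix (C : Chain P Tx Hash) (h : ℕ) : upTo C h <+: C := List.take_prefix _ _

theorem PrivOK.fork_prefix {c : Config P Tx Hash} {C : Chain P Tx Hash} (h : d.PrivOK Pr c C) :
    upTo d.base d.fork <+: C := by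
  rcases h.shape with h | ⟨B, E, h, -⟩ <;> rw [h]
  exact List.prefix_append _ _

theorem PrivOK.mono {c c' : Config P Tx Hash} (hle : c.Le c') {C : Chain P Tx Hash}
    (h : d.PrivOK Pr c C) : d.PrivOK Pr c' C :=
  ⟨h.valid.mono hle, h.shape, h.tail⟩

/-- Clean prefixes of the private chain do not contain private blocks. -/
theorem PrivOK.length_le_of_clean (hd : d.OK Pr) {c : Config P Tx Hash} {C D : Chain P Tx Hash}
    (h : d.PrivOK Pr c C) (hD : D <+: C) (hc : d.Clean D) : D.length ≤ d.fork + 1 := by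
  by_contra hlt
  push Not at hlt
  have hlen := hlt.trans_le hD.length_le
  have hCD : D[d.fork + 1] = C[d.fork + 1] := hD.getElem hlt
  obtain ⟨p, -, sl, -, hp, hsl⟩ := h.tail (C[d.fork + 1]) (by
    rw [List.mem_drop_iff_getElem]
    exact ⟨0, by simpa using hlen, by simp⟩)
  -- The block right after the fork decides: in a clean chain its slot precedes the attack, while a
  -- private block has a slot from the attack.
  have hold : ∀ x ∈ (C[d.fork + 1]).proof, x.2 < d.start.time := by
    rcases hc with hc | hc
    · rw [← hCD]
      exact hc _ (List.getElem_mem _)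
    · have : d.base[d.fork + 1]'hd.fork_lt = C[d.fork + 1] := (hc.trans hD).getElem hd.fork_lt
      rw [← this]
      exact hd.base_facts.2 _ (List.getElem_mem _)
  exact absurd (hold (p, sl) (by rw [hp]; rfl)) (not_lt.2 hsl)

/-- The adversary can sign for `p ∈ A`. The block is made from an assignment of the previous slot,
and the private chain was already valid when that slot began, so slots increase. The body is `l`
exactly when the chain still ends at the fork. -/
theorem Inv.nextPriv_ok (hd : d.OK Pr) {s : PlanState P Tx Hash} {c : Config P Tx Hash}
    (h : d.Inv Pr s c) :
    d.PrivOK Pr c (d.nextPriv Pr s c) := by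
  have hlen := length_upTo_fork hd
  rcases nextPriv_cases (Pr := Pr) (d := d) s c with ⟨h', -⟩ | ⟨p, hp, h'⟩ <;> rw [h']
  · exact h.priv
  obtain ⟨-, ht, hpA, hass⟩ := hp
  have hne := h.priv.valid.ne_nil
  have hshape := h.priv.shape
  refine ⟨?_, ?_, ?_⟩
  · refine .snoc _ _ h.priv.valid ?_ ?_ ?_ ?_
    · refine ⟨s.priv.getLast hne, List.getLast?_eq_some_getLast hne, ?_⟩
      simp [privBlock, Params.mined, List.getLast?_eq_some_getLast hne]
    · change Pr.validTx s.priv (d.privTxs s.priv)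
      unfold privTxs
      split_ifs with hl
      · rcases hshape with hs | ⟨B, E, hs, -⟩
        · rw [hs]; exact hd.valid
        · rw [hs] at hl
          simp only [List.length_append, List.length_cons] at hl
          omega
      · exact Pr.validTx_nil _
    · exact ⟨p, c.time - 1, rfl, rfl, Or.inl (h.byz_eq ht ▸ hpA)⟩
    · refine ⟨p, c.time - 1, rfl, hass, fun A hA x hx => ?_⟩
      exact h.priv_slot ht A (List.mem_of_getLast? hA) x hx
  · right
    rcases hshape with hs | ⟨B, E, hs, hB, hE⟩
    · exact ⟨d.privBlock Pr s.priv (c.time - 1) p, [], by rw [← hs],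
        if_pos (by rw [hs, hlen]), by simp⟩
    · refine ⟨B, E ++ [d.privBlock Pr s.priv (c.time - 1) p], by rw [hs]; simp, hB, ?_⟩
      intro B' hB'
      rcases List.mem_append.1 hB' with h | h
      · exact hE B' h
      · rw [List.mem_singleton] at h
        rw [h]
        refine if_neg ?_
        rw [hs]
        simp only [List.length_append, List.length_cons]
        omega
  · intro B hB
    have hl := h.priv.fork_prefix.length_le
    rw [List.drop_append_of_le_length (by omega)] at hB
    rcases List.mem_append.1 hB with h' | h'
    · exact h.priv.tail B h'
    · rw [List.mem_singleton] at h'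
      rw [h']
      exact ⟨p, hpA, c.time - 1, rfl, rfl, by omega⟩

/-- A block extending the public chain that was signed by a process outside `A`. -/
theorem Inv.signed_spec {s : PlanState P Tx Hash} {c : Config P Tx Hash}
    (h : d.Inv Pr s c) {B : Block P Tx Hash} (hB : B ∈ c.signed) {i : P} (hi : i ∉ d.A)
    (hs : B.sig = some i) : ∃ D, Pr.ValidChain c (D ++ [B]) ∧ D ≠ [] ∧
      D.length ≤ s.pub.length ∧ (D.length = s.pub.length → D = s.pub ∧
        ∀ tx ∈ B.txs, tx ∈ pending d.start d.A) := by
  obtain ⟨h₁, h₂⟩ := h.reach.globOK.signed B hB i hs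
  obtain ⟨D, h₃, h₄, h₅, h₆⟩ := h₂ fun hb => hi (h.byz hb)
  have hq : i ≠ d.q := by
    rintro rfl
    exact h.signed B hB hs
  have hj := Finset.mem_sdiff.2 ⟨h₁, hi⟩
  rw [h.pub i hj hq] at h₅ h₆
  refine ⟨D, h₃, h₄, h₅, fun hl => ?_⟩
  obtain ⟨h₇, h₈⟩ := h₆ hl
  exact ⟨h₇, fun tx htx => h.unord i hj hq (h₈ tx htx)⟩

theorem Inv.pubValid (hd : d.OK Pr) {s : PlanState P Tx Hash} {c : Config P Tx Hash}
    (h : d.Inv Pr s c) : Pr.ValidChain c s.pub := by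
  obtain ⟨j, hj⟩ := hd.nonempty
  rw [Finset.mem_sdiff] at hj
  have hq : j ≠ d.q := by
    rintro rfl
    exact hd.q_notMem hj.1
  rw [← h.pub j (Finset.mem_sdiff.2 ⟨h.mono hj.1, hj.2⟩) hq]
  exact (h.reach.globOK.loc j
    (Finset.mem_sdiff.2 ⟨h.mono hj.1, fun hb => hj.2 (h.byz hb)⟩)).known.1

/-- In one step the uninformed processes can get ahead of the public chain only by blocks placed
directly on top of it. If there are such blocks, the update adopts one, and its competitors are then
no longer than the new public chain. -/
theorem Inv.ready (hd : d.OK Pr) {s : PlanState P Tx Hash} {c : Config P Tx Hash}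
    (h : d.Inv Pr s c) : d.Ready Pr (d.update Pr s c) c := by
  have hpre : s.pub <+: (d.update Pr s c).pub := prefix_nextPub s c
  have hpre' : s.priv <+: (d.update Pr s c).priv := prefix_nextPriv s c
  have hval := h.pubValid hd
  have hg := h.reach.globOK
  have hlenf := length_upTo_fork hd
  have hbase : d.base.length ≤ s.pub.length := (ExtensionBy.base_prefix h.ext).length_le
  refine { h.toBaseInv with
    q_active := fun hq => Or.inl (h.q_active.1 hq)
    rel := ?_
    pub := fun j hj hq => by rw [h.pub j hj hq]; exact hpre
    pubValid := ?_
    no_next := ?_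
    ext := ?_
    priv := h.nextPriv_ok hd
    phase := ?_
    net_blk := ?_
    blocks := ?_
    q_chain := fun hq => by rw [h.q_chain hq]; exact hpre'
    q_blocks := ?_
    q_delivered := h.q_delivered }
  · intro hr
    by_contra hlt
    obtain ⟨h₁, h₂⟩ := h.early (not_lt.1 hlt)
    rcases hr with hr | ⟨-, -, hr⟩
    · exact h₂ hr
    · rcases nextPriv_cases (Pr := Pr) (d := d) s c with ⟨h', -⟩ | ⟨p, hp, -⟩
      · have hf := hd.fork_lt
        have := (prefix_nextPub (Pr := Pr) (d := d) s c).length_le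
        rw [h', h₁, hlenf] at hr
        omega
      · exact hlt hp.2.1
  · rcases nextPub_cases (Pr := Pr) (d := d) s c with ⟨h', -⟩ | ⟨B, hB, h'⟩
    · exact Eq.mpr (congrArg (Pr.ValidChain c) h') hval
    · exact Eq.mpr (congrArg (Pr.ValidChain c) h') hB.1
  · intro B hB i hi hs hv
    change Pr.ValidChain c (d.nextPub Pr s c ++ [B]) at hv
    rcases nextPub_cases (Pr := Pr) (d := d) s c with ⟨h', hn⟩ | ⟨B', -, h'⟩
    · rw [h'] at hv
      exact hn B ⟨hv, Or.inl ⟨hB, i, hi, hs⟩⟩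
    -- After the public chain has grown, a signed block on top of it would have a parent chain
    -- longer than the local chain of its signer.
    · obtain ⟨D, h₁, -, h₂, -⟩ := h.signed_spec hB hi hs
      have := h₁.unique hv (by simp)
      rw [List.append_cancel_right this, h'] at h₂
      simp at h₂
  · rcases nextPub_cases (Pr := Pr) (d := d) s c with ⟨h', -⟩ | ⟨B, hB, h'⟩
    · exact Eq.mpr (congrArg (ExtensionBy Pr _ _) h') h.ext
    · change ExtensionBy Pr _ _ (d.nextPub Pr s c)
      rw [h']
      refine .snoc _ _ h.ext (hB.1.snoc_inv hval.ne_nil).2.2.1 ?_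
      rcases hB.2 with ⟨hs, i, hi, hsig⟩ | ⟨-, ht⟩
      · obtain ⟨D, h₁, -, -, h₂⟩ := h.signed_spec hs hi hsig
        have := h₁.unique hB.1 (by simp)
        exact (h₂ (by rw [List.append_cancel_right this])).2
      · simp [ht]
  · intro hlt
    have := hpre.length_le
    have h₁ : s.pub.length < d.N := this.trans_lt hlt
    rcases nextPriv_cases (Pr := Pr) (d := d) s c with ⟨h', -⟩ | ⟨p, hp, -⟩
    · exact h'.trans (h.phase h₁)
    · exact absurd hp.1 (not_le.2 h₁)
  · intro j hj B hB
    obtain ⟨D, h₁, h₂, h₃, h₄⟩ := h.net_blk j hj B hB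
    refine ⟨D, h₁, h₂, h₃, ?_⟩
    rcases h₄ with h₄ | ⟨hs, i, hi, -, hsig⟩
    · exact h₄.trans hpre.length_le
    · obtain ⟨E, h₅, h₆, h₇, h₈⟩ := h.signed_spec hs hi hsig
      obtain rfl := h₁.unique h₅ (by rw [h₂]; simp)
      rw [List.length_append, List.length_singleton]
      rcases h₇.lt_or_eq with h₉ | h₉
      · exact Nat.succ_le_of_lt (h₉.trans_le hpre.length_le)
      -- A block exactly one higher than the old public chain is itself a candidate for the update,
      -- so the public chain must have grown.
      · obtain ⟨rfl, -⟩ := h₈ h₉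
        change _ ≤ (d.nextPub Pr s c).length
        rcases nextPub_cases (Pr := Pr) (d := d) s c with ⟨-, h'⟩ | ⟨B', -, h'⟩
        · exact absurd ⟨h₅, Or.inl ⟨hs, i, hi, hsig⟩⟩ (h' B)
        · rw [h']
          simp
  · intro j hj hq B hB
    obtain ⟨D, h₁, h₂, h₃⟩ := h.blocks j hj hq B hB
    -- The invariant supplies cleanness only; the length bound holds because a correct process knows
    -- no chain longer than its local one.
    have hj' : j ∈ c.active \ c.byz := Finset.mem_sdiff.2
      ⟨(Finset.mem_sdiff.1 hj).1, fun hb => (Finset.mem_sdiff.1 hj).2 (h.byz hb)⟩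
    obtain ⟨E, h₄, h₅, h₆⟩ := (hg.loc j hj').blocks B hB
    rw [h.pub j hj hq] at h₆
    obtain rfl := h₁.unique h₄.1 (h₂.trans h₅.symm)
    exact ⟨D, h₁, h₂, h₃, h₆.trans hpre.length_le⟩
  · intro hq B hB
    refine (h.q_blocks hq B hB).mono (.refl c) fun D hD => ?_
    exact hD.imp (fun h => ⟨h.1, h.2.trans hpre.length_le⟩) fun h => h.trans hpre'

end Plan

end Strategy

/-! ### One step of the attack preserves the invariant. -/

noncomputable section Invariant

set_option linter.unusedSectionVars false

variable {P Tx Hash Rnd : Type*} [DecidableEq P] [MeasurableSpace Rnd]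
  {Pr : Params P Tx Hash Rnd}

namespace Plan

variable {d : Plan P Tx Hash} {s : PlanState P Tx Hash} {c : Config P Tx Hash}

open Params

/-- The chains that may be gossiped while the private chain is kept apart. -/
def Public (d : Plan P Tx Hash) (s : PlanState P Tx Hash) (D : Chain P Tx Hash) : Prop :=
  d.Clean D ∧ D.length ≤ s.pub.length

theorem Ready.base_prefix (h : d.Ready Pr s c) : d.base <+: s.pub :=
  ExtensionBy.base_prefix h.ext

theorem OK.public_prefix (hd : d.OK Pr) (D E : Chain P Tx Hash) (hD : d.Public s D)
    (hE : E <+: D) (_ : E ≠ []) : d.Public s E :=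
  ⟨hd.clean_prefix hD.1 hE, hE.length_le.trans hD.2⟩

theorem Ready.public_pub (h : d.Ready Pr s c) : d.Public s s.pub :=
  ⟨Or.inr h.base_prefix, le_rfl⟩

theorem ends_of_mem {Q : Chain P Tx Hash → Prop} {D : Chain P Tx Hash}
    (hQ : ∀ E, E <+: D → E ≠ [] → Q E) (hD : Pr.ValidChain c D) {B : Block P Tx Hash}
    (hB : B ∈ D) : Ends Pr c Q B := by
  obtain ⟨E, hE, hl⟩ := List.exists_prefix_getLast?_of_mem hB
  have hne : E ≠ [] := by rintro rfl; simp at hl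
  exact ⟨E, hD.of_prefix hE hne, hl, hQ E hE hne⟩

theorem mid_byz (h : d.BaseInv Pr c) : (Pr.mid (d.action Pr s c) c).byz = d.A :=
  Finset.union_eq_right.2 h.byz

theorem mem_mid_active (j : P) : j ∈ (Pr.mid (d.action Pr s c) c).active ↔
    j ∈ c.active ∨ (s.rel ∧ j = d.q) := by
  classical
  change j ∈ c.active ∪ (action d Pr s c).join ↔ _
  unfold action
  dsimp only
  split_ifs with h <;> simp [h, or_comm]

theorem mem_correct (h : d.BaseInv Pr c) (j : P) :
    j ∈ (Pr.mid (d.action Pr s c) c).active \ (Pr.mid (d.action Pr s c) c).byz ↔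
      (j ∈ c.active ∨ (s.rel ∧ j = d.q)) ∧ j ∉ d.A := by
  rw [Finset.mem_sdiff, mid_byz h, mem_mid_active]

theorem mem_active_of_ne (h : d.BaseInv Pr c) {j : P} (hq : j ≠ d.q)
    (hj : j ∈ (Pr.mid (d.action Pr s c) c).active \ (Pr.mid (d.action Pr s c) c).byz) :
    j ∈ c.active \ d.A := by
  rw [mem_correct h] at hj
  rcases hj with ⟨h' | h', hA⟩
  · exact Finset.mem_sdiff.2 ⟨h', hA⟩
  · exact absurd h'.2 hq

theorem result_eq (h : d.BaseInv Pr c) (j : P) :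
    Pr.result (d.action Pr s c) c j = Pr.handleAll (Pr.mid (d.action Pr s c) c)
      (d.privMsgs s j ++ (s.pub.tail.map Msg.blk ++ d.netMsgs c j))
      (Pr.wake [] (c.loc j), []) := by
  have : Pr.result (d.action Pr s c) c j = Pr.handleAll (Pr.mid (d.action Pr s c) c)
      (d.privMsgs s j ++ (s.pub.tail.map Msg.blk ++ d.netMsgs c j))
      (Pr.wake [] ((Pr.mid (d.action Pr s c) c).loc j), []) := rfl
  rw [this, h.reach.globOK.mid_loc]

theorem privMsgs_eq_nil {j : P} (h : ¬ (s.rel ∧ j ∈ insert d.q d.S)) : d.privMsgs s j = [] :=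
  if_neg h

theorem privMsgs_eq {j : P} (h : s.rel ∧ j ∈ insert d.q d.S) :
    d.privMsgs s j = s.priv.tail.map Msg.blk :=
  if_pos h

theorem wake_locOK (h : d.BaseInv Pr c) {j : P}
    (hj : j ∈ (Pr.mid (d.action Pr s c) c).active \ (Pr.mid (d.action Pr s c) c).byz) :
    Pr.LocOK (Pr.mid (d.action Pr s c) c) (Pr.wake [] (c.loc j)) := by
  rw [← h.reach.globOK.mid_loc (a := d.action Pr s c)]
  exact (wake_spec (h.reach.globOK.mid_locOK hj) []).1

/-- The activation of a process that knows only the public chain. -/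
theorem Ready.result_honest (hd : d.OK Pr) (h : d.Ready Pr s c) {j : P}
    (hj : j ∈ c.active \ d.A) (hq : j ≠ d.q) (hS : ¬ (s.rel ∧ j ∈ insert d.q d.S)) :
    Unaffected (Pr := Pr) (Pr.mid (d.action Pr s c) c) (d.Public s) (fun _ => False)
      (pending d.start d.A) (Pr.result (d.action Pr s c) c j) (Pr.result (d.action Pr s c) c j) ∧
    (Pr.result (d.action Pr s c) c j).1.chain = s.pub ∧
    (∀ B ∈ s.pub, B ∈ (Pr.result (d.action Pr s c) c j).1.blocks) ∧
    (Pr.result (d.action Pr s c) c j).1.unordered ⊆ pending d.start d.A := by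
  have hj' := (mem_correct (s := s) h.toBaseInv j).2
    ⟨Or.inl (Finset.mem_sdiff.1 hj).1, (Finset.mem_sdiff.1 hj).2⟩
  rw [result_eq h.toBaseInv, privMsgs_eq_nil hS, List.nil_append, handleAll_append]
  set m := Pr.mid (d.action Pr s c) c with hm
  have hle : c.Le m := mid_le _ _
  have hpub := h.pubValid.mono hle
  have hr := handleAll_chain (x := (Pr.wake [] (c.loc j), []))
    (wake_locOK h.toBaseInv hj') hpub
  have hch := hr.chain_eq (by
    change (Pr.wake [] (c.loc j)).chain <+: _
    rw [wake_chain]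
    exact h.pub j hj hq)
  set y := Pr.handleAll m (s.pub.tail.map Msg.blk) (Pr.wake [] (c.loc j), []) with hy
  have hyU : Unaffected (Pr := Pr) m (d.Public s) (fun _ => False) (pending d.start d.A) y y := by
    have ho : y.2 = [] := hr.out
    refine ⟨rfl, rfl, Set.subset_union_left, subset_rfl, ?_, ?_, ?_, ?_⟩
    · intro B hB
      rcases hr.blocks_subset B hB with hB | hB
      · rw [wake_blocks] at hB
        exact (h.blocks j hj hq B hB).mono hle fun D hD => Or.inl hD
      · exact ends_of_mem (fun E hE hne => Or.inl (hd.public_prefix _ _ h.public_pub hE hne))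
          hpub hB
    all_goals simp [ho]
  have hU := handleAll_unaffected hd.public_prefix (fun D hD => hD.2) (d.netMsgs c j) y hyU
    (by rw [hch]) (h.net_op j hj) (fun B hB => (h.net_blk j hj B hB).mono hle fun D hD => hD)
    (fun B _ D _ _ hF => hF.elim)
  refine ⟨⟨rfl, rfl, Set.subset_union_left, subset_rfl, hU.blocks, hU.out_blk, hU.out_request,
    hU.out_op⟩, hU.chain.trans hch, fun B hB => hU.blocks_mono (hr.blocks B hB), ?_⟩
  refine hU.unordered.trans (Set.union_subset (hr.unordered.trans ?_) subset_rfl)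
  exact (wake_unordered_subset [] (c.loc j)).trans (h.unord j hj hq)

theorem PrivOK.txs_subset {C : Chain P Tx Hash} (h : d.PrivOK Pr c C) (hl : d.l = []) :
    ∀ tx ∈ txsOf C, tx ∈ txsOf (upTo d.base d.fork) := by
  intro tx htx
  rcases h.shape with hs | ⟨B, E, hs, hB, hE⟩
  · rwa [hs] at htx
  · rw [hs, txsOf_append] at htx
    rcases List.mem_append.1 htx with h' | h'
    · exact h'
    · obtain ⟨B', hB', ht⟩ := List.mem_flatMap.1 h'
      rcases List.mem_cons.1 hB' with rfl | hB'
      · rw [hB, hl] at ht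
        simp at ht
      · rw [hE B' hB'] at ht
        simp at ht

theorem genesis_prefix_fork (hd : d.OK Pr) : [Pr.genesis] <+: upTo d.base d.fork :=
  List.prefix_of_prefix_length_le hd.base_facts.1.genesis_prefix (upTo_prefix _ _)
    (by rw [length_upTo_fork hd]; simp)

/-- The local state of the isolated process before the time step. -/
theorem Ready.loc_q (hd : d.OK Pr) (h : d.Ready Pr s c) : (c.loc d.q).chain <+: s.priv ∧
    (∀ B ∈ (c.loc d.q).blocks, Ends Pr c (fun D => d.Public s D ∨ D <+: s.priv) B) ∧
    ∀ tx ∈ (c.loc d.q).delivered, tx ∈ txsOf (upTo d.base d.fork) := by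
  by_cases hq : d.q ∈ c.active
  · exact ⟨h.q_chain hq, h.q_blocks hq, h.q_delivered hq⟩
  -- Before it joins, `q` has the initial state, whose only block is the genesis block, a common
  -- prefix of both chains.
  · rw [h.reach.globOK.inactive_loc _ hq]
    have hg := genesis_prefix_fork hd
    refine ⟨hg.trans h.priv.fork_prefix, ?_, ?_⟩
    · intro B hB
      refine ⟨[Pr.genesis], .genesis, ?_, Or.inr (hg.trans h.priv.fork_prefix)⟩
      have : B = Pr.genesis := hB
      rw [this]
      rfl
    · intro tx htx
      rcases (mem_extend_delivered _ _).1 htx with h' | h'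
      · simp at h'
      · exact txsOf_subset_of_prefix ((dropLastK_prefix _ _).trans hg) h'

/-- The activation of the process that knows the private chain. -/
theorem Ready.result_q (hd : d.OK Pr) (h : d.Ready Pr s c) (hqA : d.q ∉ d.A) (hrel : s.rel)
    (hlen : s.pub.length ≤ s.priv.length) :
    Unaffected (Pr := Pr) (Pr.mid (d.action Pr s c) c) (d.Public s) (fun D => D <+: s.priv)
      (pending d.start d.A) (Pr.result (d.action Pr s c) c d.q)
      (Pr.result (d.action Pr s c) c d.q) ∧
    (Pr.result (d.action Pr s c) c d.q).1.chain = s.priv ∧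
    (d.l = [] → ∀ tx ∈ (Pr.result (d.action Pr s c) c d.q).1.delivered,
      tx ∈ txsOf (upTo d.base d.fork)) := by
  have hj' := (mem_correct (s := s) h.toBaseInv d.q).2 ⟨Or.inr ⟨hrel, rfl⟩, hqA⟩
  obtain ⟨hq₁, hq₂, hq₃⟩ := h.loc_q hd
  rw [result_eq h.toBaseInv, privMsgs_eq ⟨hrel, Finset.mem_insert_self _ _⟩, handleAll_append]
  set m := Pr.mid (d.action Pr s c) c with hm
  have hle : c.Le m := mid_le _ _
  have hpub := h.pubValid.mono hle
  have hpriv := h.priv.valid.mono hle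
  have hr := handleAll_chain (x := (Pr.wake [] (c.loc d.q), []))
    (wake_locOK h.toBaseInv hj') hpriv
  have hch := hr.chain_eq (by
    change (Pr.wake [] (c.loc d.q)).chain <+: _
    rw [wake_chain]
    exact hq₁)
  set y := Pr.handleAll m (s.priv.tail.map Msg.blk) (Pr.wake [] (c.loc d.q), []) with hy
  have hyU : Unaffected (Pr := Pr) m (d.Public s) (fun D => D <+: s.priv) (pending d.start d.A)
      y y := by
    have ho : y.2 = [] := hr.out
    refine ⟨rfl, rfl, Set.subset_union_left, subset_rfl, ?_, ?_, ?_, ?_⟩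
    · intro B hB
      rcases hr.blocks_subset B hB with hB | hB
      · rw [wake_blocks] at hB
        exact (hq₂ B hB).mono hle fun D hD => hD
      · exact ends_of_mem (fun E hE hne => Or.inr hE) hpriv hB
    all_goals simp [ho]
  have hmem : ∀ {M : Msg P Tx Hash}, M ∈ s.pub.tail.map Msg.blk ++ d.netMsgs c d.q →
      (∃ B ∈ s.pub, M = .blk B) ∨ (d.q ∈ c.active ∧ M ∈ d.netMsgs c d.q) := by
    intro M hM
    rcases List.mem_append.1 hM with hM | hM
    · obtain ⟨B, hB, rfl⟩ := List.mem_map.1 hM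
      exact Or.inl ⟨B, List.mem_of_mem_tail hB, rfl⟩
    · refine Or.inr ⟨?_, hM⟩
      by_contra hq
      obtain ⟨i, t, -, hi⟩ := mem_netMsgs.1 hM
      rw [h.reach.globOK.inactive_net _ hq] at hi
      simp at hi
  have hU := handleAll_unaffected hd.public_prefix (fun D hD => hD.2)
    (s.pub.tail.map Msg.blk ++ d.netMsgs c d.q) y hyU (by rw [hch]; exact hlen)
    (by
      intro tx htx
      rcases hmem htx with ⟨B, -, hB⟩ | ⟨hq, htx⟩
      · cases hB
      · exact h.net_op d.q (Finset.mem_sdiff.2 ⟨hq, hqA⟩) tx htx)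
    (by
      intro B hB
      rcases hmem hB with ⟨B', hB', h'⟩ | ⟨hq, hB⟩
      · cases h'
        exact ends_of_mem (fun E hE hne => hd.public_prefix _ _ h.public_pub hE hne) hpub hB'
      · exact (h.net_blk d.q (Finset.mem_sdiff.2 ⟨hq, hqA⟩) B hB).mono hle fun D hD => hD)
    (by
      intro B hB D hD hl hDX
      rcases hmem hB with ⟨B', -, h'⟩ | ⟨hq, hB⟩
      · cases h'
      · obtain ⟨E, hE, hl', hcl⟩ := h.net_request (h.rel hrel) d.q
          (Finset.mem_sdiff.2 ⟨hq, hqA⟩) B hB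
        obtain rfl := hD.unique hE (hl.trans hl'.symm)
        -- Requests in transit concern clean chains. A prefix of the private chain that is clean
        -- ends no later than the fork, so the reply contains no private block.
        have h₁ := h.priv.length_le_of_clean hd hDX hcl
        have h₂ := h.base_prefix.length_le
        have h₃ := hd.fork_lt
        exact ⟨hcl, by omega⟩)
  refine ⟨⟨rfl, rfl, Set.subset_union_left, subset_rfl, hU.blocks, hU.out_blk, hU.out_request,
    hU.out_op⟩, hU.chain.trans hch, fun hl tx htx => ?_⟩
  rw [hU.delivered] at htx
  rcases hr.delivered tx htx with h' | h'
  · rcases mem_wake_delivered h' with h' | h'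
    · exact hq₃ tx h'
    · exact h.priv.txs_subset hl tx (txsOf_subset_of_prefix hq₁ h')
  · exact h.priv.txs_subset hl tx h'

/-- One time step preserves the invariant, until the private chain is revealed to processes that
take part in the public chain or lose its lead. -/
theorem Ready.step (hd : d.OK Pr) (h : d.Ready Pr s c) (ω : Key P Tx Hash → Rnd)
    (hleg : Pr.Legal c (d.action Pr s c))
    (hrel : s.rel → d.S = ∅ ∧ d.l = [] ∧ s.pub.length ≤ s.priv.length ∧
      ∀ st, ¬ Pr.Wins ω (d.action Pr s c) c d.q st) :
    d.Inv Pr s (Pr.step ω (d.action Pr s c) c) := by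
  have hqA : d.q ∉ d.A := fun hq => hd.q_notMem (hd.active hq)
  set a := d.action Pr s c with ha
  have hle₁ : (Pr.mid a c).Le (Pr.step ω a c) := mid_le_step ω a c
  have hle : c.Le (Pr.step ω a c) := le_step ω a c
  have hg := h.reach.globOK
  have hcorr : ∀ {j}, j ∈ (Pr.step ω a c).active \ d.A →
      j ∈ (Pr.mid a c).active \ (Pr.mid a c).byz := by
    intro j hj
    rw [mid_byz h.toBaseInv]
    exact hj
  have hS : ∀ {j}, j ≠ d.q → ¬ (s.rel ∧ j ∈ insert d.q d.S) := by
    rintro j hj ⟨hr, hm⟩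
    rw [(hrel hr).1] at hm
    simp [hj] at hm
  have hqrel : d.q ∈ (Pr.mid a c).active → s.rel := by
    intro hq
    rcases (mem_mid_active _).1 hq with hq | hq
    · exact h.q_active hq
    · exact hq.1
  have hwq : ∀ {j st}, j ∈ (Pr.mid a c).active \ (Pr.mid a c).byz → Pr.Wins ω a c j st →
      j ≠ d.q := by
    rintro j st hj hw rfl
    exact (hrel (hqrel (Finset.mem_sdiff.1 hj).1)).2.2.2 st hw
  have hout : ∀ {j}, j ∈ (Pr.mid a c).active \ (Pr.mid a c).byz →
      (∀ B, Msg.blk B ∈ (Pr.result a c j).2 → Ends Pr (Pr.mid a c) (d.Public s) B) ∧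
      (∀ B, Msg.request B ∈ (Pr.result a c j).2 → Ends Pr (Pr.mid a c) (d.Public s) B) ∧
      ∀ tx, Msg.op tx ∉ (Pr.result a c j).2 := by
    intro j hj
    by_cases hq : j = d.q
    · subst hq
      have hr := hqrel (Finset.mem_sdiff.1 hj).1
      have := (h.result_q hd hqA hr (hrel hr).2.2.1).1
      exact ⟨this.out_blk, this.out_request, this.out_op⟩
    · have := (h.result_honest hd (mem_active_of_ne h.toBaseInv hq hj) hq (hS hq)).1
      exact ⟨this.out_blk, this.out_request, this.out_op⟩
  -- Everything that was in transit from outside `A` is delivered in this step, so what is in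
  -- transit afterwards was gossiped in this very step.
  have hnet : ∀ {j M}, j ∈ (Pr.step ω a c).active \ d.A →
      M ∈ d.netMsgs (Pr.step ω a c) j → ∃ i, i ∈ (Pr.mid a c).active \ (Pr.mid a c).byz ∧
        (M ∈ (Pr.result a c i).2 ∨
          ∃ st, Pr.Wins ω a c i st ∧ M = .blk (mined c.time i st.2)) := by
    intro j M hj hM
    obtain ⟨i, t, hi, hx⟩ := mem_netMsgs.1 hM
    rcases mem_step_net hx with ⟨hx, hn⟩ | ⟨hp, -, hx⟩
    · refine absurd ?_ hn
      change M ∈ d.privMsgs s j ++ (s.pub.tail.map Msg.blk ++ d.netMsgs c j)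
      simp only [List.mem_append]
      exact Or.inr (Or.inr (mem_netMsgs.2 ⟨i, t, hi, hx⟩))
    · exact ⟨i, hp, hx⟩
  have hhon : ∀ {j}, j ∈ (Pr.step ω a c).active \ d.A → j ≠ d.q → ∃ r,
      (Pr.step ω a c).loc j = { (Pr.result a c j).1 with com := none, retry := r } ∧
      j ∈ c.active \ d.A := by
    intro j hj hq
    obtain ⟨r, hr⟩ := step_loc_of_correct (ω := ω) (hcorr hj)
    exact ⟨r, hr, mem_active_of_ne h.toBaseInv hq (hcorr hj)⟩
  have hwin : ∀ {j st}, j ∈ (Pr.mid a c).active \ (Pr.mid a c).byz → Pr.Wins ω a c j st →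
      Pr.ValidChain (Pr.step ω a c) (s.pub ++ [mined c.time j st.2]) := by
    intro j st hj hw
    have hq := hwq hj hw
    obtain ⟨h₁, h₂, -⟩ := hg.wins_spec hj hw
    rw [(h.result_honest hd (mem_active_of_ne h.toBaseInv hq hj) hq (hS hq)).2.1] at h₁
    rw [← h₁]
    exact h₂
  have hqact : d.q ∈ (Pr.step ω a c).active → s.rel := hqrel
  refine {
    reach := .step ω a c h.reach hleg
    time := h.time.trans (Nat.le_succ _)
    mono := h.mono.trans Finset.subset_union_left
    byz := (mid_byz h.toBaseInv).subset
    byz_eq := fun _ => mid_byz h.toBaseInv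
    active := ?_
    unord := ?_
    net_op := ?_
    net_request := ?_
    signed := ?_
    q_active := ⟨hqrel, fun hr => (mem_mid_active _).2 (Or.inr ⟨hr, rfl⟩)⟩
    pub := ?_
    ext := h.ext
    priv := h.priv.mono hle
    priv_slot := fun _ => h.priv.valid.slot_lt hg.slot
    early := fun ht => absurd h.time (by rw [step_time] at ht; omega)
    phase := h.phase
    net_blk := ?_
    blocks := ?_
    q_chain := ?_
    q_blocks := ?_
    q_delivered := ?_ }
  · intro j hj
    rcases (mem_mid_active j).1 hj with hj | hj
    · exact h.active j hj
    · exact Or.inl hj.2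
  · intro j hj hq
    obtain ⟨r, hr, hj'⟩ := hhon hj hq
    rw [hr]
    exact (h.result_honest hd hj' hq (hS hq)).2.2.2
  · intro j hj tx htx
    obtain ⟨i, hi, hM | ⟨st, -, hM⟩⟩ := hnet hj htx
    · exact absurd hM ((hout hi).2.2 tx)
    · cases hM
  · intro _ j hj B hB
    obtain ⟨i, hi, hM | ⟨st, -, hM⟩⟩ := hnet hj hB
    · exact ((hout hi).2.1 B hM).mono hle₁ fun D hD => hD.1
    · cases hM
  · intro B hB hs
    rcases (mem_step_signed B).1 hB with hB | ⟨p, st, hp, hw, rfl⟩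
    · exact h.signed B hB hs
    · exact hwq hp hw (by simpa [mined] using hs)
  · intro j hj hq
    obtain ⟨r, hr, hj'⟩ := hhon hj hq
    rw [hr]
    exact (h.result_honest hd hj' hq (hS hq)).2.1
  · intro j hj B hB
    obtain ⟨i, hi, hM | ⟨st, hw, hM⟩⟩ := hnet hj hB
    · exact ((hout hi).1 B hM).mono hle₁ fun D hD => ⟨hD.1, Or.inl hD.2⟩
    · cases hM
      refine ⟨_, hwin hi hw, by simp, Or.inr (h.base_prefix.trans (List.prefix_append _ _)),
        Or.inr ⟨(mem_step_signed _).2 (Or.inr ⟨i, st, hi, hw, rfl⟩), i, ?_, hwq hi hw, rfl⟩⟩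
      exact ((mem_correct h.toBaseInv i).1 hi).2
  · intro j hj hq B hB
    obtain ⟨r, hr, hj'⟩ := hhon hj hq
    rw [hr] at hB
    refine Ends.mono hle₁ (fun D hD => ?_) ((h.result_honest hd hj' hq (hS hq)).1.blocks B hB)
    exact hD.elim (fun h => h.1) False.elim
  all_goals
    intro hq
    have hr := hqact hq
    have hres := h.result_q hd hqA hr (hrel hr).2.2.1
    obtain ⟨r, hr'⟩ := step_loc_of_correct (ω := ω) (hcorr (Finset.mem_sdiff.2 ⟨hq, hqA⟩))
    rw [hr']
  · exact hres.2.1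
  · intro B hB
    exact Ends.mono hle₁ (fun D hD => hD) (hres.1.blocks B hB)
  · exact hres.2.2 (hrel hr).2.1

end Plan

end Invariant

/-! ### Admissibility, success at the release, and the reordering of transactions. -/

noncomputable section Executions

set_option linter.unusedSectionVars false

variable {P Tx Hash Rnd : Type*} [DecidableEq P] [MeasurableSpace Rnd]
  {Pr : Params P Tx Hash Rnd}

namespace Plan

variable {d : Plan P Tx Hash} {s : PlanState P Tx Hash} {c : Config P Tx Hash}

open Params

theorem OK.clean_start (hd : d.OK Pr) {D : Chain P Tx Hash} (h : Pr.ValidChain d.start D) :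
    d.Clean D :=
  Or.inl (h.slot_lt hd.reach.globOK.slot)

/-- The given configuration is arbitrary and may have messages in transit, among them requests for
unknown blocks. Hence `net_request` is claimed only after the first step; `q` has not joined before
that. -/
theorem OK.inv_start (hd : d.OK Pr) : d.Inv Pr d.initState d.start := by
  have hg := hd.reach.globOK
  have hcor : ∀ {j}, j ∈ d.start.active \ d.A → j ∈ d.start.active \ d.start.byz := fun hj =>
    Finset.mem_sdiff.2 ⟨(Finset.mem_sdiff.1 hj).1,
      fun hb => (Finset.mem_sdiff.1 hj).2 (hd.byz hb)⟩
  have hlenf := length_upTo_fork hd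
  refine {
    reach := hd.reach
    time := le_rfl
    mono := subset_rfl
    byz := hd.byz
    byz_eq := fun h => absurd h (lt_irrefl _)
    active := fun j hj => Or.inr hj
    unord := fun j hj _ tx htx =>
      ⟨j, (Finset.mem_sdiff.1 hj).1, (Finset.mem_sdiff.1 hj).2, Or.inl htx⟩
    net_op := ?_
    net_request := fun h => absurd h (lt_irrefl _)
    signed := fun B hB hs => hd.q_notMem (hg.signed B hB _ hs).1
    q_active := ⟨fun h => absurd h hd.q_notMem, False.elim⟩
    pub := fun j hj _ => hd.chain j (hcor hj)
    ext := .refl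
    priv := ⟨?_, Or.inl rfl, ?_⟩
    priv_slot := fun h => absurd h (lt_irrefl _)
    early := fun _ => ⟨rfl, id⟩
    phase := fun _ => rfl
    net_blk := ?_
    blocks := ?_
    q_chain := fun h => absurd h hd.q_notMem
    q_blocks := fun h => absurd h hd.q_notMem
    q_delivered := fun h => absurd h hd.q_notMem }
  · intro j hj tx htx
    obtain ⟨i, t, hi, hx⟩ := mem_netMsgs.1 htx
    exact ⟨j, (Finset.mem_sdiff.1 hj).1, (Finset.mem_sdiff.1 hj).2, Or.inr ⟨i, t, hi, hx⟩⟩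
  · exact hd.base_facts.1.of_prefix (upTo_prefix _ _) fun h => by
      change upTo d.base d.fork = [] at h
      rw [h] at hlenf
      simp at hlenf
  · intro B hB
    have : (upTo d.base d.fork).drop (d.fork + 1) = [] := List.drop_eq_nil_of_le hlenf.le
    change B ∈ (upTo d.base d.fork).drop (d.fork + 1) at hB
    rw [this] at hB
    simp at hB
  · intro j hj B hB
    obtain ⟨i, t, hi, hx⟩ := mem_netMsgs.1 hB
    obtain ⟨h₁, h₂⟩ := hg.net j _ hx
    -- A block in transit either ends a chain that is not longer than `base`, or its sender has
    -- signed it and it may sit on top of `base`; these are the two alternatives of `net_blk`.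
    rcases h₂ (fun hb => hi (hd.byz hb)) B rfl with h₃ | ⟨h₃, h₄⟩
    · obtain ⟨D, hD, hl, hle⟩ := h₃ B rfl
      refine ⟨D, hD, hl, hd.clean_start hD, Or.inl ?_⟩
      rwa [hd.chain i (hcor (Finset.mem_sdiff.2 ⟨h₁, hi⟩))] at hle
    · obtain ⟨D, hD, -⟩ := (hg.signed B h₃ _ h₄).2 fun hb => hi (hd.byz hb)
      refine ⟨_, hD, by simp, hd.clean_start hD, Or.inr ⟨h₃, i, hi, ?_, h₄⟩⟩
      rintro rfl
      exact hd.q_notMem h₁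
  · intro j hj _ B hB
    obtain ⟨D, hD, hl, -⟩ := (hg.loc j (hcor hj)).blocks B hB
    exact ⟨D, hD.1, hl, hd.clean_start hD.1⟩

/-- The history of the attack. -/
abbrev hist (d : Plan P Tx Hash) (Pr : Params P Tx Hash Rnd) (ω : Key P Tx Hash → Rnd) (n : ℕ) :
    List (Config P Tx Hash) :=
  Pr.history (d.strategy Pr) d.start ω n

/-- The execution of the attack. -/
abbrev run (d : Plan P Tx Hash) (Pr : Params P Tx Hash Rnd) (ω : Key P Tx Hash → Rnd) (n : ℕ) :
    Config P Tx Hash :=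
  Pr.exec (d.strategy Pr) d.start ω n

variable {ω : Key P Tx Hash → Rnd}

theorem hist_succ (n : ℕ) : d.hist Pr ω (n + 1) = d.run Pr ω (n + 1) :: d.hist Pr ω n := rfl

theorem run_succ (n : ℕ) : d.run Pr ω (n + 1) =
    Pr.step ω (d.action Pr (d.stateOf Pr (d.hist Pr ω n)) (d.run Pr ω n)) (d.run Pr ω n) := rfl

theorem hist_eq (n : ℕ) : d.hist Pr ω n = d.run Pr ω n :: (d.hist Pr ω n).tail := by
  cases n <;> rfl

theorem strategy_hist (n : ℕ) : d.strategy Pr (d.hist Pr ω n) =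
    d.action Pr (d.stateOf Pr (d.hist Pr ω n)) (d.run Pr ω n) := rfl

theorem stateOf_hist (n : ℕ) : d.stateOf Pr (d.hist Pr ω n) =
    d.update Pr (d.stateOf Pr (d.hist Pr ω n).tail) (d.run Pr ω n) := by
  rw [hist_eq]
  rfl

theorem active_subset_run (n : ℕ) : d.start.active ⊆ (d.run Pr ω n).active := by
  induction n with
  | zero => exact subset_rfl
  | succ n ih =>
    rw [run_succ, step_active]
    exact ih.trans Finset.subset_union_left

theorem subset_byz_run (n : ℕ) : d.A ⊆ (d.run Pr ω (n + 1)).byz := by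
  rw [run_succ, step_byz]
  exact Finset.subset_union_right

theorem legal_run (hd : d.OK Pr) (ω : Key P Tx Hash → Rnd) (n : ℕ) :
    Pr.Legal (d.run Pr ω n) (d.strategy Pr (d.hist Pr ω n)) := by
  rw [strategy_hist]
  refine ⟨hd.active.trans (active_subset_run n), ?_, ?_, ?_⟩
  -- New corruptions happen only in the first step, when every correct local chain is `base` and `A`
  -- holds exactly the budget on it.
  · cases n with
    | zero =>
      right
      intro j hj
      have h : d.start.byz ∪ d.A = d.A := Finset.union_eq_right.2 hd.byz
      change ∑ p ∈ d.start.byz ∪ d.A, Pr.stateAlloc p (d.start.loc j).chain ≤ _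
      rw [h, hd.chain j hj, hd.budget _ .refl]
    | succ n => exact Or.inl (subset_byz_run n)
  · intro q hq _ x hx hxA _
    change x.2.2 ∈ _ ++ (_ ++ d.netMsgs _ q)
    refine List.mem_append_right _ (List.mem_append_right _ (mem_netMsgs.2 ⟨x.1, x.2.1, ?_, hx⟩))
    exact fun h => hxA (Finset.mem_union_right _ h)
  · intro p hp
    refine Finset.mem_union_right _ ?_
    by_contra hA
    exact hp (if_neg hA)

theorem reachable_run (hd : d.OK Pr) (n : ℕ) : Pr.Reachable (d.run Pr ω n) := by
  induction n with
  | zero => exact hd.reach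
  | succ n ih => exact .step ω _ _ ih (legal_run hd ω n)

theorem length_update_pub_le (s : PlanState P Tx Hash) (c : Config P Tx Hash) :
    (d.update Pr s c).pub.length ≤ s.pub.length + 1 := by
  change (d.nextPub Pr s c).length ≤ _
  rcases nextPub_cases (Pr := Pr) (d := d) s c with ⟨h, -⟩ | ⟨B, -, h⟩ <;> rw [h] <;> simp

theorem length_update_priv_le (s : PlanState P Tx Hash) (c : Config P Tx Hash) :
    (d.update Pr s c).priv.length ≤ s.priv.length + 1 := by
  change (d.nextPriv Pr s c).length ≤ _
  rcases nextPriv_cases (Pr := Pr) (d := d) s c with ⟨h, -⟩ | ⟨B, -, h⟩ <;> rw [h] <;> simp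

theorem length_stateOf_le (h : List (Config P Tx Hash)) :
    (d.stateOf Pr h).pub.length ≤ d.base.length + h.length ∧
    (d.stateOf Pr h).priv.length ≤ d.base.length + h.length := by
  induction h with
  | nil =>
    exact ⟨le_rfl, (upTo_prefix _ _).length_le⟩
  | cons c h ih =>
    have h₁ := length_update_pub_le (Pr := Pr) (d := d) (d.stateOf Pr h) c
    have h₂ := length_update_priv_le (Pr := Pr) (d := d) (d.stateOf Pr h) c
    change (d.update Pr (d.stateOf Pr h) c).pub.length ≤ _ ∧
      (d.update Pr (d.stateOf Pr h) c).priv.length ≤ _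
    rw [List.length_cons]
    omega

theorem length_hist (n : ℕ) : (d.hist Pr ω n).length = n + 1 := by
  induction n with
  | zero => rfl
  | succ n ih => rw [hist_succ, List.length_cons, ih]

theorem admissible (hd : d.OK Pr) : Pr.Admissible (d.strategy Pr) d.start := by
  -- In each step whole chains are sent again, at most the public and the private one, and each of
  -- them gains at most one block per step. This gives a linear bound.
  refine ⟨legal_run hd, 2 * (d.base.length + 1), 1, fun ω n => ?_⟩
  obtain ⟨h₁, h₂⟩ := length_stateOf_le (Pr := Pr) (d := d) (d.hist Pr ω n)
  rw [length_hist] at h₁ h₂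
  have hK : (d.base.length + (n + 1)) + (d.base.length + (n + 1)) ≤
      2 * (d.base.length + 1) * (n + 1) ^ 1 := by
    rw [pow_one]
    nlinarith [Nat.zero_le (d.base.length * n)]
  change (d.action Pr (d.stateOf Pr (d.hist Pr ω n)) (d.run Pr ω n)).join.card ≤ _ ∧ ∀ q,
    0 ≤ _ ∧ (d.privMsgs (d.stateOf Pr (d.hist Pr ω n)) q ++
      ((d.stateOf Pr (d.hist Pr ω n)).pub.tail.map Msg.blk ++
        d.netMsgs (d.run Pr ω n) q)).length ≤ ((d.run Pr ω n).net q).length + _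
  refine ⟨?_, fun q => ⟨Nat.zero_le _, ?_⟩⟩
  · have : (d.action Pr (d.stateOf Pr (d.hist Pr ω n)) (d.run Pr ω n)).join.card ≤ 1 := by
      unfold action
      dsimp only
      split_ifs <;> simp
    omega
  · have h₃ : (d.privMsgs (d.stateOf Pr (d.hist Pr ω n)) q).length ≤ d.base.length + (n + 1) := by
      unfold privMsgs
      split_ifs
      · rw [List.length_map, List.length_tail]
        omega
      · simp
    have h₄ : (d.netMsgs (d.run Pr ω n) q).length ≤ ((d.run Pr ω n).net q).length := by
      unfold netMsgs
      rw [List.length_map]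
      exact List.length_filter_le _ _
    simp only [List.length_append, List.length_map, List.length_tail]
    omega

theorem rel_update {c : Config P Tx Hash} (h : s.rel) : (d.update Pr s c).rel := Or.inl h

/-- The invariant holds until the private chain is revealed. -/
theorem inv_of_not_rel (hd : d.OK Pr) (n : ℕ) (h : ¬ (d.stateOf Pr (d.hist Pr ω n).tail).rel) :
    d.Inv Pr (d.stateOf Pr (d.hist Pr ω n).tail) (d.run Pr ω n) := by
  induction n with
  | zero => exact hd.inv_start
  | succ n ih =>
    have h' : ¬ (d.stateOf Pr (d.hist Pr ω n)).rel := h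
    have h'' : ¬ (d.stateOf Pr (d.hist Pr ω n).tail).rel := by
      rw [stateOf_hist] at h'
      exact fun hr => h' (rel_update hr)
    have hr := (ih h'').ready hd
    rw [← stateOf_hist] at hr
    exact hr.step hd ω (legal_run hd ω n) fun hrel => absurd hrel h'

theorem evol_run (hd : d.OK Pr) {n n' : ℕ} (h : n ≤ n') (p : P) :
    Evol ((d.run Pr ω n).loc p) ((d.run Pr ω n').loc p) := by
  induction n', h using Nat.le_induction with
  | base => exact .refl _
  | succ m _ ih => exact ih.trans ((reachable_run hd m).globOK.evol ω _ p)

/-- The activation of a process to which the private chain is revealed. -/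
theorem Ready.result_revealed (h : d.Ready Pr s c) {x : P}
    (hx : x ∈ (Pr.mid (d.action Pr s c) c).active \ (Pr.mid (d.action Pr s c) c).byz)
    (hrel : s.rel) (hxS : x ∈ insert d.q d.S) (hlen : s.pub.length ≤ s.priv.length)
    (hxl : (c.loc x).chain.length < s.priv.length) :
    (Pr.result (d.action Pr s c) c x).1.chain = s.priv ∧
    ∀ B ∈ s.pub, B ∈ (Pr.result (d.action Pr s c) c x).1.blocks := by
  have hx' := (mem_correct h.toBaseInv x).1 hx
  -- The private blocks are handled first. The public chain and the messages in transit follow, and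
  -- since they concern chains that are not longer, they add blocks without changing the local
  -- chain.
  rw [result_eq h.toBaseInv, privMsgs_eq ⟨hrel, hxS⟩, handleAll_append, handleAll_append]
  set m := Pr.mid (d.action Pr s c) c with hm
  have hle : c.Le m := mid_le _ _
  have hw := wake_locOK (s := s) h.toBaseInv hx
  have hr := handleAll_chain (x := (Pr.wake [] (c.loc x), [])) hw (h.priv.valid.mono hle)
  have hch : (Pr.handleAll m (s.priv.tail.map Msg.blk) (Pr.wake [] (c.loc x), [])).1.chain =
      s.priv := by
    rw [hr.chain]
    refine if_pos ?_
    change (Pr.wake [] (c.loc x)).chain.length < _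
    rw [wake_chain]
    exact hxl
  obtain ⟨hyL, -, -⟩ := handleAll_spec (s.priv.tail.map Msg.blk) (Pr.wake [] (c.loc x), []) hw
    (by simp)
  have hyo := hr.out
  set y := Pr.handleAll m (s.priv.tail.map Msg.blk) (Pr.wake [] (c.loc x), []) with hy
  have hr' := handleAll_chain (x := y) hyL (h.pubValid.mono hle)
  have hch' := hr'.chain_eq_of_le (by rw [hch]; exact hlen)
  obtain ⟨hzL, -, -⟩ := handleAll_spec (s.pub.tail.map Msg.blk) y hyL (by simp [hyo])
  have hzo := hr'.out.trans hyo
  set z := Pr.handleAll m (s.pub.tail.map Msg.blk) y with hz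
  rw [hch] at hch'
  have hnet : ∀ {M : Msg P Tx Hash}, M ∈ d.netMsgs c x → x ∈ c.active \ d.A := by
    intro M hM
    refine Finset.mem_sdiff.2 ⟨?_, hx'.2⟩
    by_contra hq
    obtain ⟨i, t, -, hi⟩ := mem_netMsgs.1 hM
    rw [h.reach.globOK.inactive_net _ hq] at hi
    simp at hi
  have hU := handleAll_unaffected (c := m) (Q := fun D => D.length ≤ s.priv.length)
    (X := fun _ => False) (n := s.priv.length) (ops := pending d.start d.A)
    (fun D E hD hE _ => hE.length_le.trans hD) (fun D hD => hD) (d.netMsgs c x) z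
    (by
      refine ⟨rfl, rfl, Set.subset_union_left, subset_rfl, ?_, ?_, ?_, ?_⟩
      · intro B hB
        obtain ⟨D, hD, hl, hle⟩ := hzL.blocks B hB
        exact ⟨D, hD.1, hl, Or.inl (hch' ▸ hle)⟩
      all_goals simp [hzo])
    (by rw [hch']) (fun tx htx => h.net_op x (hnet htx) tx htx)
    (fun B hB => (h.net_blk x (hnet hB) B hB).mono hle fun D hD => hD.2.trans hlen)
    (fun B _ D _ _ hF => hF.elim)
  exact ⟨hU.chain.trans hch', fun B hB => hU.blocks_mono (hr'.blocks B hB)⟩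

theorem PrivOK.exists_block {C : Chain P Tx Hash} (hd : d.OK Pr) (h : d.PrivOK Pr c C)
    (hlen : d.fork + 1 < C.length) : ∃ B E, C = upTo d.base d.fork ++ B :: E ∧ B.txs = d.l := by
  rcases h.shape with hs | ⟨B, E, hs, hB, -⟩
  · rw [hs, length_upTo_fork hd] at hlen
    omega
  · exact ⟨B, E, hs, hB⟩

/-- When the private chain is revealed, the attack succeeds. -/
theorem Ready.attackSucceeds (hd : d.OK Pr) (h : d.Ready Pr s c) (ω : Key P Tx Hash → Rnd)
    (hrel : s.rel) (hq : d.q ∉ c.active) (hN : d.N ≤ s.pub.length)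
    (hL : s.pub.length + d.L ≤ s.priv.length) :
    AttackSucceeds Pr d.start d.base d.fork d.S d.l (Pr.step ω (d.action Pr s c) c) := by
  have hqA : d.q ∉ d.A := fun hq => hd.q_notMem (hd.active hq)
  set a := d.action Pr s c with ha
  have hle₁ : (Pr.mid a c).Le (Pr.step ω a c) := mid_le_step ω a c
  have hle : c.Le (Pr.step ω a c) := le_step ω a c
  have hg := h.reach.globOK
  have hbyz : (Pr.step ω a c).byz = d.A := mid_byz h.toBaseInv
  have hlt : s.pub.length < s.priv.length := by have := hd.L_pos; omega
  have hforkN := hd.fork_lt_N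
  have hcor : ∀ {j}, j ∈ (Pr.step ω a c).active \ (Pr.step ω a c).byz ↔
    j ∈ (Pr.mid a c).active \ (Pr.mid a c).byz := Iff.rfl
  have hrev : ∀ {x}, x ∈ insert d.q d.S →
      x ∈ (Pr.mid a c).active \ (Pr.mid a c).byz ∧
      (Pr.result a c x).1.chain = s.priv ∧ ∀ B ∈ s.pub, B ∈ (Pr.result a c x).1.blocks := by
    intro x hx
    have hxc : x ∈ (Pr.mid a c).active \ (Pr.mid a c).byz ∧
        (c.loc x).chain.length < s.priv.length := by
      rcases Finset.mem_insert.1 hx with rfl | hxS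
      · refine ⟨(mem_correct h.toBaseInv _).2 ⟨Or.inr ⟨hrel, rfl⟩, hqA⟩, ?_⟩
        rw [hg.inactive_loc _ hq]
        change 1 < _
        omega
      · have hx' := Finset.mem_sdiff.1 (hd.S_subset hxS)
        have hxq : x ≠ d.q := by
          rintro rfl
          exact hd.q_notMem hx'.1
        have hxa := h.mono hx'.1
        exact ⟨(mem_correct h.toBaseInv _).2 ⟨Or.inl hxa, hx'.2⟩,
          (h.pub x (Finset.mem_sdiff.2 ⟨hxa, hx'.2⟩) hxq).length_le.trans_lt hlt⟩
    exact ⟨hxc.1, h.result_revealed hxc.1 hrel hx hlt.le hxc.2⟩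
  have hoth : ∀ {j}, j ∈ (Pr.mid a c).active \ (Pr.mid a c).byz → j ∉ insert d.q d.S →
      (Pr.result a c j).1.chain = s.pub := by
    intro j hj hjS
    have hjq : j ≠ d.q := by
      rintro rfl
      exact hjS (Finset.mem_insert_self _ _)
    exact (h.result_honest hd (mem_active_of_ne h.toBaseInv hjq hj) hjq
      fun h' => hjS h'.2).2.1
  have hfp := h.priv.fork_prefix
  obtain ⟨B, E, hBE, hBl⟩ := h.priv.exists_block hd (show d.fork + 1 < s.priv.length by omega)
  refine ⟨s.priv, d.q, h.priv.valid.mono hle, hfp, ?_, ?_, ⟨B, ?_, hBl⟩, by omega, ?_,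
    hd.q_notMem, ?_, ?_⟩
  -- The prefix of `base` through height `fork + 1` is clean, and one block too long to be a clean
  -- prefix of the private chain.
  · intro hpre
    have hc : d.Clean (upTo d.base (d.fork + 1)) :=
      hd.clean_prefix (Or.inr List.prefix_rfl) (upTo_prefix _ _)
    have h₁ := h.priv.length_le_of_clean hd hpre hc
    have h₂ := hd.fork_lt
    simp only [upTo, List.length_take] at h₁
    omega
  · intro B hB
    obtain ⟨p, hp, sl, hs, -⟩ := h.priv.tail B hB
    exact ⟨p, hbyz ▸ hp, hs⟩
  · rw [hBE, List.getElem?_append_right (length_upTo_fork hd).le, length_upTo_fork hd]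
    simp
  · exact (mem_mid_active _).2 (Or.inr ⟨hrel, rfl⟩)
  · intro x hx
    obtain ⟨hxc, hch, hpub⟩ := hrev hx
    obtain ⟨r, hr⟩ := step_loc_of_correct (ω := ω) hxc
    have hL := (hg.result_spec hxc).1
    rw [hr]
    refine ⟨(Finset.mem_sdiff.1 (hcor.2 hxc)).2, hch, ?_, ?_⟩
    · rw [← hch]
      exact hL.deep
    · intro j hj B hB
      obtain ⟨r', hr'⟩ := step_loc_of_correct (ω := ω) (hcor.1 hj)
      rw [hr'] at hB
      change B ∈ (Pr.result a c j).1.chain at hB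
      by_cases hjS : j ∈ insert d.q d.S
      · rw [(hrev hjS).2.1, ← hch] at hB
        exact hL.known.2 B hB
      · rw [hoth (hcor.1 hj) hjS] at hB
        exact hpub B hB
  · intro j hj hjS
    obtain ⟨r', hr'⟩ := step_loc_of_correct (ω := ω) (hcor.1 hj)
    rw [hr']
    change (Pr.result a c j).1.chain.length < _
    rw [hoth (hcor.1 hj) hjS]
    exact hlt

open Classical in
theorem foldl_deliver_eq_append (l d : List Tx) (hl : l.Nodup) (hd : ∀ tx ∈ l, tx ∉ d) :
    l.foldl (fun d tx => if tx ∈ d then d else d ++ [tx]) d = d ++ l := by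
  induction l generalizing d with
  | nil => simp
  | cons a l ih =>
    rw [List.nodup_cons] at hl
    rw [List.foldl_cons, if_neg (hd a (by simp)), ih _ hl.2, List.append_assoc]
    · rfl
    · intro tx htx hmem
      rcases List.mem_append.1 hmem with h | h
      · exact hd tx (by simp [htx]) h
      · rw [List.mem_singleton] at h
        exact hl.1 (h ▸ htx)

theorem wake_initLocal : Pr.wake [] Pr.initLocal = Pr.initLocal := by
  have h : Pr.initLocal.retry = false := rfl
  unfold wake
  simp only [h, Bool.false_eq_true, if_false, List.not_mem_nil, false_and, Set.ofPred_false,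
    Set.union_empty]
  exact rfl

/-- A process that joins when the private chain is revealed a-delivers the transactions of its
first private block in their order. -/
theorem Ready.sublist_delivered (hd : d.OK Pr) (h : d.Ready Pr s c) (ω : Key P Tx Hash → Rnd)
    (hrel : s.rel) (hq : d.q ∉ c.active) (hlen : d.fork + 1 + Pr.k < s.priv.length) :
    d.l.Sublist ((Pr.step ω (d.action Pr s c) c).loc d.q).delivered := by
  classical
  have hqA : d.q ∉ d.A := fun hq => hd.q_notMem (hd.active hq)
  have hqc := (mem_correct (s := s) h.toBaseInv d.q).2 ⟨Or.inr ⟨hrel, rfl⟩, hqA⟩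
  obtain ⟨r, hr⟩ := step_loc_of_correct (ω := ω) hqc
  rw [hr]
  change d.l.Sublist (Pr.result (d.action Pr s c) c d.q).1.delivered
  rw [result_eq h.toBaseInv, privMsgs_eq ⟨hrel, Finset.mem_insert_self _ _⟩, handleAll_append,
    h.reach.globOK.inactive_loc _ hq, wake_initLocal]
  set m := Pr.mid (d.action Pr s c) c with hm
  have hpriv := h.priv.valid.mono (mid_le (Pr := Pr) (d.action Pr s c) c)
  obtain ⟨hL, -, hout⟩ := handleAll_spec (Pr := Pr) (s.priv.tail.map Msg.blk)
    (Pr.initLocal, []) (locOK_initLocal m) (by simp)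
  have hdel := handleAll_chain_delivered (Pr := Pr) [] hpriv
  set y := Pr.handleAll m (s.priv.tail.map Msg.blk) (Pr.initLocal, []) with hy
  refine List.Sublist.trans ?_
    (handleAll_spec (Pr := Pr) (s.pub.tail.map Msg.blk ++ d.netMsgs c d.q) y hL hout).2.1.delivered.sublist
  obtain ⟨B, E, hBE, hBl⟩ := h.priv.exists_block hd (by omega)
  -- The assumed length buries the first private block under at least `k` others. Its transactions
  -- do not occur up to the fork, so the newcomer delivers them as one contiguous piece.
  have hpre : upTo d.base d.fork ++ [B] <+: dropLastK s.priv Pr.k := by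
    refine List.prefix_of_prefix_length_le (l₃ := s.priv) ?_ (dropLastK_prefix _ _) ?_
    · rw [hBE]
      exact ⟨E, by simp⟩
    · simp only [dropLastK, List.length_append, List.length_singleton, List.length_take,
        length_upTo_fork hd]
      omega
  obtain ⟨F, hF⟩ := hpre
  rw [hdel, ← hF, txsOf_append, txsOf_append, List.foldl_append, List.foldl_append]
  refine List.Sublist.trans ?_ (foldl_deliver_prefix _ _).sublist
  have hB : txsOf [B] = d.l := by simp [txsOf, hBl]
  obtain ⟨h₁, h₂⟩ := Pr.validTx_fresh _ _ hd.valid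
  rw [hB, foldl_deliver_eq_append _ _ h₁]
  · exact List.sublist_append_right _ _
  · intro tx htx hmem
    rw [mem_foldl_deliver] at hmem
    rcases hmem with hmem | hmem
    · simp at hmem
    · exact h₂ tx htx hmem

theorem not_sublist_swap {l : List Tx} (hl : l.Nodup) {x y : Tx} (h : [x, y].Sublist l) :
    ¬ [y, x].Sublist l := by
  intro h'
  -- In a list without duplicates, two entries occur in one order only; this is proved for all
  -- ordered pairs at once and then restricted to the given sublist.
  have h₁ : l.Pairwise fun a b => [a, b].Sublist l ∧ ¬ [b, a].Sublist l := by
    clear h h'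
    induction l with
    | nil => exact List.Pairwise.nil
    | cons a l ih =>
      rw [List.nodup_cons] at hl
      refine List.Pairwise.cons ?_ ?_
      · intro b hb
        refine ⟨List.Sublist.cons_cons a (List.singleton_sublist.2 hb), fun h => ?_⟩
        rcases List.sublist_cons_iff.1 h with h | ⟨r, hr, h⟩
        · exact hl.1 (h.subset (by simp))
        · simp only [List.cons.injEq] at hr
          exact hl.1 (hr.1 ▸ hb)
      · refine (List.Pairwise.and_mem.1 (ih hl.2)).imp ?_
        rintro b e ⟨hb, he, h₁, h₂⟩
        refine ⟨h₁.cons a, fun h => ?_⟩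
        rcases List.sublist_cons_iff.1 h with h | ⟨r, hr, h⟩
        · exact h₂ h
        · simp only [List.cons.injEq] at hr
          exact hl.1 (hr.1 ▸ he)
  have h₂ := h₁.sublist h
  simp only [List.pairwise_cons, List.mem_singleton, forall_eq] at h₂
  exact h₂.1.2 h'

end Plan

end Executions

/-! ### Measurability of histories and integration step by step. -/

noncomputable section Probability

set_option linter.unusedSectionVars false

/-- A function with finitely many values whose fibers are measurable. -/
def SimpleFor {Ω α : Type*} (m : MeasurableSpace Ω) (f : Ω → α) : Prop :=
  (Set.range f).Finite ∧ ∀ y, MeasurableSet[m] (f ⁻¹' {y})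

namespace SimpleFor

variable {Ω α β : Type*} {m : MeasurableSpace Ω} {f : Ω → α}

theorem preimage (h : SimpleFor m f) (s : Set α) : MeasurableSet[m] (f ⁻¹' s) := by
  have : f ⁻¹' s = ⋃ y ∈ Set.range f ∩ s, f ⁻¹' {y} := by
    ext ω
    simp
  rw [this]
  exact (h.1.subset Set.inter_subset_left).measurableSet_biUnion fun y _ => h.2 y

theorem comp (h : SimpleFor m f) (g : α → β) : SimpleFor m fun ω => g (f ω) := by
  refine ⟨?_, fun y => h.preimage (g ⁻¹' {y})⟩
  rw [Set.range_comp' g f]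
  exact h.1.image g

theorem measurable [MeasurableSpace β] (h : SimpleFor m f) (g : α → β) :
    Measurable[m] fun ω => g (f ω) :=
  fun s _ => h.preimage (g ⁻¹' s)

theorem mono {m' : MeasurableSpace Ω} (hm : m ≤ m') (h : SimpleFor m f) : SimpleFor m' f :=
  ⟨h.1, fun y => hm _ (h.2 y)⟩

/-- The finitely many fibers of `f` cut the space into measurable pieces, on each of which the
parameter of `g` is constant. This permits an adaptive adversary without a measurable structure on
configurations. -/
theorem bind (h : SimpleFor m f) {g : α → Ω → β} (hg : ∀ ω, SimpleFor m (g (f ω))) :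
    SimpleFor m fun ω => g (f ω) ω := by
  have hg' : ∀ a ∈ Set.range f, SimpleFor m (g a) := by
    rintro _ ⟨ω, rfl⟩
    exact hg ω
  refine ⟨?_, fun y => ?_⟩
  · refine (h.1.biUnion (t := fun a => Set.range (g a)) fun a ha => (hg' a ha).1).subset ?_
    rintro _ ⟨ω, rfl⟩
    simp only [Set.mem_iUnion]
    exact ⟨f ω, ⟨ω, rfl⟩, ω, rfl⟩
  · have : (fun ω => g (f ω) ω) ⁻¹' {y} = ⋃ a ∈ Set.range f, f ⁻¹' {a} ∩ g a ⁻¹' {y} := by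
      ext ω
      simp only [Set.mem_preimage, Set.mem_singleton_iff, Set.mem_iUnion, Set.mem_inter_iff,
        exists_prop]
      exact ⟨fun h => ⟨f ω, ⟨ω, rfl⟩, rfl, h⟩, fun ⟨a, _, h₁, h₂⟩ => h₁ ▸ h₂⟩
    rw [this]
    exact h.1.measurableSet_biUnion fun a ha => (h.2 a).inter ((hg' a ha).2 y)

theorem of_events {ι : Type*} [Finite ι] {E : ι → Set Ω} (hE : ∀ i, MeasurableSet[m] (E i)) :
    SimpleFor m fun ω i => ω ∈ E i := by
  refine ⟨Set.toFinite _, fun y => ?_⟩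
  have : (fun ω i => ω ∈ E i) ⁻¹' {y} = ⋂ i, {ω | (ω ∈ E i) = y i} := by
    ext ω
    simp [funext_iff]
  rw [this]
  refine MeasurableSet.iInter fun i => ?_
  by_cases hy : y i
  · simpa [hy] using hE i
  · have h : {ω | (ω ∈ E i) = y i} = (E i)ᶜ := by
      ext ω
      simp [hy]
    rw [h]
    exact (hE i).compl

end SimpleFor

variable {P Tx Hash Rnd : Type*} [DecidableEq P] [MeasurableSpace Rnd]
  {Pr : Params P Tx Hash Rnd}

namespace Params

open ProbabilityTheory

instance : IsProbabilityMeasure Pr.randomness := by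
  have := Pr.D_prob
  unfold randomness
  infer_instance

/-- The information in the randomness of the queries in `S`. -/
@[reducible]
def sigmaOf (P Tx Hash Rnd : Type*) [MeasurableSpace Rnd] (S : Set (Key P Tx Hash)) :
    MeasurableSpace (Key P Tx Hash → Rnd) :=
  ⨆ k ∈ S, MeasurableSpace.comap (fun ω : Key P Tx Hash → Rnd => ω k) inferInstance

theorem sigmaOf_le (S : Set (Key P Tx Hash)) :
    sigmaOf P Tx Hash Rnd S ≤ MeasurableSpace.pi :=
  iSup₂_le fun k _ => (measurable_pi_apply k).comap_le

theorem sigmaOf_mono {S T : Set (Key P Tx Hash)} (h : S ⊆ T) :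
    sigmaOf P Tx Hash Rnd S ≤ sigmaOf P Tx Hash Rnd T :=
  biSup_mono h

theorem measurableSet_sigmaOf {S : Set (Key P Tx Hash)} {k : Key P Tx Hash} (hk : k ∈ S)
    {s : Set Rnd} (hs : MeasurableSet s) :
    MeasurableSet[sigmaOf P Tx Hash Rnd S] {ω | ω k ∈ s} := by
  have h : MeasurableSpace.comap (fun ω : Key P Tx Hash → Rnd => ω k) inferInstance ≤
      sigmaOf P Tx Hash Rnd S :=
    le_iSup₂ (f := fun k (_ : k ∈ S) =>
      MeasurableSpace.comap (fun ω : Key P Tx Hash → Rnd => ω k) inferInstance) k hk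
  exact h _ ⟨s, hs, rfl⟩

theorem indep_sigmaOf {S T : Set (Key P Tx Hash)} (h : Disjoint S T) :
    Indep (sigmaOf P Tx Hash Rnd S) (sigmaOf P Tx Hash Rnd T) Pr.randomness := by
  have := Pr.D_prob
  have hi : iIndepFun (fun (k : Key P Tx Hash) (ω : Key P Tx Hash → Rnd) => ω k)
      Pr.randomness :=
    iIndepFun_infinitePi (P := fun _ : Key P Tx Hash => Pr.D) (X := fun _ x => x)
      fun _ => measurable_id
  exact indep_iSup_of_disjoint (fun k => (measurable_pi_apply k).comap_le) hi.iIndep h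

/-- The probability that nobody in `K` is elected. -/
theorem randomness_not_elected (K : Finset P) (v : Chain P Tx Hash) (t : ℕ) (S : P →₀ ℕ) :
    Pr.randomness {ω | ∀ p ∈ K, p ∉ Pr.F S t (ω (p, v, t))} =
      ENNReal.ofReal ((1 - Pr.rate) ^ ∑ p ∈ K, S p) := by
  have := Pr.D_prob
  have hr := Pr.rate_pos
  have hr' := Pr.rate_lt_one
  -- Different processes query different coordinates, so the probabilities multiply and the
  -- resources add up in the exponent.
  let e : P ↪ Key P Tx Hash := ⟨fun p => (p, v, t), fun p p' h => by simpa using h⟩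
  have hset : {ω : Key P Tx Hash → Rnd | ∀ p ∈ K, p ∉ Pr.F S t (ω (p, v, t))} =
      ((K.map e : Finset (Key P Tx Hash)) : Set (Key P Tx Hash)).pi
        fun k => {x | k.1 ∈ Pr.F S t x}ᶜ := by
    ext ω
    simp only [Set.mem_ofPred_eq, Set.mem_pi, Finset.mem_coe, Finset.mem_map,
      forall_exists_index, and_imp, forall_apply_eq_imp_iff₂, Set.mem_compl_iff]
    rfl
  rw [hset]
  unfold randomness
  rw [Measure.infinitePi_pi _ fun k _ => (Pr.F_measurable S t k.1).compl, Finset.prod_map]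
  have hp : ∀ p, Pr.D {x | p ∈ Pr.F S t x}ᶜ = ENNReal.ofReal ((1 - Pr.rate) ^ S p) := by
    intro p
    rw [prob_compl_eq_one_sub (Pr.F_measurable S t p), Pr.F_prob, ← ENNReal.ofReal_one,
      ← ENNReal.ofReal_sub _ (by
        have : (1 - Pr.rate) ^ S p ≤ 1 := pow_le_one₀ (by linarith) (by linarith)
        linarith)]
    congr 1
    ring
  have hp' : ∀ p, Pr.D {x | (e p).1 ∈ Pr.F S t x}ᶜ = ENNReal.ofReal ((1 - Pr.rate) ^ S p) := hp
  simp only [hp']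
  rw [← ENNReal.ofReal_prod_of_nonneg fun p _ => pow_nonneg (by linarith) _,
    Finset.prod_pow_eq_pow_sum]

/-! ### Histories -/

open Classical in
/-- One time step, given who wins. -/
def stepWith (Pr : Params P Tx Hash Rnd) (wins : P → Chain P Tx Hash × Block P Tx Hash → Prop)
    (a : AdvAction P Tx Hash) (c : Config P Tx Hash) : Config P Tx Hash :=
  let c₁ := Pr.mid a c
  let correct := c₁.active \ c₁.byz
  let res := Pr.result a c
  let com := Pr.commitOf a c
  let out := fun p => (res p).2 ++
    ((com p).toList.filter fun st => decide (wins p st)).map fun st =>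
      Msg.blk (mined c.time p st.2)
  { time := c.time + 1
    active := c₁.active
    byz := c₁.byz
    loc := fun p => if p ∈ correct then
        { (res p).1 with
          com := none
          retry := match com p with
            | none => (res p).1.retry
            | some st => !decide (wins p st) }
      else c₁.loc p
    assigned := c.assigned ∪ {x | ∃ st, wins x.1 st ∧ x.2 = (Pr.view st.1 c.time, c.time)}
    signed := c.signed ∪ {B | ∃ p st, p ∈ correct ∧ wins p st ∧ B = mined c.time p st.2}
    net := fun q => (c.net q).filter (fun x => decide (x.2.2 ∉ a.deliver q)) ++
      if q ∈ c₁.active then correct.toList.flatMap fun p => (out p).map fun m => (p, c.time, m)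
      else [] }

theorem step_eq_stepWith (ω : Key P Tx Hash → Rnd) (a : AdvAction P Tx Hash)
    (c : Config P Tx Hash) : Pr.step ω a c = Pr.stepWith (Pr.Wins ω a c) a c := by
  unfold step stepWith Wins commitOf result mid mined
  dsimp only
  congr!

/-- The commit of `p` is determined by `a` and `c` before any randomness of the slot is used, so the
event is empty or concerns a single coordinate of this slot. -/
theorem measurableSet_wins (a : AdvAction P Tx Hash) (c : Config P Tx Hash) (p : P) :
    MeasurableSet[sigmaOf P Tx Hash Rnd {k | k.2.2 = c.time}]
      {ω | ∃ st, Pr.Wins ω a c p st} := by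
  unfold Wins
  cases hc : Pr.commitOf a c p with
  | none => simp
  | some st =>
    simp only [Option.some.injEq, exists_eq_left']
    unfold Elected
    have hm := measurableSet_sigmaOf (P := P) (Tx := Tx) (Hash := Hash)
      (S := {k | k.2.2 = c.time}) (k := (p, Pr.view st.1 (Pr.mid a c).time, (Pr.mid a c).time))
      rfl (Pr.F_measurable (Pr.ledger (txsOf (Pr.view st.1 (Pr.mid a c).time)))
        (Pr.mid a c).time p)
    by_cases h : Pr.ValidChain (Pr.mid a c) st.1 ∧ Pr.Linked st.1 st.2
    · simp only [h.1, h.2, true_and]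
      exact hm
    · have : ∀ ω : Key P Tx Hash → Rnd, ¬ (Pr.ValidChain (Pr.mid a c) st.1 ∧
          Pr.Linked st.1 st.2 ∧ p ∈ Pr.F (Pr.ledger (txsOf (Pr.view st.1 (Pr.mid a c).time)))
            (Pr.mid a c).time (ω (p, Pr.view st.1 (Pr.mid a c).time, (Pr.mid a c).time))) :=
        fun ω hω => h ⟨hω.1, hω.2.1⟩
      simp only [this, Set.ofPred_false]
      exact @MeasurableSet.empty _ (sigmaOf P Tx Hash Rnd {k | k.2.2 = c.time})

theorem commitOf_eq_none {a : AdvAction P Tx Hash} {c : Config P Tx Hash} {p : P}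
    (h : p ∉ (Pr.mid a c).active ∪ (Pr.mid a c).byz) : Pr.commitOf a c p = none := by
  rw [Finset.mem_union, not_or] at h
  unfold commitOf
  rw [if_neg fun h' => h.1 (Finset.mem_sdiff.1 h').1, if_neg h.2]

/-- Only the finitely many processes in `K` can commit, each to at most one state, so the new
configuration is a function of finitely many bits. -/
theorem simpleFor_step (a : AdvAction P Tx Hash) (c : Config P Tx Hash) :
    SimpleFor (sigmaOf P Tx Hash Rnd {k | k.2.2 = c.time}) fun ω => Pr.step ω a c := by
  classical
  let K := (Pr.mid a c).active ∪ (Pr.mid a c).byz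
  have h := SimpleFor.of_events (ι := K) (E := fun p => {ω | ∃ st, Pr.Wins ω a c p st})
    fun p => measurableSet_wins a c p
  have h' := h.comp fun y => Pr.stepWith
    (fun p st => Pr.commitOf a c p = some st ∧ ∃ hp : p ∈ K, y ⟨p, hp⟩) a c
  convert h' using 2 with ω
  rw [step_eq_stepWith]
  congr 1
  funext p st
  apply propext
  constructor
  · intro hw
    refine ⟨hw.1, ?_, st, hw⟩
    by_contra hp
    have h₁ := hw.1
    rw [commitOf_eq_none hp] at h₁
    simp at h₁
  · rintro ⟨h₁, hp, st', h₂⟩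
    have h₃ := h₂.1
    rw [h₁] at h₃
    simp only [Option.some.injEq] at h₃
    rw [h₃]
    exact h₂

theorem exec_time (σ : Strategy P Tx Hash) (c : Config P Tx Hash) (ω : Key P Tx Hash → Rnd)
    (n : ℕ) : (Pr.exec σ c ω n).time = c.time + n := by
  induction n with
  | zero => rfl
  | succ n ih =>
    change (Pr.exec σ c ω n).time + 1 = _
    omega

/-- A step at time `t` reads queries of slot `t` only. The strict bound on the slots is what makes
the next step independent of the history. -/
theorem simpleFor_history (σ : Strategy P Tx Hash) (c : Config P Tx Hash) (n : ℕ) :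
    SimpleFor (sigmaOf P Tx Hash Rnd {k | k.2.2 < c.time + n})
      fun ω => Pr.history σ c ω n := by
  induction n with
  | zero =>
    refine ⟨Set.Finite.subset (Set.finite_singleton [c]) ?_, fun y => ?_⟩
    · rintro _ ⟨ω, rfl⟩
      rfl
    · exact MeasurableSet.const ([c] = y)
  | succ n ih =>
    have h := (ih.mono (sigmaOf_mono (T := {k | k.2.2 < c.time + (n + 1)}) fun k hk => by
      simp only [Set.mem_ofPred_eq] at hk ⊢
      omega)).bind (g := fun h ω => Pr.step ω (σ h) (h.headD c) :: h) fun ω => by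
        refine SimpleFor.comp (g := fun x => x :: Pr.history σ c ω n) ?_
        refine (simpleFor_step _ _).mono (sigmaOf_mono fun k hk => ?_)
        have := exec_time (Pr := Pr) σ c ω n
        unfold exec at this
        simp only [Set.mem_ofPred_eq] at hk ⊢
        omega
    exact h

/-- A bound for the expectation after one more time step, from the bounds that are conditional on
the history. -/
theorem lintegral_history_succ_le (σ : Strategy P Tx Hash) (c : Config P Tx Hash)
    (Ψ : List (Config P Tx Hash) → ENNReal) (ρ : ENNReal) (n : ℕ)
    (h : ∀ ω, ∫⁻ ω', Ψ (Pr.step ω' (σ (Pr.history σ c ω n))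
        ((Pr.history σ c ω n).headD c) :: Pr.history σ c ω n) ∂Pr.randomness ≤
      ρ * Ψ (Pr.history σ c ω n)) :
    ∫⁻ ω, Ψ (Pr.history σ c ω (n + 1)) ∂Pr.randomness ≤
      ρ * ∫⁻ ω, Ψ (Pr.history σ c ω n) ∂Pr.randomness := by
  classical
  have hs := simpleFor_history (Pr := Pr) σ c n
  have hs' := hs.mono (sigmaOf_le _)
  let R := hs.1.toFinset
  let e : List (Config P Tx Hash) → (Key P Tx Hash → Rnd) → ENNReal :=
    fun y => ((fun ω => Pr.history σ c ω n) ⁻¹' {y}).indicator 1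
  -- Decomposition by the value `y` of the history, which replaces a conditional expectation.
  have hsum : ∀ (g : List (Config P Tx Hash) → (Key P Tx Hash → Rnd) → ENNReal) ω,
      g (Pr.history σ c ω n) ω = ∑ y ∈ R, e y ω * g y ω := by
    intro g ω
    rw [Finset.sum_eq_single (Pr.history σ c ω n)]
    · simp [e]
    · intro y _ hy
      have : ω ∉ (fun ω => Pr.history σ c ω n) ⁻¹' {y} := fun h => hy h.symm
      simp [e, Set.indicator_of_notMem this]
    · intro hn
      exact absurd (hs.1.mem_toFinset.2 ⟨ω, rfl⟩) hn
  have hem : ∀ y, Measurable[sigmaOf P Tx Hash Rnd {k | k.2.2 < c.time + n}] (e y) := fun y =>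
    Measurable.indicator measurable_const (hs.2 y)
  have hem' : ∀ y, Measurable (e y) := fun y => (hem y).mono (sigmaOf_le _) le_rfl
  have hstep : ∀ y, SimpleFor (sigmaOf P Tx Hash Rnd {k | k.2.2 = (y.headD c).time})
      fun ω => Pr.step ω (σ y) (y.headD c) := fun y => simpleFor_step _ _
  have hg : ∀ y, Measurable fun ω => Ψ (Pr.step ω (σ y) (y.headD c) :: y) := fun y =>
    ((hstep y).mono (sigmaOf_le _)).measurable fun x => Ψ (x :: y)
  calc ∫⁻ ω, Ψ (Pr.history σ c ω (n + 1)) ∂Pr.randomness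
      = ∫⁻ ω, ∑ y ∈ R, e y ω * Ψ (Pr.step ω (σ y) (y.headD c) :: y) ∂Pr.randomness := by
        refine lintegral_congr fun ω => ?_
        exact hsum (fun y ω => Ψ (Pr.step ω (σ y) (y.headD c) :: y)) ω
    _ = ∑ y ∈ R, ∫⁻ ω, e y ω * Ψ (Pr.step ω (σ y) (y.headD c) :: y) ∂Pr.randomness :=
        lintegral_finsetSum _ fun y _ => (hem' y).mul (hg y)
    _ ≤ ∑ y ∈ R, ∫⁻ ω, e y ω * (ρ * Ψ y) ∂Pr.randomness := by
        refine Finset.sum_le_sum fun y hy => ?_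
        obtain ⟨ω₀, rfl⟩ := hs.1.mem_toFinset.1 hy
        -- The indicator depends on earlier slots and the next step on the current slot alone, so
        -- the integral of the product splits. Only values `y` that are attained occur, as the
        -- hypothesis `h` requires.
        have ht : ((Pr.history σ c ω₀ n).headD c).time = c.time + n := exec_time σ c ω₀ n
        rw [lintegral_mul_eq_lintegral_mul_lintegral_of_independent_measurableSpace
          (sigmaOf_le _) (sigmaOf_le _) (indep_sigmaOf ?_) (hem _)
          ((hstep (Pr.history σ c ω₀ n)).measurable fun x => Ψ (x :: Pr.history σ c ω₀ n)),
          lintegral_mul_const _ (hem' _)]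
        · gcongr
          exact h ω₀
        · rw [Set.disjoint_left]
          intro k hk hk'
          simp only [Set.mem_ofPred_eq] at hk hk'
          omega
    _ = ∫⁻ ω, ρ * Ψ (Pr.history σ c ω n) ∂Pr.randomness := by
        rw [← lintegral_finsetSum _ fun y _ => (hem' y).mul_const _]
        refine lintegral_congr fun ω => ?_
        exact (hsum (fun y _ => ρ * Ψ y) ω).symm
    _ = ρ * ∫⁻ ω, Ψ (Pr.history σ c ω n) ∂Pr.randomness :=
        lintegral_const_mul _ (hs'.measurable Ψ)

end Params

end Probability

/-! ### The drift of the private chain against the public chain. -/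

noncomputable section Drift

set_option linter.unusedSectionVars false

variable {P Tx Hash Rnd : Type*} [DecidableEq P] [MeasurableSpace Rnd]
  {Pr : Params P Tx Hash Rnd}

namespace Plan

open Params

variable {d : Plan P Tx Hash} {s : PlanState P Tx Hash} {c : Config P Tx Hash}

/-- The processes in `M` hold the majority before the fork, and keep it on the private chain. -/
structure Majority (d : Plan P Tx Hash) (Pr : Params P Tx Hash Rnd) (M : Finset P) : Prop where
  le : Pr.RA ≤ Pr.R
  subset : M ⊆ d.A
  before : Pr.R < (∑ p ∈ M, Pr.stateAlloc p (upTo d.base d.fork)) + Pr.RA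
  after : Pr.R < (∑ p ∈ M, Pr.ledger (txsOf (upTo d.base d.fork) ++ d.l) p) + Pr.RA
  q_zero : Pr.stateAlloc d.q (upTo d.base d.fork) = 0

theorem view_prefix (C : Chain P Tx Hash) (t : ℕ) : Pr.view C t <+: C :=
  List.takeWhile_prefix _

theorem prefix_view {C D : Chain P Tx Hash} {t : ℕ} (hD : D <+: C)
    (h : ∀ B ∈ D, ∀ x ∈ B.proof, x.2 ≤ Pr.cutoff t) : D <+: Pr.view C t := by
  obtain ⟨E, rfl⟩ := hD
  unfold view
  rw [List.takeWhile_append_of_pos (by simpa using h)]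
  exact List.prefix_append _ _

theorem sum_le_R (K : Finset P) (l : List Tx) : ∑ p ∈ K, Pr.ledger l p ≤ Pr.R := by
  rw [← Pr.ledger_total l, Finsupp.sum]
  calc ∑ p ∈ K, Pr.ledger l p
      = ∑ p ∈ K.filter (fun p => Pr.ledger l p ≠ 0), Pr.ledger l p :=
        (Finset.sum_filter_ne_zero K).symm
    _ ≤ _ := by
        refine Finset.sum_le_sum_of_subset fun p hp => ?_
        exact Finsupp.mem_support_iff.2 (Finset.mem_filter.1 hp).2

/-- In the slots considered, the allocator sees the whole old chain. -/
theorem OK.old_le_cutoff (hd : d.OK Pr) {t : ℕ} (ht : d.T ≤ t) {D : Chain P Tx Hash}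
    (hD : D <+: d.base) : ∀ B ∈ D, ∀ x ∈ B.proof, x.2 ≤ Pr.cutoff t := fun B hB x hx =>
  (hd.base_facts.2 B (hD.subset hB) x hx).le.trans (hd.cutoff t ht)

/-- From slot `T` on, the part of the public chain that the allocator sees contains `base` and
extends it by pending transactions only, so the budget hypothesis covers it. -/
theorem Ready.sum_view_pub (hd : d.OK Pr) (h : d.Ready Pr s c) {t : ℕ} (ht : d.T ≤ t) :
    ∑ p ∈ d.A, Pr.ledger (txsOf (Pr.view s.pub t)) p = Pr.RA :=
  hd.budget _ (ExtensionBy.of_prefix h.ext (view_prefix _ _)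
    (prefix_view h.base_prefix (hd.old_le_cutoff ht List.prefix_rfl)))

/-- All private blocks but the first are empty, so it matters only whether the allocator sees the
first one yet. In both cases `M` keeps its majority. -/
theorem PrivOK.txs_view (hd : d.OK Pr) {C : Chain P Tx Hash} (h : d.PrivOK Pr c C) {t : ℕ}
    (ht : d.T ≤ t) : txsOf (Pr.view C t) = txsOf (upTo d.base d.fork) ∨
      txsOf (Pr.view C t) = txsOf (upTo d.base d.fork) ++ d.l := by
  have h₁ : upTo d.base d.fork <+: Pr.view C t :=
    prefix_view h.fork_prefix (hd.old_le_cutoff ht (upTo_prefix _ _))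
  have h₂ : Pr.view C t <+: C := view_prefix C t
  obtain ⟨F, hF⟩ := h₁
  rw [← hF] at h₂ ⊢
  rw [txsOf_append]
  rcases h.shape with hs | ⟨B, E, hs, hB, hE⟩
  · have : F = [] := by
      have := h₂.length_le
      rw [hs, List.length_append] at this
      exact List.length_eq_zero_iff.1 (by omega)
    simp [this, txsOf]
  · rw [hs, List.prefix_append_right_inj] at h₂
    cases F with
    | nil => simp [txsOf]
    | cons B' F =>
      obtain ⟨rfl, h₃⟩ := List.cons_prefix_cons.1 h₂
      right
      have : txsOf F = [] := by
        simp only [txsOf, List.flatMap_eq_nil_iff]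
        exact fun B' hB' => hE B' (h₃.subset hB')
      rw [show txsOf (B' :: F) = B'.txs ++ txsOf F from rfl, this, hB, List.append_nil]

theorem Majority.sum_view (hd : d.OK Pr) {M : Finset P} (hM : d.Majority Pr M)
    {C : Chain P Tx Hash} (h : d.PrivOK Pr c C) {t : ℕ} (ht : d.T ≤ t) :
    Pr.R - Pr.RA + 1 ≤ ∑ p ∈ M, Pr.ledger (txsOf (Pr.view C t)) p := by
  have h₁ := hM.before
  have h₂ := hM.after
  have h₃ := hM.le
  unfold stateAlloc at h₁
  rcases h.txs_view hd ht with h' | h' <;> rw [h'] <;> omega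

/-- The private chain and the block with which the adversary extends it. -/
theorem linked_target {C : Chain P Tx Hash} (hC : C ≠ []) (l : List Tx) (x : Option (P × ℕ))
    (y : Option P) : Pr.Linked C ⟨C.getLast?.map Pr.H, l, x, y⟩ :=
  ⟨C.getLast hC, List.getLast?_eq_some_getLast hC, by simp [List.getLast?_eq_some_getLast hC]⟩

theorem wins_of_mem_A (h : d.Ready Pr s c) {p : P} (hp : p ∈ d.A) {ω : Key P Tx Hash → Rnd}
    (hel : p ∈ Pr.F (Pr.ledger (txsOf (Pr.view (d.target Pr s).1 c.time))) c.time
      (ω (p, Pr.view (d.target Pr s).1 c.time, c.time))) :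
    Pr.Wins ω (d.action Pr s c) c p (d.target Pr s) := by
  have hbyz := mid_byz (s := s) h.toBaseInv
  refine ⟨?_, ?_, ?_, hel⟩
  · unfold commitOf
    rw [if_neg fun h' => (Finset.mem_sdiff.1 h').2 (hbyz ▸ hp), if_pos (hbyz ▸ hp)]
    exact if_pos hp
  · have hle := mid_le (Pr := Pr) (d.action Pr s c) c
    unfold target
    split_ifs
    · exact h.pubValid.mono hle
    · exact h.priv.valid.mono hle
  · unfold target
    split_ifs
    · exact linked_target h.pubValid.ne_nil _ _ _
    · exact linked_target h.priv.valid.ne_nil _ _ _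

theorem length_priv_of_elected (h : d.Ready Pr s c) (hN : d.N ≤ s.pub.length) {p : P}
    (hp : p ∈ d.A) {ω : Key P Tx Hash → Rnd}
    (hel : p ∈ Pr.F (Pr.ledger (txsOf (Pr.view s.priv c.time))) c.time
      (ω (p, Pr.view s.priv c.time, c.time))) :
    (d.nextPriv Pr s (Pr.step ω (d.action Pr s c) c)).length = s.priv.length + 1 := by
  have ht : d.target Pr s = (s.priv, ⟨s.priv.getLast?.map Pr.H, d.privTxs s.priv, none, none⟩) :=
    if_neg (not_lt.2 hN)
  have hw := wins_of_mem_A h hp (ω := ω) (by rw [ht]; exact hel)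
  rw [ht] at hw
  rcases nextPriv_cases (Pr := Pr) (d := d) s (Pr.step ω (d.action Pr s c) c) with
    ⟨-, h'⟩ | ⟨_, -, h'⟩
  · refine absurd ⟨hN, Nat.lt_succ_of_le h.time, hp, ?_⟩ (h' p)
    exact (mem_step_assigned _).2 (Or.inr ⟨_, hw, rfl⟩)
  · rw [h']
    simp

theorem length_pub_of_elected (h : d.Ready Pr s c) (hN : s.pub.length < d.N) {p : P}
    (hp : p ∈ d.A) {ω : Key P Tx Hash → Rnd}
    (hel : p ∈ Pr.F (Pr.ledger (txsOf (Pr.view s.pub c.time))) c.time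
      (ω (p, Pr.view s.pub c.time, c.time))) :
    (d.nextPub Pr s (Pr.step ω (d.action Pr s c) c)).length = s.pub.length + 1 := by
  have ht : d.target Pr s = (s.pub, ⟨s.pub.getLast?.map Pr.H, [], none, none⟩) := if_pos hN
  have hw := wins_of_mem_A h hp (ω := ω) (by rw [ht]; exact hel)
  rw [ht] at hw
  rcases nextPub_cases (Pr := Pr) (d := d) s (Pr.step ω (d.action Pr s c) c) with
    ⟨-, h'⟩ | ⟨_, -, h'⟩
  · refine absurd ⟨?_, Or.inr ⟨hN, rfl⟩⟩
      (h' (mined c.time p ⟨s.pub.getLast?.map Pr.H, [], none, none⟩))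
    refine .snoc _ _ (h.pubValid.mono (le_step ω _ c)) (linked_target h.pubValid.ne_nil _ _ _)
      (Pr.validTx_nil _) ⟨p, c.time, rfl, rfl, Or.inl ?_⟩ ⟨p, c.time, rfl, ?_, ?_⟩
    · have hbyz := mid_byz (s := s) h.toBaseInv
      exact hbyz ▸ hp
    · exact (mem_step_assigned _).2 (Or.inr ⟨_, hw, rfl⟩)
    · exact fun A hA x hx =>
        h.pubValid.slot_lt h.reach.globOK.slot A (List.mem_of_getLast? hA) x hx
  · rw [h']
    simp

/-- The processes that take part in the public chain. -/
def honest (d : Plan P Tx Hash) (c : Config P Tx Hash) : Finset P :=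
  (c.active \ d.A).erase d.q

/-- The public chain grows only if an honest process was elected. -/
theorem exists_elected (hd : d.OK Pr) (h : d.Ready Pr s c) (hN : d.N ≤ s.pub.length)
    (hS : s.rel → d.S = ∅) {ω : Key P Tx Hash → Rnd}
    (hq : ∀ st, ¬ Pr.Wins ω (d.action Pr s c) c d.q st)
    (hgrow : d.nextPub Pr s (Pr.step ω (d.action Pr s c) c) ≠ s.pub) :
    ∃ p ∈ d.honest c, p ∈ Pr.F (Pr.ledger (txsOf (Pr.view s.pub c.time))) c.time
      (ω (p, Pr.view s.pub c.time, c.time)) := by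
  rcases nextPub_cases (Pr := Pr) (d := d) s (Pr.step ω (d.action Pr s c) c) with
    ⟨h', -⟩ | ⟨B, ⟨hv, hB⟩, -⟩
  · exact absurd h' hgrow
  rcases hB with ⟨hB, i, hi, hs⟩ | ⟨hB, -⟩
  swap
  · exact absurd hB (not_lt.2 hN)
  rcases (mem_step_signed B).1 hB with hB | ⟨p, st, hp, hw, rfl⟩
  -- A block signed before this step cannot sit on top of the public chain by `no_next`, so the
  -- signature is new and its maker was elected now.
  · obtain ⟨D, hD, -⟩ := (h.reach.globOK.signed B hB i hs).2 fun hb => hi (h.byz hb)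
    have := hD.unique hv (by simp)
    rw [this] at hD
    exact absurd hD (h.no_next B hB i hi hs)
  · have hpq : p ≠ d.q := by
      rintro rfl
      exact hq st hw
    have hpa := mem_active_of_ne h.toBaseInv hpq hp
    refine ⟨p, Finset.mem_erase.2 ⟨hpq, hpa⟩, ?_⟩
    have hch := (h.reach.globOK.wins_spec hp hw).1
    have hpS : ¬ (s.rel ∧ p ∈ insert d.q d.S) := by
      rintro ⟨hr, hm⟩
      rw [hS hr] at hm
      simp [hpq] at hm
    rw [(h.result_honest hd hpa hpq hpS).2.1] at hch
    have := hw.2.2.2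
    rw [hch] at this
    exact this

/-- Almost surely, the process that knows the private chain is not elected. -/
theorem ae_not_wins (hd : d.OK Pr) {M : Finset P} (hM : d.Majority Pr M) (h : d.Ready Pr s c)
    (ht : d.T ≤ c.time) (hrel : s.rel → d.l = [] ∧ s.pub.length ≤ s.priv.length) :
    ∀ᵐ ω ∂Pr.randomness, ∀ st, ¬ Pr.Wins ω (d.action Pr s c) c d.q st := by
  have hqA : d.q ∉ d.A := fun hq => hd.q_notMem (hd.active hq)
  by_cases hr : s.rel
  -- `q` was chosen without resource at the fork, and with `l` empty the private chain never gives
  -- it any.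
  · have hz : Pr.ledger (txsOf (Pr.view s.priv c.time)) d.q = 0 := by
      have := hM.q_zero
      unfold stateAlloc at this
      rcases h.priv.txs_view hd ht with h' | h' <;> rw [h']
      · exact this
      · rw [(hrel hr).1, List.append_nil]
        exact this
    have hμ := randomness_not_elected (Pr := Pr) {d.q} (Pr.view s.priv c.time) c.time
      (Pr.ledger (txsOf (Pr.view s.priv c.time)))
    simp only [Finset.mem_singleton, forall_eq, Finset.sum_singleton, hz, pow_zero,
      ENNReal.ofReal_one] at hμ
    have hms : MeasurableSet {ω : Key P Tx Hash → Rnd |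
        d.q ∉ Pr.F (Pr.ledger (txsOf (Pr.view s.priv c.time))) c.time
          (ω (d.q, Pr.view s.priv c.time, c.time))} :=
      (measurable_pi_apply (d.q, Pr.view s.priv c.time, c.time) :
        Measurable fun ω : Key P Tx Hash → Rnd => ω (d.q, Pr.view s.priv c.time, c.time))
        (Pr.F_measurable (Pr.ledger (txsOf (Pr.view s.priv c.time))) c.time d.q).compl
    have hae := (mem_ae_iff_prob_eq_one hms).2 hμ
    filter_upwards [hae] with ω hω st hw
    have hqc := (mem_correct (s := s) h.toBaseInv d.q).2 ⟨Or.inr ⟨hr, rfl⟩, hqA⟩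
    have hch := (h.reach.globOK.wins_spec hqc hw).1
    rw [(h.result_q hd hqA hr (hrel hr).2).2.1] at hch
    have := hw.2.2.2
    rw [hch] at this
    exact hω this
  · refine Eventually.of_forall fun ω st hw => ?_
    have hn : d.q ∉ (Pr.mid (d.action Pr s c) c).active := by
      rw [mem_mid_active]
      rintro (h' | h')
      · exact hr (h.q_active h')
      · exact hr h'.1
    have hb : d.q ∉ (Pr.mid (d.action Pr s c) c).byz := by
      rw [mid_byz h.toBaseInv]
      exact hqA
    have := hw.1
    rw [commitOf_eq_none fun h' => (Finset.mem_union.1 h').elim hn hb] at this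
    cases this

/-! ### The potential -/

/-- The potential that decreases on average. -/
def potential (d : Plan P Tx Hash) (x : ℝ) (s : PlanState P Tx Hash) : ℝ :=
  x ^ s.priv.length * x⁻¹ ^ max s.pub.length (2 * d.N - s.pub.length)

theorem potential_nonneg {x : ℝ} (hx : 0 < x) (s : PlanState P Tx Hash) :
    0 ≤ d.potential x s := by
  unfold potential
  positivity

/-- The factor by which the potential changes. -/
def factor {Ω : Type*} (x : ℝ) (NA NB : Set Ω) (ω : Ω) : ENNReal :=
  ENNReal.ofReal x + NA.indicator (fun _ => ENNReal.ofReal (1 - x)) ω +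
    NBᶜ.indicator (fun _ => ENNReal.ofReal (x⁻¹ - 1)) ω

/-- A bound that is additive in the two events, so their joint distribution is never needed. The
only slack is in the cases where the indicators overshoot; when both chains grow it comes down to `x
+ x⁻¹ ≥ 2`. -/
theorem le_factor {Ω : Type*} {x : ℝ} (hx : 0 < x) (hx' : x < 1) {NA NB : Set Ω} {ω : Ω}
    {i j : ℕ} (hi : i ≤ 1) (hj : j ≤ 1) (hA : ω ∉ NA → i = 1) (hB : ω ∈ NB → j = 0) :
    ENNReal.ofReal (x ^ i * x⁻¹ ^ j) ≤ factor x NA NB ω := by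
  have h₁ : 0 ≤ x⁻¹ - 1 := sub_nonneg.2 (one_le_inv_iff₀.2 ⟨hx, hx'.le⟩)
  have h₂ : x * x⁻¹ = 1 := mul_inv_cancel₀ hx.ne'
  have h₃ : 2 ≤ x + x⁻¹ := by nlinarith [sq_nonneg (x - 1), inv_pos.2 hx]
  unfold factor
  interval_cases i <;> interval_cases j
  · have hA' : ω ∈ NA := by by_contra h; simpa using hA h
    rw [Set.indicator_of_mem hA', ← ENNReal.ofReal_add hx.le (by linarith)]
    refine le_trans (ENNReal.ofReal_le_ofReal ?_) le_self_add
    simp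
  · have hA' : ω ∈ NA := by by_contra h; simpa using hA h
    have hB' : ω ∈ NBᶜ := fun h => by simpa using hB h
    rw [Set.indicator_of_mem hA', Set.indicator_of_mem hB', ← ENNReal.ofReal_add hx.le
      (by linarith), ← ENNReal.ofReal_add (by linarith) h₁]
    refine ENNReal.ofReal_le_ofReal ?_
    simp
  · refine le_trans (ENNReal.ofReal_le_ofReal ?_) (le_self_add.trans le_self_add)
    simp
  · have hB' : ω ∈ NBᶜ := fun h => by simpa using hB h
    rw [Set.indicator_of_mem hB', add_right_comm, ← ENNReal.ofReal_add hx.le h₁]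
    refine le_trans (ENNReal.ofReal_le_ofReal ?_) le_self_add
    simp only [pow_one, h₂]
    linarith

theorem lintegral_factor_le {Ω : Type*} [MeasurableSpace Ω] {μ : Measure Ω}
    [IsProbabilityMeasure μ] {x : ℝ} (hx : 0 < x) (hx' : x < 1) {NA NB : Set Ω}
    (hNA : MeasurableSet NA) (hNB : MeasurableSet NB) {a b : ℝ} (ha : 0 ≤ a) (hb : b ≤ 1)
    (hμa : μ NA ≤ ENNReal.ofReal a) (hb0 : 0 ≤ b) (hμb : ENNReal.ofReal b ≤ μ NB) :
    ∫⁻ ω, factor x NA NB ω ∂μ ≤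
      ENNReal.ofReal (x + (1 - x) * a + (x⁻¹ - 1) * (1 - b)) := by
  have h₁ : 0 ≤ x⁻¹ - 1 := sub_nonneg.2 (one_le_inv_iff₀.2 ⟨hx, hx'.le⟩)
  have hm : Measurable fun ω => ENNReal.ofReal x +
      NA.indicator (fun _ => ENNReal.ofReal (1 - x)) ω :=
    (measurable_const.indicator hNA : Measurable (NA.indicator
      fun _ => ENNReal.ofReal (1 - x))).const_add _
  unfold factor
  rw [lintegral_add_left hm,
    lintegral_add_left measurable_const, lintegral_indicator_const hNA,
    lintegral_indicator_const hNB.compl, lintegral_const, measure_univ, mul_one,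
    prob_compl_eq_one_sub hNB,
    ENNReal.ofReal_add (add_nonneg hx.le (mul_nonneg (by linarith) ha))
      (mul_nonneg h₁ (by linarith)),
    ENNReal.ofReal_add hx.le (mul_nonneg (by linarith) ha), ENNReal.ofReal_mul (by linarith),
    ENNReal.ofReal_mul h₁, ENNReal.ofReal_sub _ hb0, ENNReal.ofReal_one]
  gcongr

theorem measurableSet_not_elected (K : Finset P) (v : Chain P Tx Hash) (t : ℕ) (S : P →₀ ℕ) :
    MeasurableSet {ω : Key P Tx Hash → Rnd | ∀ p ∈ K, p ∉ Pr.F S t (ω (p, v, t))} := by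
  have : {ω : Key P Tx Hash → Rnd | ∀ p ∈ K, p ∉ Pr.F S t (ω (p, v, t))} =
      ⋂ p ∈ K, {ω | p ∉ Pr.F S t (ω (p, v, t))} := by
    ext ω
    simp
  rw [this]
  exact Finset.measurableSet_biInter _ fun p _ =>
    (measurable_pi_apply (p, v, t) :
      Measurable fun ω : Key P Tx Hash → Rnd => ω (p, v, t)) (Pr.F_measurable S t p).compl

/-- A rate at which the potential decreases. -/
def Rate (Pr : Params P Tx Hash Rnd) (x ρ : ℝ) : Prop :=
  0 < x ∧ x < 1 ∧ 0 < ρ ∧ ρ < 1 ∧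
    x + (1 - x) * (1 - Pr.rate) ^ (Pr.R - Pr.RA + 1) +
      (x⁻¹ - 1) * (1 - (1 - Pr.rate) ^ (Pr.R - Pr.RA)) ≤ ρ ∧
    x + (1 - x) * (1 - Pr.rate) ^ Pr.RA ≤ ρ

/-- One unit of resource more gives the private chain a strict advantage in the exponent, which
leaves room for an `x` below `1`; positivity of `R_A` serves the phase in which `A` alone drives the
public chain. -/
theorem exists_rate (hRA : 0 < Pr.RA) : ∃ x ρ, Rate Pr x ρ := by
  have hr := Pr.rate_pos
  have hr' := Pr.rate_lt_one
  set z := (1 - Pr.rate) ^ (Pr.R - Pr.RA) with hz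
  set w := (1 - Pr.rate) ^ Pr.RA with hw
  have hz0 : 0 < z := pow_pos (by linarith) _
  have hz1 : z ≤ 1 := pow_le_one₀ (by linarith) (by linarith)
  have hw0 : 0 < w := pow_pos (by linarith) _
  have hw1 : w < 1 := pow_lt_one₀ (by linarith) (by linarith) hRA.ne'
  have hzs : (1 - Pr.rate) ^ (Pr.R - Pr.RA + 1) = z * (1 - Pr.rate) := pow_succ _ _
  -- After division by `1 - x`, the first drift condition with `1` in place of `ρ` reads `(1 - z) /
  -- x < 1 - z * (1 - rate)`, that is, `y < x`.
  set y := (1 - z) / (1 - z * (1 - Pr.rate)) with hy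
  have hden : 0 < 1 - z * (1 - Pr.rate) := by nlinarith
  have hy0 : 0 ≤ y := div_nonneg (by linarith) hden.le
  have hy1 : y < 1 := by
    rw [hy, div_lt_one hden]
    nlinarith
  obtain ⟨x, hx₁, hx₂⟩ := exists_between hy1
  have hx0 : 0 < x := hy0.trans_lt hx₁
  have h₁ : (1 - z) * x⁻¹ < 1 - z * (1 - Pr.rate) := by
    rw [hy, div_lt_iff₀ hden] at hx₁
    rw [← div_eq_mul_inv, div_lt_iff₀ hx0]
    linarith
  have h₂ : x + (1 - x) * (z * (1 - Pr.rate)) + (x⁻¹ - 1) * (1 - z) < 1 := by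
    have h₃ : x⁻¹ - 1 = (1 - x) * x⁻¹ := by
      rw [sub_mul, mul_inv_cancel₀ hx0.ne', one_mul]
    rw [h₃]
    nlinarith
  have h₃ : x + (1 - x) * w < 1 := by nlinarith
  refine ⟨x, max (x + (1 - x) * (z * (1 - Pr.rate)) + (x⁻¹ - 1) * (1 - z)) (x + (1 - x) * w),
    hx0, hx₂, ?_, max_lt h₂ h₃, ?_, le_max_right _ _⟩
  · refine lt_max_of_lt_right ?_
    nlinarith
  · rw [hzs]
    exact le_max_left _ _

/-- The potential decreases on average in each time step. -/
theorem lintegral_potential_le (hd : d.OK Pr) {M : Finset P} (hM : d.Majority Pr M) {x ρ : ℝ}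
    (hx : Rate Pr x ρ) (h : d.Ready Pr s c) (ht : d.T ≤ c.time)
    (hrel : s.rel → d.S = ∅ ∧ d.l = [] ∧ s.pub.length ≤ s.priv.length) :
    ∫⁻ ω, ENNReal.ofReal (d.potential x (d.update Pr s (Pr.step ω (d.action Pr s c) c)))
      ∂Pr.randomness ≤ ENNReal.ofReal ρ * ENNReal.ofReal (d.potential x s) := by
  obtain ⟨hx0, hx1, hρ0, hρ1, hρa, hρb⟩ := hx
  have hr := Pr.rate_pos
  have hr' := Pr.rate_lt_one
  have hφ := potential_nonneg (d := d) hx0 s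
  have key : ∀ NA NB : Set (Key P Tx Hash → Rnd),
      (∀ᵐ ω ∂Pr.randomness, ∃ i j : ℕ, i ≤ 1 ∧ j ≤ 1 ∧ (ω ∉ NA → i = 1) ∧ (ω ∈ NB → j = 0) ∧
        d.potential x (d.update Pr s (Pr.step ω (d.action Pr s c) c)) =
          d.potential x s * (x ^ i * x⁻¹ ^ j)) →
      ∫⁻ ω, ENNReal.ofReal (d.potential x (d.update Pr s (Pr.step ω (d.action Pr s c) c)))
        ∂Pr.randomness ≤ ENNReal.ofReal (d.potential x s) *
          ∫⁻ ω, factor x NA NB ω ∂Pr.randomness := by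
    intro NA NB hae
    rw [← lintegral_const_mul' _ _ ENNReal.ofReal_ne_top]
    refine lintegral_mono_ae ?_
    filter_upwards [hae] with ω hω
    obtain ⟨i, j, hi, hj, hA, hB, he⟩ := hω
    rw [he, ENNReal.ofReal_mul hφ]
    gcongr
    exact le_factor hx0 hx1 hi hj hA hB
  rw [mul_comm]
  by_cases hN : d.N ≤ s.pub.length
  · let NA : Set (Key P Tx Hash → Rnd) := {ω | ∀ p ∈ M,
      p ∉ Pr.F (Pr.ledger (txsOf (Pr.view s.priv c.time))) c.time
        (ω (p, Pr.view s.priv c.time, c.time))}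
    let NB : Set (Key P Tx Hash → Rnd) := {ω | ∀ p ∈ d.honest c,
      p ∉ Pr.F (Pr.ledger (txsOf (Pr.view s.pub c.time))) c.time
        (ω (p, Pr.view s.pub c.time, c.time))}
    refine (key NA NB ?_).trans ?_
    · filter_upwards [ae_not_wins hd hM h ht fun h' => (hrel h').2] with ω hω
      set c' := Pr.step ω (d.action Pr s c) c with hc'
      have h₁ := length_update_priv_le (Pr := Pr) (d := d) s c'
      have h₂ := length_update_pub_le (Pr := Pr) (d := d) s c'
      have h₃ : s.priv.length ≤ (d.update Pr s c').priv.length :=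
        (prefix_nextPriv (Pr := Pr) (d := d) s c').length_le
      have h₄ : s.pub.length ≤ (d.update Pr s c').pub.length :=
        (prefix_nextPub (Pr := Pr) (d := d) s c').length_le
      obtain ⟨i, hi⟩ := Nat.exists_eq_add_of_le h₃
      obtain ⟨j, hj⟩ := Nat.exists_eq_add_of_le h₄
      refine ⟨i, j, by omega, by omega, ?_, ?_, ?_⟩
      · intro hA
        simp only [NA, Set.mem_ofPred_eq, not_forall, not_not] at hA
        obtain ⟨p, hp, hel⟩ := hA
        have := length_priv_of_elected h hN (hM.subset hp) hel
        change (d.update Pr s c').priv.length = _ at this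
        omega
      · intro hB
        by_contra hj0
        obtain ⟨p, hp, hel⟩ := exists_elected hd h hN (fun h' => (hrel h').1) hω (by
          intro he
          have : (d.update Pr s c').pub.length = s.pub.length := congrArg List.length he
          omega)
        exact hB p hp hel
      · unfold potential
        rw [hi, hj, max_eq_left (by omega), max_eq_left (by omega), pow_add, pow_add]
        ring
    · gcongr
      refine (lintegral_factor_le hx0 hx1 (measurableSet_not_elected _ _ _ _)
        (measurableSet_not_elected _ _ _ _) (a := (1 - Pr.rate) ^ (Pr.R - Pr.RA + 1))
        (b := (1 - Pr.rate) ^ (Pr.R - Pr.RA)) (pow_nonneg (by linarith) _)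
        (pow_le_one₀ (by linarith) (by linarith)) ?_ (pow_nonneg (by linarith) _) ?_).trans
        (ENNReal.ofReal_le_ofReal hρa)
      · rw [randomness_not_elected]
        refine ENNReal.ofReal_le_ofReal (pow_le_pow_of_le_one (by linarith) (by linarith) ?_)
        exact hM.sum_view hd h.priv ht
      · rw [randomness_not_elected]
        refine ENNReal.ofReal_le_ofReal (pow_le_pow_of_le_one (by linarith) (by linarith) ?_)
        have hsum := h.sum_view_pub hd ht
        have hdis : Disjoint (d.honest c) d.A := by
          rw [Finset.disjoint_left]
          intro p hp hpA
          exact (Finset.mem_sdiff.1 (Finset.mem_of_mem_erase hp)).2 hpA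
        -- Only an upper bound for the honest share is available, as others may hold resource
        -- without having joined; it is also the direction needed.
        have htot := sum_le_R (Pr := Pr) (d.honest c ∪ d.A) (txsOf (Pr.view s.pub c.time))
        rw [Finset.sum_union hdis, hsum] at htot
        omega
  · let NA : Set (Key P Tx Hash → Rnd) := {ω | ∀ p ∈ d.A,
      p ∉ Pr.F (Pr.ledger (txsOf (Pr.view s.pub c.time))) c.time
        (ω (p, Pr.view s.pub c.time, c.time))}
    push Not at hN
    refine (key NA Set.univ ?_).trans ?_
    · refine Eventually.of_forall fun ω => ?_
      set c' := Pr.step ω (d.action Pr s c) c with hc'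
      have h₂ := length_update_pub_le (Pr := Pr) (d := d) s c'
      have h₃ : (d.update Pr s c').priv = s.priv := by
        rcases nextPriv_cases (Pr := Pr) (d := d) s c' with ⟨h', -⟩ | ⟨p, hp, -⟩
        · exact h'
        · exact absurd hp.1 (not_le.2 hN)
      have h₄ : s.pub.length ≤ (d.update Pr s c').pub.length :=
        (prefix_nextPub (Pr := Pr) (d := d) s c').length_le
      obtain ⟨i, hi⟩ := Nat.exists_eq_add_of_le h₄
      refine ⟨i, 0, by omega, by omega, ?_, fun _ => rfl, ?_⟩
      · intro hA
        simp only [NA, Set.mem_ofPred_eq, not_forall, not_not] at hA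
        obtain ⟨p, hp, hel⟩ := hA
        have := length_pub_of_elected h hN hp hel
        change (d.update Pr s c').pub.length = _ at this
        omega
      · unfold potential
        -- Up to length `N` the second entry of the maximum is the larger one. Each new public block
        -- lowers it by one, so here public growth makes the potential smaller.
        rw [hi, h₃, max_eq_right (by omega), max_eq_right (by omega), pow_zero, mul_one]
        have : 2 * d.N - s.pub.length = (2 * d.N - (s.pub.length + i)) + i := by omega
        rw [this, pow_add x⁻¹, mul_assoc, mul_assoc, ← mul_pow, inv_mul_cancel₀ hx0.ne', one_pow,
          mul_one]
    · gcongr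
      refine (lintegral_factor_le hx0 hx1 (measurableSet_not_elected _ _ _ _)
        MeasurableSet.univ (a := (1 - Pr.rate) ^ Pr.RA) (b := 1) (pow_nonneg (by linarith) _)
        le_rfl ?_ zero_le_one ?_).trans ?_
      · rw [randomness_not_elected, h.sum_view_pub hd ht]
      · simp
      · refine ENNReal.ofReal_le_ofReal ?_
        simpa using hρb

end Plan

end Drift

/-! ### Almost sure release, persistence of the lead, and the violated properties. -/

noncomputable section Release

set_option linter.unusedSectionVars false

variable {P Tx Hash Rnd : Type*} [DecidableEq P] [MeasurableSpace Rnd]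
  {Pr : Params P Tx Hash Rnd}

namespace Plan

open Params

variable {d : Plan P Tx Hash} {s : PlanState P Tx Hash} {c : Config P Tx Hash}
  {ω : Key P Tx Hash → Rnd}

theorem rel_mono {n n' : ℕ} (h : n ≤ n') (hr : (d.stateOf Pr (d.hist Pr ω n)).rel) :
    (d.stateOf Pr (d.hist Pr ω n')).rel := by
  induction n', h using Nat.le_induction with
  | base => exact hr
  | succ m _ ih => exact rel_update ih

theorem not_rel_tail {n : ℕ} (h : ¬ (d.stateOf Pr (d.hist Pr ω n)).rel) :
    ¬ (d.stateOf Pr (d.hist Pr ω n).tail).rel := by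
  rw [stateOf_hist] at h
  exact fun hr => h (rel_update hr)

/-- The adversary is ready until it has revealed the private chain. -/
theorem ready_run (hd : d.OK Pr) {n : ℕ} (h : ¬ (d.stateOf Pr (d.hist Pr ω n).tail).rel) :
    d.Ready Pr (d.stateOf Pr (d.hist Pr ω n)) (d.run Pr ω n) := by
  rw [stateOf_hist]
  exact (inv_of_not_rel hd n h).ready hd

/-- What holds at the moment when the private chain is revealed. -/
theorem release_spec {n : ℕ} (h : (d.stateOf Pr (d.hist Pr ω n)).rel)
    (h' : ¬ (d.stateOf Pr (d.hist Pr ω n).tail).rel) :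
    d.T ≤ (d.run Pr ω n).time ∧ d.N ≤ (d.stateOf Pr (d.hist Pr ω n)).pub.length ∧
      (d.stateOf Pr (d.hist Pr ω n)).pub.length + d.L ≤
        (d.stateOf Pr (d.hist Pr ω n)).priv.length := by
  rw [stateOf_hist] at h ⊢
  exact h.resolve_left h'

/-- There is a first moment at which the private chain is revealed. -/
theorem exists_first_release (h : ∃ n, (d.stateOf Pr (d.hist Pr ω n)).rel) :
    ∃ n, (d.stateOf Pr (d.hist Pr ω n)).rel ∧
      ¬ (d.stateOf Pr (d.hist Pr ω n).tail).rel := by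
  classical
  refine ⟨Nat.find h, Nat.find_spec h, ?_⟩
  rcases hn : Nat.find h with _ | n
  · exact id
  · exact Nat.find_min h (m := n) (by omega)

theorem le_potential {x : ℝ} (hx : 0 < x) (hx' : x < 1) {m : ℕ}
    (h : s.priv.length ≤ max s.pub.length (2 * d.N - s.pub.length) + m) :
    x ^ m ≤ d.potential x s := by
  unfold potential
  rw [inv_pow, ← div_eq_mul_inv, le_div_iff₀ (pow_pos hx _), ← pow_add]
  exact pow_le_pow_of_le_one hx.le hx'.le (by omega)

theorem potential_le {x : ℝ} (hx : 0 < x) (hx' : x < 1) (hN : d.N ≤ s.pub.length)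
    (h : s.pub.length + d.L ≤ s.priv.length) : d.potential x s ≤ x ^ d.L := by
  unfold potential
  rw [max_eq_left (by omega), inv_pow, ← div_eq_mul_inv, div_le_iff₀ (pow_pos hx _), ← pow_add]
  exact pow_le_pow_of_le_one hx.le hx'.le (by omega)

theorem measurable_hist (Ψ : List (Config P Tx Hash) → ENNReal) (n : ℕ) :
    Measurable fun ω => Ψ (d.hist Pr ω n) :=
  ((simpleFor_history (d.strategy Pr) d.start n).mono (sigmaOf_le _)).measurable Ψ

open Classical in
/-- The potential, until the private chain is revealed. -/
def waiting (Pr : Params P Tx Hash Rnd) (d : Plan P Tx Hash) (x : ℝ)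
    (h : List (Config P Tx Hash)) : ENNReal :=
  if (d.stateOf Pr h).rel then 0 else ENNReal.ofReal (d.potential x (d.stateOf Pr h))

/-- At the release `waiting` drops to zero, which only helps; until then it is the potential and
inherits its drift. -/
theorem lintegral_waiting_succ_le (hd : d.OK Pr) {M : Finset P} (hM : d.Majority Pr M) {x ρ : ℝ}
    (hx : Rate Pr x ρ) {n : ℕ} (hn : d.T ≤ n) :
    ∫⁻ ω, waiting Pr d x (d.hist Pr ω (n + 1)) ∂Pr.randomness ≤
      ENNReal.ofReal ρ * ∫⁻ ω, waiting Pr d x (d.hist Pr ω n) ∂Pr.randomness := by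
  refine lintegral_history_succ_le _ _ (waiting Pr d x) _ n fun ω => ?_
  change ∫⁻ ω', waiting Pr d x (Pr.step ω' (d.action Pr (d.stateOf Pr (d.hist Pr ω n))
    (d.run Pr ω n)) (d.run Pr ω n) :: d.hist Pr ω n) ∂Pr.randomness ≤
      _ * waiting Pr d x (d.hist Pr ω n)
  by_cases hr : (d.stateOf Pr (d.hist Pr ω n)).rel
  · have : ∀ c', waiting Pr d x (c' :: d.hist Pr ω n) = 0 := fun c' => if_pos (rel_update hr)
    simp [this]
  · have ht : d.T ≤ (d.run Pr ω n).time := by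
      rw [exec_time]
      omega
    have := lintegral_potential_le hd hM hx (ready_run hd (not_rel_tail hr)) ht
      fun h => absurd h hr
    unfold waiting
    rw [if_neg hr]
    refine le_trans (lintegral_mono fun ω' => ?_) this
    dsimp only
    split_ifs
    · exact zero_le
    · exact le_rfl

theorem lintegral_waiting_lt_top {x : ℝ} (hx : 0 < x) (hx' : x < 1) (n : ℕ) :
    ∫⁻ ω, waiting Pr d x (d.hist Pr ω n) ∂Pr.randomness < ⊤ := by
  have hb : ∀ ω, waiting Pr d x (d.hist Pr ω n) ≤
      ENNReal.ofReal (x⁻¹ ^ (2 * d.N + (d.base.length + (n + 1)))) := by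
    intro ω
    unfold waiting
    split_ifs
    · exact zero_le
    refine ENNReal.ofReal_le_ofReal ?_
    have h₁ := (length_stateOf_le (Pr := Pr) (d := d) (d.hist Pr ω n)).1
    rw [length_hist] at h₁
    have h₂ : 1 ≤ x⁻¹ := one_le_inv_iff₀.2 ⟨hx, hx'.le⟩
    unfold potential
    calc _ ≤ 1 * x⁻¹ ^ max (d.stateOf Pr (d.hist Pr ω n)).pub.length
          (2 * d.N - (d.stateOf Pr (d.hist Pr ω n)).pub.length) := by
          gcongr
          exact pow_le_one₀ hx.le hx'.le
      _ ≤ _ := by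
          rw [one_mul]
          exact pow_le_pow_right₀ h₂ (by omega)
  refine (lintegral_mono hb).trans_lt ?_
  simp

/-- Almost surely, the private chain is revealed at some time. -/
theorem ae_release (hd : d.OK Pr) {M : Finset P} (hM : d.Majority Pr M) {x ρ : ℝ}
    (hx : Rate Pr x ρ) : ∀ᵐ ω ∂Pr.randomness, ∃ n, (d.stateOf Pr (d.hist Pr ω n)).rel := by
  have hx0 := hx.1
  have hx1 := hx.2.1
  let E : ℕ → ENNReal := fun n => ∫⁻ ω, waiting Pr d x (d.hist Pr ω n) ∂Pr.randomness
  -- A lower bound for the potential before the release that serves both phases: in the first the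
  -- private chain still has length `fork + 1`, in the second its lead is below `L`.
  let κ : ENNReal := ENNReal.ofReal (x ^ (d.fork + 1 + d.L))
  have hE : ∀ m, E (d.T + m) ≤ ENNReal.ofReal ρ ^ m * E d.T := by
    intro m
    induction m with
    | zero => simp
    | succ m ih =>
      rw [pow_succ', mul_assoc]
      refine (lintegral_waiting_succ_le (n := d.T + m) hd hM hx (by omega)).trans ?_
      exact mul_le_mul_right ih _
  have hκ : ∀ m, κ * Pr.randomness {ω | ∀ n, ¬ (d.stateOf Pr (d.hist Pr ω n)).rel} ≤
      ENNReal.ofReal ρ ^ m * E d.T := by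
    intro m
    refine le_trans ?_ (hE m)
    refine le_trans ?_ (mul_meas_ge_le_lintegral (measurable_hist (waiting Pr d x) _) κ)
    refine mul_le_mul_right (measure_mono fun ω hω => ?_) κ
    have hr := hω (d.T + m)
    have hready := ready_run hd (not_rel_tail hr)
    have ht : d.T ≤ (d.run Pr ω (d.T + m)).time := by
      rw [exec_time]
      omega
    change κ ≤ waiting Pr d x (d.hist Pr ω (d.T + m))
    unfold waiting
    rw [if_neg hr]
    refine ENNReal.ofReal_le_ofReal (le_potential hx0 hx1 ?_)
    by_cases hN : (d.stateOf Pr (d.hist Pr ω (d.T + m))).pub.length < d.N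
    · rw [hready.phase hN, length_upTo_fork hd]
      omega
    · rw [stateOf_hist] at hr hN ⊢
      have : ¬ (d.T ≤ (d.run Pr ω (d.T + m)).time ∧ _ ∧ _) := fun h => hr (Or.inr h)
      have h' := fun h₁ h₂ => this ⟨ht, h₁, h₂⟩
      have h'' := h' (not_lt.1 hN)
      have h₃ := not_le.1 h''
      change (d.nextPriv Pr _ _).length ≤ max (d.nextPub Pr _ _).length _ + _
      omega
  have hlim : Tendsto (fun m => ENNReal.ofReal ρ ^ m * E d.T) atTop (nhds (0 * E d.T)) := by
    refine ENNReal.Tendsto.mul_const (ENNReal.tendsto_pow_atTop_nhds_zero_of_lt_one ?_)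
      (Or.inr (lintegral_waiting_lt_top hx0 hx1 _).ne)
    rw [ENNReal.ofReal_lt_one]
    exact hx.2.2.2.1
  have h0 := ge_of_tendsto' hlim hκ
  rw [zero_mul, nonpos_iff_eq_zero, mul_eq_zero] at h0
  have hκ0 : κ ≠ 0 := (ENNReal.ofReal_pos.2 (pow_pos hx0 _)).ne'
  have h1 := h0.resolve_left hκ0
  rw [ae_iff]
  simpa using h1

/-! ### After the private chain was revealed -/

/-- So far, the private chain has not lost its lead since it was revealed. -/
def Good (Pr : Params P Tx Hash Rnd) (d : Plan P Tx Hash) : List (Config P Tx Hash) → Prop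
  | [] => True
  | c :: h => Good Pr d h ∧ ((d.stateOf Pr (c :: h)).rel → d.T ≤ c.time ∧
      d.Ready Pr (d.stateOf Pr (c :: h)) c ∧
      (d.stateOf Pr (c :: h)).pub.length ≤ (d.stateOf Pr (c :: h)).priv.length)

theorem good_of_not_rel (h : List (Config P Tx Hash)) (hr : ¬ (d.stateOf Pr h).rel) :
    Good Pr d h := by
  induction h with
  | nil => trivial
  | cons c h ih => exact ⟨ih fun hr' => hr (rel_update hr'), fun hr' => absurd hr' hr⟩

open Classical in
/-- A bound for the probability that the private chain loses its lead after it was revealed. -/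
def risk (Pr : Params P Tx Hash Rnd) (d : Plan P Tx Hash) (x : ℝ)
    (h : List (Config P Tx Hash)) : ENNReal :=
  if (d.stateOf Pr h).rel then
    if Good Pr d h then ENNReal.ofReal (d.potential x (d.stateOf Pr h)) else 1
  else ENNReal.ofReal (x ^ d.L)

/-- The three values of `risk` fit together: at the release the potential is at most `x ^ L`,
afterwards it decreases on average, and it is at least `1` when the lead is lost. Failure of the
invariant for another reason would need an election of `q`, a null event. -/
theorem lintegral_risk_succ_le (hd : d.OK Pr) {M : Finset P} (hM : d.Majority Pr M) {x ρ : ℝ}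
    (hx : Rate Pr x ρ) (hS : d.S = ∅) (hl : d.l = []) (n : ℕ) :
    ∫⁻ ω, risk Pr d x (d.hist Pr ω (n + 1)) ∂Pr.randomness ≤
      1 * ∫⁻ ω, risk Pr d x (d.hist Pr ω n) ∂Pr.randomness := by
  have hx0 := hx.1
  have hx1 := hx.2.1
  refine lintegral_history_succ_le _ _ (risk Pr d x) _ n fun ω => ?_
  rw [one_mul]
  set s := d.stateOf Pr (d.hist Pr ω n) with hs
  set c := d.run Pr ω n with hc
  change ∫⁻ ω', risk Pr d x (Pr.step ω' (d.action Pr s c) c :: d.hist Pr ω n) ∂Pr.randomness ≤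
    risk Pr d x (d.hist Pr ω n)
  have hleg : Pr.Legal c (d.action Pr s c) := legal_run hd ω n
  have hst : ∀ c', d.stateOf Pr (c' :: d.hist Pr ω n) = d.update Pr s c' := fun _ => rfl
  by_cases hr : s.rel
  · by_cases hg : Good Pr d (d.hist Pr ω n)
    · have hg' := hg
      rw [hist_eq] at hg'
      have hg₂ := hg'.2
      rw [← hist_eq] at hg₂
      obtain ⟨ht, hready, hlead⟩ := hg₂ hr
      have hRHS : risk Pr d x (d.hist Pr ω n) = ENNReal.ofReal (d.potential x s) := by
        unfold risk
        rw [if_pos hr, if_pos hg]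
      rw [hRHS]
      refine le_trans ?_ ((lintegral_potential_le hd hM hx hready ht
        fun _ => ⟨hS, hl, hlead⟩).trans ?_)
      · refine lintegral_mono_ae ?_
        filter_upwards [ae_not_wins hd hM hready ht fun _ => ⟨hl, hlead⟩] with ω' hω'
        set c' := Pr.step ω' (d.action Pr s c) c with hc'
        have hready' : d.Ready Pr (d.update Pr s c') c' :=
          (hready.step hd ω' hleg fun _ => ⟨hS, hl, hlead, hω'⟩).ready hd
        unfold risk
        rw [hst, if_pos (rel_update hr)]
        split_ifs with hg₁
        · exact le_rfl
        · rw [← ENNReal.ofReal_one]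
          refine ENNReal.ofReal_le_ofReal ?_
          -- The invariant persists, so the history can stop being good only through the loss of the
          -- lead.
          have hlt : (d.update Pr s c').priv.length < (d.update Pr s c').pub.length := by
            by_contra hle
            exact hg₁ ⟨hg, fun _ => ⟨ht.trans (Nat.le_succ _), hready', not_lt.1 hle⟩⟩
          rw [← pow_zero x]
          exact le_potential (s := d.update Pr s c') hx0 hx1 (by omega)
      · refine mul_le_of_le_one_left zero_le ?_
        rw [ENNReal.ofReal_le_one]
        exact hx.2.2.2.1.le
    · have hRHS : risk Pr d x (d.hist Pr ω n) = 1 := by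
        unfold risk
        rw [if_pos hr, if_neg hg]
      have hLHS : ∀ c', risk Pr d x (c' :: d.hist Pr ω n) = 1 := by
        intro c'
        unfold risk
        rw [hst, if_pos (rel_update hr), if_neg fun h => hg h.1]
      simp [hRHS, hLHS]
  · have hready := ready_run hd (not_rel_tail hr)
    have hRHS : risk Pr d x (d.hist Pr ω n) = ENNReal.ofReal (x ^ d.L) := by
      unfold risk
      rw [if_neg hr]
    rw [hRHS]
    refine (lintegral_mono (g := fun _ => ENNReal.ofReal (x ^ d.L)) fun ω' => ?_).trans
      (by simp)
    set c' := Pr.step ω' (d.action Pr s c) c with hc'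
    have hready' : d.Ready Pr (d.update Pr s c') c' :=
      (hready.step hd ω' hleg fun h => absurd h hr).ready hd
    dsimp only
    unfold risk
    rw [hst]
    split_ifs with h₁ h₂
    · obtain ⟨-, h₃, h₄⟩ := h₁.resolve_left hr
      exact ENNReal.ofReal_le_ofReal (potential_le hx0 hx1 h₃ h₄)
    · obtain ⟨h₃, h₄, h₅⟩ := h₁.resolve_left hr
      refine absurd ⟨good_of_not_rel _ hr, fun _ => ⟨h₃, hready', ?_⟩⟩ h₂
      change (d.nextPub Pr s c').length ≤ (d.nextPriv Pr s c').length
      omega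
    · exact le_rfl

/-- The probability that the private chain loses its lead after it was revealed is small. -/
theorem randomness_not_good_le (hd : d.OK Pr) {M : Finset P} (hM : d.Majority Pr M) {x ρ : ℝ}
    (hx : Rate Pr x ρ) (hS : d.S = ∅) (hl : d.l = []) :
    Pr.randomness {ω | ∃ n, (d.stateOf Pr (d.hist Pr ω n)).rel ∧ ¬ Good Pr d (d.hist Pr ω n)} ≤
      ENNReal.ofReal (x ^ d.L) := by
  have hE : ∀ n, ∫⁻ ω, risk Pr d x (d.hist Pr ω n) ∂Pr.randomness ≤
      ENNReal.ofReal (x ^ d.L) := by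
    intro n
    induction n with
    | zero =>
      have : ∀ ω, risk Pr d x (d.hist Pr ω 0) = ENNReal.ofReal (x ^ d.L) := fun ω =>
        if_neg fun hr => lt_irrefl _ ((ready_run (n := 0) (ω := ω) hd id).rel hr)
      simp [this]
    | succ n ih =>
      refine (lintegral_risk_succ_le hd hM hx hS hl n).trans ?_
      rwa [one_mul]
  let B : ℕ → Set (Key P Tx Hash → Rnd) := fun n =>
    {ω | (d.stateOf Pr (d.hist Pr ω n)).rel ∧ ¬ Good Pr d (d.hist Pr ω n)}
  -- A loss of the lead is remembered by `Good`, so the events increase and a bound at each fixed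
  -- time is enough.
  have hB : Monotone B := monotone_nat_of_le_succ fun n ω hω =>
    ⟨rel_update hω.1, fun h => hω.2 h.1⟩
  have hset : {ω | ∃ n, (d.stateOf Pr (d.hist Pr ω n)).rel ∧ ¬ Good Pr d (d.hist Pr ω n)} =
      ⋃ n, B n := by
    ext ω
    simp [B]
  rw [hset, hB.measure_iUnion]
  refine iSup_le fun n => le_trans ?_ (hE n)
  have := mul_meas_ge_le_lintegral (μ := Pr.randomness)
    (measurable_hist (d := d) (Pr := Pr) (risk Pr d x) n) 1
  rw [one_mul] at this
  refine le_trans (measure_mono fun ω hω => ?_) this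
  change 1 ≤ risk Pr d x (d.hist Pr ω n)
  unfold risk
  rw [if_pos hω.1, if_neg hω.2]

theorem byz_run_subset (hd : d.OK Pr) (n : ℕ) : (d.run Pr ω n).byz ⊆ d.A := by
  induction n with
  | zero => exact hd.byz
  | succ n ih =>
    rw [run_succ, step_byz]
    exact Finset.union_subset ih subset_rfl

theorem correct_run (hd : d.OK Pr) {p : P} (hp : p ∈ d.start.active \ d.A) :
    Correct (d.run Pr ω) p :=
  ⟨⟨0, (Finset.mem_sdiff.1 hp).1⟩,
    fun n h => (Finset.mem_sdiff.1 hp).2 (byz_run_subset hd n h)⟩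

theorem q_mem_active {n n' : ℕ} (h : n < n') (hr : (d.stateOf Pr (d.hist Pr ω n)).rel) :
    d.q ∈ (d.run Pr ω n').active := by
  induction n', h using Nat.le_induction with
  | base =>
    rw [run_succ, step_active]
    refine Finset.mem_union_right _ ?_
    have hj : (d.action Pr (d.stateOf Pr (d.hist Pr ω n)) (d.run Pr ω n)).join = {d.q} :=
      if_pos hr
    rw [hj]
    exact Finset.mem_singleton_self _
  | succ m _ ih =>
    rw [run_succ, step_active]
    exact Finset.mem_union_left _ ih

theorem OK.q_notMem_A (hd : d.OK Pr) : d.q ∉ d.A := fun hq => hd.q_notMem (hd.active hq)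

theorem correct_q (hd : d.OK Pr) {n : ℕ} (hr : (d.stateOf Pr (d.hist Pr ω n)).rel) :
    Correct (d.run Pr ω) d.q :=
  ⟨⟨n + 1, q_mem_active n.lt_succ_self hr⟩, fun m h => hd.q_notMem_A (byz_run_subset hd m h)⟩

/-- The long-range attack succeeds almost surely. -/
theorem exists_attackSucceeds (hd : d.OK Pr)
    (h : ∃ n, (d.stateOf Pr (d.hist Pr ω n)).rel) :
    ∃ n, AttackSucceeds Pr d.start d.base d.fork d.S d.l (d.run Pr ω n) := by
  obtain ⟨n, hr, hr'⟩ := exists_first_release h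
  obtain ⟨-, hN, hL⟩ := release_spec hr hr'
  exact ⟨n + 1, (ready_run hd hr').attackSucceeds hd ω hr
    (fun hq => hr' ((inv_of_not_rel hd n hr').q_active.1 hq)) hN hL⟩

/-- Total order is violated if the first private block changes the order of two transactions. -/
theorem not_totalOrder (hd : d.OK Pr) (h : ∃ n, (d.stateOf Pr (d.hist Pr ω n)).rel) {p : P}
    (hp : p ∈ d.start.active \ d.A) {tx₁ tx₂ : Tx}
    (h₁ : [tx₁, tx₂].Sublist (d.start.loc p).delivered) (h₂ : [tx₂, tx₁].Sublist d.l) :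
    ¬ TotalOrder (d.run Pr ω) := by
  obtain ⟨n, hr, hr'⟩ := exists_first_release h
  obtain ⟨-, hN, hL⟩ := release_spec hr hr'
  have hfork := hd.fork_lt_N
  have hsub : d.l.Sublist ((d.run Pr ω (n + 1)).loc d.q).delivered :=
    (ready_run hd hr').sublist_delivered hd ω hr
      (fun hq => hr' ((inv_of_not_rel hd n hr').q_active.1 hq)) (by omega)
  have h₃ := h₂.trans hsub
  intro hto
  obtain ⟨m, hm⟩ := hto p d.q tx₁ tx₂ (correct_run hd hp) (correct_q hd hr)
    ⟨n + 1, h₃.subset (by simp)⟩ ⟨n + 1, h₃.subset (by simp)⟩ ⟨0, h₁⟩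
  have hnd := ((reachable_run (ω := ω) hd (max m (n + 1))).globOK.loc d.q
    (Finset.mem_sdiff.2 ⟨q_mem_active (lt_max_of_lt_right n.lt_succ_self) hr,
      fun hq => hd.q_notMem_A (byz_run_subset hd _ hq)⟩)).nodup
  exact not_sublist_swap hnd
    (hm.trans (evol_run hd (le_max_left m (n + 1)) d.q).delivered.sublist)
    (h₃.trans (evol_run hd (le_max_right m (n + 1)) d.q).delivered.sublist)

/-- Agreement is violated if the private chain does not lose its lead after it was revealed. -/
theorem not_agreement (hd : d.OK Pr) {h₁ : ℕ} (hN : h₁ + 1 + Pr.k < d.N)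
    {tx : Tx} (htx : tx ∈ txsOf (upTo d.base h₁)) (htx' : tx ∉ txsOf (upTo d.base d.fork))
    (h : ∃ n, (d.stateOf Pr (d.hist Pr ω n)).rel)
    (hg : ∀ n, (d.stateOf Pr (d.hist Pr ω n)).rel → Good Pr d (d.hist Pr ω n)) :
    ¬ Agreement (d.run Pr ω) := by
  obtain ⟨n, hr, hr'⟩ := exists_first_release h
  obtain ⟨-, hNn, -⟩ := release_spec hr hr'
  obtain ⟨p, hp⟩ := hd.nonempty
  have hpA := (Finset.mem_sdiff.1 hp).2
  have hpq : p ≠ d.q := by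
    rintro rfl
    exact hd.q_notMem (Finset.mem_sdiff.1 hp).1
  have hpn : p ∈ (d.run Pr ω n).active := active_subset_run n (Finset.mem_sdiff.1 hp).1
  have hinv := inv_of_not_rel hd n hr'
  have hdel : tx ∈ ((d.run Pr ω n).loc p).delivered := by
    refine ((reachable_run (ω := ω) hd n).globOK.loc p (Finset.mem_sdiff.2
      ⟨hpn, fun hb => hpA (byz_run_subset hd n hb)⟩)).deep tx
      (txsOf_subset_of_prefix (C := upTo d.base h₁) ?_ htx)
    rw [hinv.pub p (Finset.mem_sdiff.2 ⟨hpn, hpA⟩) hpq]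
    refine List.prefix_of_prefix_length_le
      ((upTo_prefix _ _).trans (ExtensionBy.base_prefix hinv.ext)) (dropLastK_prefix _ _) ?_
    -- The local chain is the public chain before its last update and may be one block shorter than
    -- `N`; the strict inequality in `hN` pays for this block.
    rw [stateOf_hist] at hNn
    have := length_update_pub_le (Pr := Pr) (d := d) (d.stateOf Pr (d.hist Pr ω n).tail)
      (d.run Pr ω n)
    simp only [upTo, dropLastK, List.length_take]
    omega
  intro hag
  obtain ⟨m, hm⟩ := hag p d.q tx (correct_run hd hp) (correct_q hd hr) ⟨n, hdel⟩
  -- A time after both the supposed delivery and the joining of `q`; goodness there says that `q`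
  -- has delivered nothing beyond the fork.
  have hr₂ := rel_mono (n' := max m (n + 1)) (by omega) hr
  have hg₂ := hg _ hr₂
  have hr₃ := hr₂
  rw [hist_eq] at hg₂ hr₃
  have hready := (hg₂.2 hr₃).2.1
  exact htx' (hready.q_delivered (q_mem_active (lt_max_of_lt_right n.lt_succ_self) hr) tx
    ((evol_run hd (le_max_left m (n + 1)) d.q).delivered.subset hm))

end Plan

end Release

/-! ### Choice of the parameters of the attack. -/

theorem mainTheorem2 {P Tx Hash Rnd : Type*} [DecidableEq P] [Infinite P] [MeasurableSpace Rnd]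
    (Pr : Params P Tx Hash Rnd) (hRA : 2 * Pr.RA ≤ Pr.R)
    (c : Config P Tx Hash) (hc : Pr.Reachable c)
    (C : Chain P Tx Hash) (hC : ∀ j ∈ c.active \ c.byz, (c.loc j).chain = C)
    (h₀ h₁ : ℕ) (M : Finset P) (hM : ShiftingEvent Pr C h₀ h₁ M)
    (A : Finset P) (hMA : M ⊆ A) (hbyz : c.byz ⊆ A) (hA : A ⊆ c.active)
    (hcorrect : (c.active \ A).Nonempty)
    (hbudget : ∀ C', ExtensionBy Pr (pending c A) C C' →
      ∑ p ∈ A, Pr.stateAlloc p C' = Pr.RA) :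
    (∀ S ⊆ c.active \ A, ∀ l : List Tx, Pr.validTx (upTo C h₀) l →
      Pr.R < (∑ p ∈ M, Pr.ledger (txsOf (upTo C h₀) ++ l) p) + Pr.RA →
      ∃ σ : Strategy P Tx Hash, Pr.Admissible σ c ∧ ∀ᵐ ω ∂Pr.randomness,
        (∃ n, AttackSucceeds Pr c C h₀ S l (Pr.exec σ c ω n)) ∧
        ∀ p ∈ c.active \ A, ∀ tx₁ tx₂, [tx₁, tx₂].Sublist (c.loc p).delivered →
          [tx₂, tx₁].Sublist l → ¬ TotalOrder (Pr.exec σ c ω)) ∧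
    ∀ ε : ENNReal, 0 < ε → ∃ σ : Strategy P Tx Hash, Pr.Admissible σ c ∧
      Pr.randomness {ω | TotalOrderBroadcast Pr (Pr.exec σ c ω)} ≤ ε ∧
      Pr.randomness {ω | Agreement (Pr.exec σ c ω)} ≤ ε := by
  have hbefore := hM.active_before
  have hafter := hM.inactive_after
  have hlt := hM.lt
  have hlen := hM.lt_length
  -- `M` cannot hold more than the total `R`, so a share above `R - R_A` forces `R_A` to be
  -- positive.
  have hRA0 : 0 < Pr.RA := by
    have := Plan.sum_le_R (Pr := Pr) M (txsOf (upTo C h₀))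
    unfold Params.stateAlloc at hbefore
    omega
  obtain ⟨T, hT⟩ := eventually_atTop.1 (Pr.cutoff_tendsto.eventually_ge_atTop c.time)
  -- The newcomer must not have joined and must hold nothing at height `h₀`; both exclude only
  -- finitely many processes.
  obtain ⟨q, hq⟩ := Infinite.exists_notMem_finset
    (c.active ∪ (Pr.ledger (txsOf (upTo C h₀))).support)
  rw [Finset.mem_union, not_or] at hq
  obtain ⟨x, ρ, hx⟩ := Plan.exists_rate (Pr := Pr) hRA0
  have hOK : ∀ S ⊆ c.active \ A, ∀ l, Pr.validTx (upTo C h₀) l → ∀ L, 0 < L →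
      (⟨c, C, h₀, A, S, q, l, h₁ + 2 + Pr.k, L, T⟩ : Plan P Tx Hash).OK Pr := by
    intro S hS l hl L hL
    exact {
      reach := hc
      chain := hC
      fork_lt := by change h₀ + 1 < C.length; omega
      byz := hbyz
      active := hA
      nonempty := hcorrect
      budget := hbudget
      S_subset := hS
      q_notMem := hq.1
      valid := hl
      L_pos := hL
      fork_lt_N := by change h₀ + 1 + Pr.k < h₁ + 2 + Pr.k; omega
      cutoff := hT }
  have hMaj : ∀ S l L, Pr.R < (∑ p ∈ M, Pr.ledger (txsOf (upTo C h₀) ++ l) p) + Pr.RA →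
      (⟨c, C, h₀, A, S, q, l, h₁ + 2 + Pr.k, L, T⟩ : Plan P Tx Hash).Majority Pr M :=
    fun S l L hl => ⟨by omega, hMA, hbefore, hl, Finsupp.notMem_support_iff.1 hq.2⟩
  constructor
  · intro S hS l hl hl'
    have hd := hOK S hS l hl 1 one_pos
    refine ⟨_, Plan.admissible hd, ?_⟩
    filter_upwards [Plan.ae_release hd (hMaj S l 1 hl') hx] with ω hω
    exact ⟨Plan.exists_attackSucceeds hd hω,
      fun p hp tx₁ tx₂ h h' => Plan.not_totalOrder hd hω hp h h'⟩
  · intro ε hε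
    obtain ⟨L, hL, hL0⟩ : ∃ L, ENNReal.ofReal (x ^ L) ≤ ε ∧ 0 < L := by
      have h := ENNReal.tendsto_pow_atTop_nhds_zero_of_lt_one (ENNReal.ofReal_lt_one.2 hx.2.1)
      obtain ⟨L, h₁, h₂⟩ := ((h.eventually_lt_const hε).and (eventually_gt_atTop 0)).exists
      refine ⟨L, ?_, h₂⟩
      rw [ENNReal.ofReal_pow hx.1.le]
      exact h₁.le
    have hd := hOK ∅ (Finset.empty_subset _) [] (Pr.validTx_nil _) L hL0
    have hM' := hMaj ∅ [] L (by rw [List.append_nil]; exact hbefore)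
    obtain ⟨tx, htx, htx'⟩ : ∃ tx ∈ txsOf (upTo C h₁), tx ∉ txsOf (upTo C h₀) := by
      have hpre : upTo C h₀ <+: upTo C h₁ := List.take_prefix_take_left (by omega)
      obtain ⟨E, hE⟩ := hpre
      -- Without transactions between `h₀` and `h₁` both heights have the same distribution, so `M`
      -- would hold more than `R - R_A ≥ R_A` and at most `R_A`.
      have hne : txsOf E ≠ [] := by
        intro h
        rw [← hE] at hafter
        unfold Params.stateAlloc at hafter hbefore
        rw [txsOf_append, h, List.append_nil] at hafter
        omega
      obtain ⟨tx, htx⟩ := List.exists_mem_of_ne_nil _ hne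
      refine ⟨tx, ?_, ?_⟩
      · rw [← hE, txsOf_append]
        exact List.mem_append_right _ htx
      · have hlen₀ := Plan.length_upTo_fork hd
        have hv := hd.base_facts.1.of_prefix (Plan.upTo_prefix C h₁) (by
          rw [← hE]
          exact List.append_ne_nil_of_left_ne_nil
            (List.ne_nil_of_length_pos (by rw [hlen₀]; omega)) _)
        rw [← hE] at hv
        exact hv.fresh (List.ne_nil_of_length_pos (by rw [hlen₀]; omega)) tx htx
    have hag : Pr.randomness {ω | Agreement (Pr.exec 
        (Plan.strategy ⟨c, C, h₀, A, ∅, q, [], h₁ + 2 + Pr.k, L, T⟩ Pr) c ω)} ≤ ε := by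
      -- Up to a null set, agreement can hold only if the revealed chain loses its lead. This
      -- compares outer measures, so measurability of the agreement event is not needed.
      refine le_trans ?_ ((Plan.randomness_not_good_le hd hM' hx rfl rfl).trans hL)
      refine measure_mono_ae ?_
      filter_upwards [Plan.ae_release hd hM' hx] with ω hω hω'
      by_contra hg
      refine Plan.not_agreement hd ?_ htx htx' hω (fun n hn => ?_) hω'
      · change h₁ + 1 + Pr.k < h₁ + 2 + Pr.k
        omega
      · by_contra hg'
        exact hg ⟨n, hn, hg'⟩
    refine ⟨_, Plan.admissible hd, (measure_mono fun ω hω => hω.agreement).trans hag, hag⟩
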